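/- **Setting.** Let $d\in\mathbb N$, let $L$ be a real $d\times d$ matrix with $\det L\neq 0$, $\mathcal L=L\mathbb Z^d$, $\mathcal C=L[-\frac12,\frac12]^d$, $L^*=2\pi (L^T)^{-1}$ and $\mathcal B=L^*[-\frac12,\frac12]^d$. Let $W$ be a bounded measurable $\mathcal L$-periodic function on $\mathbb R^d$ with $W\ge 1$, and let $(E_n,v_n)_{n\in\mathbb N}$ be the eigenpairs, with $E_0\le E_1\le\cdots$, of $-\frac12\Delta+W$ on $\mathcal C$ with periodic boundary conditions (in the weak sense, $v_n\in H^1_{\rm per}$), the $v_n$ being extended $\mathcal L$-periodically and forming an orthonormal basis of $L^2(\mathcal C)$. Put $P_{nn'}=\int_{\mathcal C}\overline{v_n}\,\nabla v_{n'}\,dx\in\mathbb C^d$. Let $\mathcal L^2=\ell^2(\mathbb N,L^2(\mathbb R^d))$ and, for $\mu\ge0$, let $\mathcal L^2_\mu$ be the set of $g\in\mathcal L^2$ with $\|g\|_{\mathcal L^2_\mu}^2=\sum_n\int(1+|k|^2)^{\mu}|g_n(k)|^2\,dk<\infty$. Fourier transforms are $\hat f(k)=(2\pi)^{-d/2}\int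 e^{-ik\cdot x}f(x)\,dx$. Let $\mathcal W_\mu$ be the set of real $V\in L^\infty(\mathbb R^d_x\times\mathbb R^d_z)$, $\mathcal L$-periodic in $z$, such that for a.e. $z$ the function $V(\cdot,z)$ has an integrable Fourier transform $\hat V(\cdot,z)$, i.e. $V(x,z)=(2\pi)^{-d/2}\int e^{ik\cdot x}\hat V(k,z)\,dk$ for all $x$ (this fixes the representative, continuous in $x$, that is used in $V(x,x/\epsilon)$), with $\hat V$ measurable in $(k,z)$ and $$\|V\|_{\mathcal W_\mu}=(2\pi)^{-d/2}\operatorname*{ess\,sup}_{z\in\mathcal C}\int(1+|k|)^\mu|\hat V(k,z)|\,dk<\infty .$$ For $\epsilon>0$ define the following operators in $\mathcal L^2$. * $(A^\epsilon_{\rm kp}g)_n(k)=\big(\frac{E_n}{\epsilon^2}+\frac{|k|^2}2\big)g_n(k)-\frac i\epsilon\sum_{n'}k\cdot P_{nn'}\,g_{n'}(k)$, on the domain of all $g\in\mathcal L^2$ such that $\sum_n|E_ng_n(k)|^2<\infty$ for a.e. $k$ and the right-hand side defines an element of $\mathcal L^2$. * $\mathcal U^\epsilon$: given $g$, let $\psi=|\mathcal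 C|^{1/2}\sum_n f_n\,v_n(\cdot/\epsilon)$ in $L^2(\mathbb R^d)$ with $\hat f_n=\mathbf 1_{\mathcal B/\epsilon}g_n$. Then $\mathcal U^\epsilon g=(h_n)_n$, where the $h_n$ are the Fourier transforms of the $\epsilon$-scaled envelope functions of $V(x,x/\epsilon)\psi(x)$: $(h_n)_n\in\mathcal L^2$ is the sequence with $h_n=0$ a.e. outside $\mathcal B/\epsilon$ and $V(\cdot,\cdot/\epsilon)\psi=|\mathcal C|^{1/2}\sum_n \mathcal F^{-1}(h_n)\,v_n(\cdot/\epsilon)$ in $L^2(\mathbb R^d)$. * $(\mathcal U^0g)_n(k)=\sum_{n'}(2\pi)^{-d/2}\int\hat V_{nn'}(k-k')g_{n'}(k')\,dk'$ (series in $L^2(\mathbb R^d)$), where $V_{nn'}(x)=\int_{\mathcal C}\overline{v_n(z)}\,v_{n'}(z)\,V(x,z)\,dz$. A mild solution of $i\partial_tg=(A+U)g$, $g(0)=g^{in}$, is a continuous $g:[0,\infty)\to\mathcal L^2$ such that, for every $t\ge0$, $\int_0^tg(s)\,ds$ lies in the domain of $A+U$ and $g(t)=g^{in}-i(A+U)\int_0^tg(s)\,ds$.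 **Theorem.** Let $\mu\ge0$, $V\in\mathcal W_\mu$ and $\tau\ge0$. There is a constant $C=C(\mu,V,\tau)\ge0$, depending only on $\mu,V,\tau$ and the lattice (in particular not on $\epsilon$ or on the initial datum), such that for every $\epsilon>0$ and every $g^{in}=g^{in,\epsilon}\in\mathcal L^2_\mu$: if $g^\epsilon$ is the mild solution of $i\partial_tg=(A^\epsilon_{\rm kp}+\mathcal U^\epsilon)g$, $g(0)=g^{in}$ (exact dynamics), and $g^\epsilon_{\rm kp}$ is the mild solution of $i\partial_tg=(A^\epsilon_{\rm kp}+\mathcal U^0)g$, $g(0)=g^{in}$ (k$\cdot$p dynamics), then $$\|g^\epsilon(t)-g^\epsilon_{\rm kp}(t)\|_{\mathcal L^2}\le \epsilon^\mu\,C\,\|g^{in}\|_{\mathcal L^2_\mu}\qquad\text{for all }0\le t\le\tau .$$ -/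

import Mathlib

open MeasureTheory Set Filter Topology
open scoped ENNReal ContDiff ComplexConjugate Matrix

noncomputable section

namespace KP

/-- Euclidean space `ℝ^d`. -/
abbrev Sp (d : ℕ) : Type := EuclideanSpace ℝ (Fin d)

variable {d : ℕ}

/-! ### Lattice, cell, Brillouin zone -/

/-- The linear map `t ↦ L t` with values in Euclidean space. -/
def latMap (L : Matrix (Fin d) (Fin d) ℝ) (t : Fin d → ℝ) : Sp d :=
  WithLp.toLp 2 (L *ᵥ t)

/-- Centered fundamental domain `{L t | t ∈ [-1/2, 1/2]^d}` of the lattice `L ℤ^d`. -/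
def cell (L : Matrix (Fin d) (Fin d) ℝ) : Set (Sp d) :=
  latMap L '' {t | ∀ i, t i ∈ Icc (-(1 / 2) : ℝ) (1 / 2)}

/-- Generator of the reciprocal lattice: `Lᵀ L* = 2π I`. -/
def recip (L : Matrix (Fin d) (Fin d) ℝ) : Matrix (Fin d) (Fin d) ℝ :=
  (2 * Real.pi) • (Lᵀ)⁻¹

/-- The Brillouin zone: the centered fundamental domain of the reciprocal lattice. -/
def brillouin (L : Matrix (Fin d) (Fin d) ℝ) : Set (Sp d) := cell (recip L)

/-- The scaled Brillouin zone `𝓑/ε`. -/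
def brillouinScaled (L : Matrix (Fin d) (Fin d) ℝ) (ε : ℝ) : Set (Sp d) :=
  {k | ε • k ∈ brillouin L}

/-- Periodicity with respect to the lattice `L ℤ^d`. -/
def IsPeriodic {α : Type*} (L : Matrix (Fin d) (Fin d) ℝ) (f : Sp d → α) : Prop :=
  ∀ (m : Fin d → ℤ) (x : Sp d), f (x + latMap L (fun i => (m i : ℝ))) = f x

/-! ### Bloch functions at zero wavevector -/

/-- Classical partial derivative (used for test functions only). -/
def partialDeriv (j : Fin d) (φ : Sp d → ℂ) (x : Sp d) : ℂ :=
  fderiv ℝ φ x (EuclideanSpace.single j 1)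

/-- Periodic smooth test functions. -/
def IsPerTest (L : Matrix (Fin d) (Fin d) ℝ) (φ : Sp d → ℂ) : Prop :=
  ContDiff ℝ ∞ φ ∧ IsPeriodic L φ

/-- The crystal potential: measurable, bounded, lattice-periodic, and at least one. -/
structure IsCrystalPotential (L : Matrix (Fin d) (Fin d) ℝ) (W : Sp d → ℝ) : Prop where
  measurable : Measurable W
  periodic : IsPeriodic L W
  one_le : ∀ x, 1 ≤ W x
  bounded : ∃ M, ∀ x, W x ≤ M

/-- `(E n, v n)` is the sequence of eigenpairs of `-½Δ + W` on the cell with periodic boundary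
conditions, listed with multiplicity in nondecreasing order; the `v n` form an orthonormal basis
of `L²(𝓒)` and lie in the periodic Sobolev space `H¹`, with weak gradient
`dv n = (∂₁ v n, …, ∂_d v n)`. The eigenvalue equation is understood weakly. -/
structure IsBlochBasis (L : Matrix (Fin d) (Fin d) ℝ) (W : Sp d → ℝ) (E : ℕ → ℝ)
    (v : ℕ → Sp d → ℂ) (dv : ℕ → Fin d → Sp d → ℂ) : Prop where
  periodic : ∀ n, IsPeriodic L (v n)
  memLp : ∀ n, MemLp (v n) 2 (volume.restrict (cell L))
  orthonormal : ∀ n m, ∫ x in cell L, conj (v n x) * v m x = if n = m then 1 else 0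
  complete : ∀ φ : Sp d → ℂ, MemLp φ 2 (volume.restrict (cell L)) →
    (∀ n, ∫ x in cell L, conj (v n x) * φ x = 0) → φ =ᵐ[volume.restrict (cell L)] 0
  grad_memLp : ∀ n j, MemLp (dv n j) 2 (volume.restrict (cell L))
  weak_grad : ∀ n j φ, IsPerTest L φ →
    ∫ x in cell L, v n x * partialDeriv j φ x = -∫ x in cell L, dv n j x * φ x
  eigen : ∀ n φ, IsPerTest L φ →
    (1 / 2 : ℂ) * ∑ j, (∫ x in cell L, dv n j x * partialDeriv j φ x)
      + ∫ x in cell L, (W x : ℂ) * v n x * φ x = (E n : ℂ) * ∫ x in cell L, v n x * φ x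
  monotone : Monotone E

/-- Matrix elements of the gradient, `P_{nn'} = ∫_𝓒 conj(v_n) ∇v_{n'}` (a vector in `ℂ^d`). -/
def gradElem (L : Matrix (Fin d) (Fin d) ℝ) (v : ℕ → Sp d → ℂ) (dv : ℕ → Fin d → Sp d → ℂ)
    (n n' : ℕ) (j : Fin d) : ℂ :=
  ∫ x in cell L, conj (v n x) * dv n' j x

/-! ### Spaces of sequences -/

/-- The Hilbert space `ℓ²(ℕ, L²(ℝ^d))`. -/
abbrev EnvSpace (d : ℕ) : Type := lp (fun _ : ℕ => Lp ℂ 2 (volume : Measure (Sp d))) 2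

/-- `∑_n ∫ (1+|k|²)^μ |g_n(k)|² dk`, with values in `[0, ∞]`. -/
def weightedSq (μ : ℝ) (g : EnvSpace d) : ℝ≥0∞ :=
  ∑' n, ∫⁻ k : Sp d, ENNReal.ofReal ((1 + ‖k‖ ^ 2) ^ μ) * ‖g n k‖ₑ ^ 2

/-- Membership in the weighted space `𝓛²_μ`. -/
def MemL2mu (μ : ℝ) (g : EnvSpace d) : Prop := weightedSq μ g < ⊤

/-- The norm of `𝓛²_μ` (meaningful for members). -/
def normL2mu (μ : ℝ) (g : EnvSpace d) : ℝ := Real.sqrt (weightedSq μ g).toReal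

/-! ### External potentials -/

/-- The normalization constant `(2π)^{-d/2}` of the Fourier transform. -/
def fourierConst (d : ℕ) : ℝ := (2 * Real.pi) ^ (-(d : ℝ) / 2)

/-- `e^{i k·x}`. -/
def planeWave (k x : Sp d) : ℂ := Complex.exp (Complex.I * ((inner ℝ k x : ℝ) : ℂ))

/-- `w` is the Fourier transform, as an integrable function, of the bounded continuous function
`f`: `f(x) = (2π)^{-d/2} ∫ e^{ik·x} w(k) dk`. This makes sense without integrability of `f`, and
it determines `w` almost everywhere. -/
def HasFourierL1 (f w : Sp d → ℂ) : Prop :=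
  Integrable w ∧ ∀ x, f x = (fourierConst d : ℂ) * ∫ k, planeWave k x * w k

/-- `‖V‖_{𝓦_μ}` in terms of the partial Fourier transform `Vhat (k, z)`. -/
def normW (L : Matrix (Fin d) (Fin d) ℝ) (μ : ℝ) (Vhat : Sp d → Sp d → ℂ) : ℝ≥0∞ :=
  ENNReal.ofReal (fourierConst d) *
    essSup (fun z => ∫⁻ k : Sp d, ENNReal.ofReal ((1 + ‖k‖) ^ μ) * ‖Vhat k z‖ₑ)
      (volume.restrict (cell L))

/-- The class `𝓦_μ` of real potentials `V(x, z)`, `V ∈ L^∞(ℝ^{2d})`, lattice-periodic in `z`, with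
finite `𝓦_μ`-norm. For almost every `z`, `V(·, z)` has an integrable Fourier transform, hence is
(after a change on a null set) continuous; `V` denotes that representative, which is what gives
`V(x, x/ε)` a meaning. -/
structure MemW (L : Matrix (Fin d) (Fin d) ℝ) (μ : ℝ) (V : Sp d → Sp d → ℝ) : Prop where
  memLp : MemLp (Function.uncurry V) ⊤ (volume.prod volume)
  periodic : ∀ x, IsPeriodic L (V x)
  norm_lt_top : ∃ Vhat : Sp d → Sp d → ℂ, Measurable (Function.uncurry Vhat) ∧
    (∀ᵐ z : Sp d, HasFourierL1 (fun x => (V x z : ℂ)) (fun k => Vhat k z)) ∧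
    normW L μ Vhat < ⊤

/-! ### The operators, as graphs: `h` is the image of `g` -/

/-- `h = A_kp^ε g`, the fibered operator with fibers
`ε⁻² A(εk)`, `A(ξ)_{nn'} = (E_n + |ξ|²/2) δ_{nn'} - i ξ·P_{nn'}`, each on the domain
`{c ∈ ℓ² | ∑ |E_n c_n|² < ∞}`. Since `h` ranges over `ℓ²(ℕ, L²)`, this includes the condition
`∫ ‖ε⁻² A(εk) g(k)‖² dk < ∞` in the domain. -/
def IsAkp (E : ℕ → ℝ) (P : ℕ → ℕ → Fin d → ℂ) (ε : ℝ) (g h : EnvSpace d) : Prop :=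
  ∀ᵐ k : Sp d, Summable (fun n => ‖(E n : ℂ) * g n k‖ ^ 2) ∧
    ∀ n, h n k = ((E n / ε ^ 2 + ‖k‖ ^ 2 / 2 : ℝ) : ℂ) * g n k
      - Complex.I / (ε : ℂ) * ∑' n', (∑ j, (k j : ℂ) * P n n' j) * g n' k

/-- The function `(2π)^{-d/2} ∫_{𝓑/ε} e^{ik·x} c(k) dk`, i.e. the inverse Fourier transform of
`c` cut off to the scaled Brillouin zone. -/
def envFun (L : Matrix (Fin d) (Fin d) ℝ) (ε : ℝ) (c : Sp d → ℂ) (x : Sp d) : ℂ :=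
  (fourierConst d : ℂ) * ∫ k in brillouinScaled L ε, planeWave k x * c k

/-- `ψ = |𝓒|^{1/2} ∑_n f_n v_n(·/ε)` in `L²(ℝ^d)`, where `f_n` is the inverse Fourier transform
of `𝟙_{𝓑/ε} g_n`. -/
def IsSynthesis (L : Matrix (Fin d) (Fin d) ℝ) (v : ℕ → Sp d → ℂ) (ε : ℝ)
    (g : EnvSpace d) (ψ : Sp d → ℂ) : Prop :=
  MemLp ψ 2 volume ∧
  Tendsto (fun N => eLpNorm (fun x => ψ x - (Real.sqrt (volume.real (cell L)) : ℂ) *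
    ∑ n ∈ Finset.range N, envFun L ε (fun k => g n k) x * v n (ε⁻¹ • x)) 2 volume) atTop (𝓝 0)

/-- `g` is the sequence of Fourier transforms of the `ε`-scaled envelope functions of `ψ`. -/
def IsEnvelope (L : Matrix (Fin d) (Fin d) ℝ) (v : ℕ → Sp d → ℂ) (ε : ℝ)
    (ψ : Sp d → ℂ) (g : EnvSpace d) : Prop :=
  (∀ n, ∀ᵐ k : Sp d, k ∉ brillouinScaled L ε → g n k = 0) ∧ IsSynthesis L v ε g ψ

/-- `h = 𝓤^ε g`: synthesize the wave function `ψ = ∑_n ∫ 𝓧^ε_{n,k} g_n(k) dk`, multiply it by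
`V(x, x/ε)`, and take Fourier transforms of envelope functions (pair with `𝓧^ε_{n,k}`). This is
the integral operator with the (in general oscillatory) kernel
`U^ε_{nn'}(k,k') = ∫ conj(𝓧^ε_{n,k}(x)) V(x, x/ε) 𝓧^ε_{n',k'}(x) dx`. -/
def IsUeps (L : Matrix (Fin d) (Fin d) ℝ) (v : ℕ → Sp d → ℂ) (V : Sp d → Sp d → ℝ) (ε : ℝ)
    (g h : EnvSpace d) : Prop :=
  ∃ ψ : Sp d → ℂ, IsSynthesis L v ε g ψ ∧
    IsEnvelope L v ε (fun x => (V x (ε⁻¹ • x) : ℂ) * ψ x) h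

/-- `V_{nn'}(x) = ∫_𝓒 conj(v_n(z)) v_{n'}(z) V(x, z) dz`. -/
def potElem (L : Matrix (Fin d) (Fin d) ℝ) (v : ℕ → Sp d → ℂ) (V : Sp d → Sp d → ℝ)
    (n n' : ℕ) (x : Sp d) : ℂ :=
  ∫ z in cell L, conj (v n z) * v n' z * (V x z : ℂ)

/-- `h = 𝓤⁰ g`: `h_n(k) = ∑_{n'} (2π)^{-d/2} ∫ V̂_{nn'}(k-k') g_{n'}(k') dk'`, where `V̂_{nn'}` is
the Fourier transform of `V_{nn'}` and the series converges in `L²(ℝ^d)`. -/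
def IsU0 (L : Matrix (Fin d) (Fin d) ℝ) (v : ℕ → Sp d → ℂ) (V : Sp d → Sp d → ℝ)
    (g h : EnvSpace d) : Prop :=
  ∃ Vhat : ℕ → ℕ → Sp d → ℂ, (∀ n n', HasFourierL1 (potElem L v V n n') (Vhat n n')) ∧
    ∀ n, Tendsto (fun N => eLpNorm (fun k => h n k - ∑ n' ∈ Finset.range N,
      (fourierConst d : ℂ) * ∫ k', Vhat n n' (k - k') * g n' k') 2 volume) atTop (𝓝 0)

/-- `g` is the mild solution, for `t ≥ 0`, of `i ∂_t g = A g + U g`, `g(0) = g₀`, the operators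
`A` and `U` being given by their graphs: `g` is continuous, `∫₀ᵗ g` lies in the domain, and
`g(t) = g₀ - i (A + U) ∫₀ᵗ g(s) ds`. -/
def IsMildSolution (A U : EnvSpace d → EnvSpace d → Prop) (g₀ : EnvSpace d)
    (g : ℝ → EnvSpace d) : Prop :=
  ContinuousOn g (Ici 0) ∧
  ∀ t, 0 ≤ t → ∃ a u : EnvSpace d, A (∫ s in (0 : ℝ)..t, g s) a ∧ U (∫ s in (0 : ℝ)..t, g s) u ∧
    g t = g₀ - Complex.I • (a + u)

end KP

end

open MeasureTheory Set Filter Topology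
open scoped ENNReal ContDiff ComplexConjugate Matrix

noncomputable section

namespace KP

variable {d : ℕ}

/-! ### Lattice geometry -/

/-! Identify a sequence `g` with the function `u(k,z) = ∑ g_n(k) v_n(z)` on `ℝ^d × 𝓒`.
Orthonormality makes this an isometry (`IsONSystem.synth`), and on the function side `z` is only a
parameter of integral operators in `k`. There `𝓤⁰` is convolution with `(2π)^{-d/2} V̂(·,z)`
(`IsPotHat.eq_of_isU0`). The operator `𝓤^ε` has the kernel `(2π)^{-d/2} ∑_λ e^{iλ·εz} V̂(k+λ-k',z)`
with `k, k'` restricted to `B = 𝓑/ε` and `λ` running over `ε⁻¹L*ℤ^d`: for fixed `z` the wave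
function is a Fourier integral sampled on `ε(z+𝓛)`, so frequencies of the product with `V` are
folded back into `B` (`IsSynthesis.ae_eq`, `alias_identity`, `IsPotHat.synth_eq_of_isUeps`).

The two kernels differ only in terms with a far frequency: `k` or `k'` lies outside `B`, or `λ ≠ 0`
and `k+λ` is not interior to `B`. Such a frequency has norm at least `r/ε`, where `r` is the radius
of a ball inside `𝓑`. Let `w(k) = min((1+|k|²)^{μ/2}, R)` with `R = (r/ε)^μ`. This weight equals `R`
at far frequencies and satisfies `w(k) ≤ (1+|k-k'|)^μ w(k')`, so each extra term, divided by
`w(k')`, is at most `R⁻¹ (1+|q|)^μ |V̂(q,z)|` up to the Fourier constant, `q` being its argument.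
Schur's test with `c = ‖V‖` gives `‖(𝓤^ε-𝓤⁰)u‖ ≤ 2cR⁻¹‖wu‖` (`IsPotHat.norm_opEps_sub_op0_le`) and
likewise `‖w𝓤⁰u‖ ≤ c‖wu‖` (`IsPotHat.norm_weight_op0_le`).

The `k·p` operator is symmetric (`IsAkp.inner_im`) and acts fiberwise in `k`, hence commutes with
`w` (`IsAkp.env`). An energy estimate bounds `w g_kp` by `w g^in`; a second one bounds the
difference of the solutions, driven by the source `(𝓤^ε-𝓤⁰)g_kp`. The factor `R⁻¹ = r^{-μ} ε^μ` is
the rate. Mild solutions need not be differentiable in time, so both estimates are run on increments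
of their time integrals and divided by the step at the end (`norm_sub_le_of_mild_of_continuous`).
The truncation at `R` keeps `w` a bounded operator, so no domain question arises for it. -/

/-- The half-open unit cube centered at the integer point `m`. -/
def cube (m : Fin d → ℤ) : Set (Fin d → ℝ) :=
  {t | ∀ i, t i - m i ∈ Ioc (-(1 / 2) : ℝ) (-(1 / 2) + 1)}

lemma measurableSet_cube (m : Fin d → ℤ) : MeasurableSet (cube m) := by
  have : cube m = ⋂ i, {t : Fin d → ℝ | t i - m i ∈ Ioc (-(1 / 2) : ℝ) (-(1 / 2) + 1)} := by
    ext; simp [cube]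
  rw [this]
  refine MeasurableSet.iInter fun i => ?_
  have h : Measurable fun t : Fin d → ℝ => t i - m i := by fun_prop
  exact h measurableSet_Ioc

lemma latMap_eq (M : Matrix (Fin d) (Fin d) ℝ) :
    latMap M = WithLp.toLp 2 ∘ (Matrix.toLin' M) := by
  ext; simp [latMap, Matrix.toLin'_apply]

lemma latMap_add (M : Matrix (Fin d) (Fin d) ℝ) (s t : Fin d → ℝ) :
    latMap M (s + t) = latMap M s + latMap M t := by
  simp [latMap, Matrix.mulVec_add]

lemma continuous_latMap (M : Matrix (Fin d) (Fin d) ℝ) : Continuous (latMap M) := by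
  rw [latMap_eq]
  exact (PiLp.continuous_toLp 2 _).comp (Matrix.toLin' M).continuous_of_finiteDimensional

lemma latMap_inv_apply {M : Matrix (Fin d) (Fin d) ℝ} (hM : M.det ≠ 0) (x : Sp d) :
    latMap M (M⁻¹ *ᵥ x.ofLp) = x := by
  simp [latMap, Matrix.mulVec_mulVec, Matrix.mul_nonsing_inv M (isUnit_iff_ne_zero.2 hM)]

lemma inv_mulVec_latMap {M : Matrix (Fin d) (Fin d) ℝ} (hM : M.det ≠ 0) (t : Fin d → ℝ) :
    M⁻¹ *ᵥ (latMap M t).ofLp = t := by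
  simp [latMap, Matrix.mulVec_mulVec, Matrix.nonsing_inv_mul M (isUnit_iff_ne_zero.2 hM)]

lemma latMap_injective {M : Matrix (Fin d) (Fin d) ℝ} (hM : M.det ≠ 0) :
    Function.Injective (latMap M) :=
  Function.LeftInverse.injective (g := fun x : Sp d => M⁻¹ *ᵥ x.ofLp) (inv_mulVec_latMap hM)

lemma measurableEmbedding_latMap {M : Matrix (Fin d) (Fin d) ℝ} (hM : M.det ≠ 0) :
    MeasurableEmbedding (latMap M) :=
  (continuous_latMap M).measurableEmbedding (latMap_injective hM)

lemma volume_eq_smul_map_latMap {M : Matrix (Fin d) (Fin d) ℝ} (hM : M.det ≠ 0) :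
    (volume : Measure (Sp d)) = ENNReal.ofReal |M.det| • Measure.map (latMap M) volume := by
  have h1 : Measure.map (latMap M) volume
      = ENNReal.ofReal |M.det⁻¹| • (volume : Measure (Sp d)) := by
    rw [latMap_eq, ← Measure.map_map (by fun_prop)
      (Matrix.toLin' M).continuous_of_finiteDimensional.measurable,
      Real.map_matrix_volume_pi_eq_smul_volume_pi hM, Measure.map_smul,
      (PiLp.volume_preserving_toLp (Fin d)).map_eq]
  rw [h1, smul_smul, ← ENNReal.ofReal_mul (abs_nonneg _), ← abs_mul, mul_inv_cancel₀ hM]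
  simp

lemma cube_zero_ae_eq :
    (cube (0 : Fin d → ℤ)) =ᵐ[volume] {t | ∀ i, t i ∈ Icc (-(1 / 2) : ℝ) (1 / 2)} := by
  have h1 : cube (0 : Fin d → ℤ) = Set.pi univ fun _ => Ioc (-(1 / 2) : ℝ) (1 / 2) := by
    ext t; simp only [cube, mem_ofPred_eq, Set.mem_pi]; norm_num
  have h2 : {t : Fin d → ℝ | ∀ i, t i ∈ Icc (-(1 / 2) : ℝ) (1 / 2)}
      = Set.pi univ fun _ => Icc (-(1 / 2) : ℝ) (1 / 2) := by
    ext t; simp only [mem_ofPred_eq, Set.mem_pi, mem_univ, true_imp_iff]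
  rw [h1, h2]
  exact Measure.ae_eq_set_pi fun i _ => Ioc_ae_eq_Icc

/-- The closed cell and the image of the half-open cube differ by a null set; the half-open version
is the one whose translates are disjoint. -/
lemma restrict_cell_eq {M : Matrix (Fin d) (Fin d) ℝ} (hM : M.det ≠ 0) :
    (volume : Measure (Sp d)).restrict (cell M)
      = ENNReal.ofReal |M.det| • Measure.map (latMap M) (volume.restrict (cube 0)) := by
  conv_lhs => rw [volume_eq_smul_map_latMap hM]
  rw [Measure.restrict_smul, cell, (measurableEmbedding_latMap hM).restrict_map,
    (latMap_injective hM).preimage_image, Measure.restrict_congr_set cube_zero_ae_eq]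

lemma isCompact_cell (M : Matrix (Fin d) (Fin d) ℝ) : IsCompact (cell M) := by
  refine IsCompact.image ?_ (continuous_latMap M)
  have : {t : Fin d → ℝ | ∀ i, t i ∈ Icc (-(1 / 2) : ℝ) (1 / 2)}
      = Set.pi univ fun _ => Icc (-(1 / 2) : ℝ) (1 / 2) := by
    ext t; simp only [mem_ofPred_eq, Set.mem_pi, mem_univ, true_imp_iff]
  rw [this]
  exact isCompact_univ_pi fun _ => isCompact_Icc

lemma measurableSet_cell (M : Matrix (Fin d) (Fin d) ℝ) : MeasurableSet (cell M) :=
  (isCompact_cell M).measurableSet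

lemma volume_cell_lt_top (M : Matrix (Fin d) (Fin d) ℝ) : volume (cell M) < ⊤ :=
  (isCompact_cell M).measure_lt_top

instance isFiniteMeasure_restrict_cell (M : Matrix (Fin d) (Fin d) ℝ) :
    IsFiniteMeasure ((volume : Measure (Sp d)).restrict (cell M)) :=
  ⟨by simpa using volume_cell_lt_top M⟩

/-- The lattice vector `M m`, `m ∈ ℤ^d`. -/
def latVec (M : Matrix (Fin d) (Fin d) ℝ) (m : Fin d → ℤ) : Sp d :=
  latMap M (fun i => (m i : ℝ))

lemma lintegral_cube (F : (Fin d → ℝ) → ℝ≥0∞) :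
    ∫⁻ t, F t = ∑' m : Fin d → ℤ, ∫⁻ t in cube 0, F (t + fun i => (m i : ℝ)) := by
  have hU : (⋃ m : Fin d → ℤ, cube m) = univ := by
    -- The integer `⌈t - 1/2⌉` is the one at distance in `(-1/2, 1/2]` below `t`.
    refine eq_univ_of_forall fun t => mem_iUnion.2 ⟨fun i => ⌈t i - 1 / 2⌉, fun i => ?_⟩
    have h1 := Int.le_ceil (t i - 1 / 2)
    have h2 := Int.ceil_lt_add_one (t i - 1 / 2)
    constructor <;> linarith
  have hD : Pairwise (Function.onFun Disjoint (cube (d := d))) := by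
    intro m n hmn
    rw [Function.onFun, Set.disjoint_left]
    intro t h1 h2
    apply hmn
    ext i
    have a := h1 i
    have b := h2 i
    have c1 : (m i : ℝ) < n i + 1 := by linarith [a.1, a.2, b.1, b.2]
    have c2 : (n i : ℝ) < m i + 1 := by linarith [a.1, a.2, b.1, b.2]
    have c1' : m i < n i + 1 := by exact_mod_cast c1
    have c2' : n i < m i + 1 := by exact_mod_cast c2
    omega
  rw [← setLIntegral_univ, ← hU, lintegral_iUnion measurableSet_cube hD]
  refine tsum_congr fun m => ?_
  have hmp := measurePreserving_add_right (volume : Measure (Fin d → ℝ)) (fun i => (m i : ℝ))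
  have he := (MeasurableEquiv.addRight (fun i => (m i : ℝ) : Fin d → ℝ)).measurableEmbedding
  have := hmp.setLIntegral_comp_preimage_emb he F (cube m)
  rw [← this]
  congr 2
  ext t
  simp only [cube, mem_ofPred_eq, mem_preimage, Pi.add_apply, add_sub_cancel_right, Pi.zero_apply,
    Int.cast_zero, sub_zero]

/-- No measurability of `F` is needed, because every change of variables is along a measurable
embedding and the pieces are measurable sets. -/
lemma lintegral_tiling {M : Matrix (Fin d) (Fin d) ℝ} (hM : M.det ≠ 0) (F : Sp d → ℝ≥0∞) :
    ∫⁻ x, F x = ∑' m : Fin d → ℤ, ∫⁻ x in cell M, F (x + latVec M m) := by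
  rw [volume_eq_smul_map_latMap hM, lintegral_smul_measure,
    (measurableEmbedding_latMap hM).lintegral_map, lintegral_cube, smul_eq_mul,
    ← ENNReal.tsum_mul_left]
  refine tsum_congr fun m => ?_
  rw [← volume_eq_smul_map_latMap hM, restrict_cell_eq hM, lintegral_smul_measure,
    (measurableEmbedding_latMap hM).lintegral_map, smul_eq_mul]
  simp only [latMap_add, latVec]

/-- The translates of the cell tile the space. -/
lemma measurePreserving_tiling {M : Matrix (Fin d) (Fin d) ℝ} (hM : M.det ≠ 0) :
    MeasurePreserving (fun p : Sp d × (Fin d → ℤ) => p.1 + latVec M p.2)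
      ((volume.restrict (cell M)).prod Measure.count) volume := by
  have hmeas : Measurable (fun p : Sp d × (Fin d → ℤ) => p.1 + latVec M p.2) :=
    measurable_fst.add ((measurable_of_countable (latVec M)).comp measurable_snd)
  refine ⟨hmeas, ?_⟩
  ext s hs
  have hi : Measurable fun p : Sp d × (Fin d → ℤ) =>
      s.indicator (1 : Sp d → ℝ≥0∞) (p.1 + latVec M p.2) :=
    (measurable_one.indicator hs).comp hmeas
  rw [← lintegral_indicator_one hs, ← lintegral_indicator_one hs,
    lintegral_map (measurable_one.indicator hs) hmeas, lintegral_prod_symm' _ hi,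
    lintegral_count, lintegral_tiling hM]

lemma det_recip {M : Matrix (Fin d) (Fin d) ℝ} (hM : M.det ≠ 0) : (recip M).det ≠ 0 := by
  have h2 : (2 * Real.pi) ≠ 0 := by positivity
  have h : IsUnit Mᵀ.det := by simpa [isUnit_iff_ne_zero] using hM
  rw [recip, Matrix.det_smul]
  exact mul_ne_zero (pow_ne_zero _ h2) (Matrix.isUnit_nonsing_inv_det _ h).ne_zero

lemma inner_latMap_recip {M : Matrix (Fin d) (Fin d) ℝ} (hM : M.det ≠ 0) (s t : Fin d → ℝ) :
    inner ℝ (latMap (recip M) s) (latMap M t) = 2 * Real.pi * ∑ i, s i * t i := by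
  have h : IsUnit Mᵀ.det := by simpa [isUnit_iff_ne_zero] using hM
  have e1 : inner ℝ (latMap (recip M) s) (latMap M t) = (recip M *ᵥ s) ⬝ᵥ (M *ᵥ t) := by
    simp [latMap, PiLp.inner_apply, dotProduct, mul_comm]
  rw [e1, Matrix.dotProduct_mulVec, ← Matrix.mulVec_transpose, Matrix.mulVec_mulVec, recip,
    Matrix.mul_smul, Matrix.mul_nonsing_inv _ h, Matrix.smul_mulVec, Matrix.one_mulVec,
    smul_dotProduct]
  simp [dotProduct]

/-- Fourier series are used on the cell of the frequency lattice `ε⁻¹L*ℤ^d`; biduality says that the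
dual lattice is then the position lattice `εLℤ^d`. -/
lemma recip_recip {M : Matrix (Fin d) (Fin d) ℝ} (hM : M.det ≠ 0) : recip (recip M) = M := by
  have h : IsUnit M.det := isUnit_iff_ne_zero.2 hM
  have h2 : (2 * Real.pi) ≠ 0 := by positivity
  have key : (recip M)ᵀ * ((2 * Real.pi)⁻¹ • M) = 1 := by
    rw [recip, Matrix.transpose_smul, Matrix.transpose_nonsing_inv, Matrix.transpose_transpose,
      Matrix.smul_mul, Matrix.mul_smul, Matrix.nonsing_inv_mul _ h, smul_smul,
      mul_inv_cancel₀ h2, one_smul]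
  rw [recip, Matrix.inv_eq_right_inv key, smul_smul, mul_inv_cancel₀ h2, one_smul]

lemma det_smul_ne_zero {L : Matrix (Fin d) (Fin d) ℝ} (hL : L.det ≠ 0) {ε : ℝ} (hε : ε ≠ 0) :
    (ε • L).det ≠ 0 := by
  rw [Matrix.det_smul]; exact mul_ne_zero (pow_ne_zero _ hε) hL

lemma latMap_smul (ε : ℝ) (L : Matrix (Fin d) (Fin d) ℝ) (t : Fin d → ℝ) :
    latMap (ε • L) t = ε • latMap L t := by
  simp [latMap, Matrix.smul_mulVec]

lemma recip_smul {L : Matrix (Fin d) (Fin d) ℝ} (hL : L.det ≠ 0) {ε : ℝ} (hε : ε ≠ 0) :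
    recip (ε • L) = ε⁻¹ • recip L := by
  have h : IsUnit Lᵀ.det := by simpa [isUnit_iff_ne_zero] using hL
  have key : (ε • L)ᵀ * (ε⁻¹ • (Lᵀ)⁻¹) = 1 := by
    rw [Matrix.transpose_smul, Matrix.smul_mul, Matrix.mul_smul, Matrix.mul_nonsing_inv _ h,
      smul_smul, mul_inv_cancel₀ hε, one_smul]
  rw [recip, recip, Matrix.inv_eq_right_inv key, smul_comm]

lemma brillouinScaled_eq {L : Matrix (Fin d) (Fin d) ℝ} (hL : L.det ≠ 0) {ε : ℝ} (hε : ε ≠ 0) :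
    brillouinScaled L ε = cell (recip (ε • L)) := by
  ext k
  simp only [brillouinScaled, brillouin, cell, mem_ofPred_eq, mem_image, recip_smul hL hε,
    latMap_smul]
  refine exists_congr fun t => and_congr_right fun _ => ?_
  rw [inv_smul_eq_iff₀ hε]

/-- The open parallelepiped `|t_i| < 1/2` contains a ball about the origin. For the reciprocal
lattice its radius `r` is what turns "outside the Brillouin zone" into a lower bound on the
frequency. -/
lemma exists_le_norm_latMap {M : Matrix (Fin d) (Fin d) ℝ} (hM : M.det ≠ 0) :
    ∃ r > 0, ∀ t : Fin d → ℝ, (∃ i, 1 / 2 ≤ |t i|) → r ≤ ‖latMap M t‖ := by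
  have hc : Continuous fun x : Sp d => M⁻¹ *ᵥ x.ofLp := by fun_prop
  have hO : IsOpen (⋂ i : Fin d, (fun x : Sp d => (M⁻¹ *ᵥ x.ofLp) i) ⁻¹'
      Ioo (-(1 / 2) : ℝ) (1 / 2)) :=
    isOpen_iInter_of_finite fun i => isOpen_Ioo.preimage ((continuous_apply i).comp hc)
  obtain ⟨r, hr, hball⟩ := Metric.isOpen_iff.1 hO 0 (by simp)
  refine ⟨r, hr, fun t ⟨i, hi⟩ => ?_⟩
  by_contra! hlt
  have := mem_iInter.1 (hball (show latMap M t ∈ Metric.ball 0 r by simpa using hlt)) i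
  rw [mem_preimage, inv_mulVec_latMap hM] at this
  exact absurd (abs_lt.2 this) (not_lt.2 hi)

lemma exists_half_le_of_notMem_cell {M : Matrix (Fin d) (Fin d) ℝ} (hM : M.det ≠ 0) {x : Sp d}
    (hx : x ∉ cell M) : ∃ t : Fin d → ℝ, x = latMap M t ∧ ∃ i, 1 / 2 ≤ |t i| := by
  refine ⟨M⁻¹ *ᵥ x.ofLp, (latMap_inv_apply hM x).symm, ?_⟩
  by_contra! h
  exact hx ⟨M⁻¹ *ᵥ x.ofLp, fun i => abs_le.1 (h i).le, latMap_inv_apply hM x⟩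

/-- A coordinate shifted by a nonzero integer has modulus at least `1 - 1/2`. The non-strict bound
accommodates the boundary of the closed cell. -/
lemma exists_half_le_of_mem_cell_add {M : Matrix (Fin d) (Fin d) ℝ} {x : Sp d}
    (hx : x ∈ cell M) {m : Fin d → ℤ} (hm : m ≠ 0) :
    ∃ t : Fin d → ℝ, x + latVec M m = latMap M t ∧ ∃ i, 1 / 2 ≤ |t i| := by
  obtain ⟨t, ht, rfl⟩ := hx
  obtain ⟨i, hi⟩ := Function.ne_iff.1 hm
  refine ⟨t + fun i => (m i : ℝ), (latMap_add M _ _).symm, i, ?_⟩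
  have h1 : (1 : ℝ) ≤ |(m i : ℝ)| := by exact_mod_cast Int.one_le_abs hi
  have h2 : |t i| ≤ 1 / 2 := abs_le.2 (ht i)
  have h3 := abs_sub_abs_le_abs_sub (m i : ℝ) (-t i)
  rw [abs_neg, sub_neg_eq_add, add_comm (m i : ℝ)] at h3
  simp only [Pi.add_apply]
  linarith

/-! ### Plane waves and Fourier series on a cell -/

lemma planeWave_add_left (k k' x : Sp d) :
    planeWave (k + k') x = planeWave k x * planeWave k' x := by
  rw [planeWave, planeWave, planeWave, ← Complex.exp_add, inner_add_left]
  push_cast; ring_nf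

lemma planeWave_add_right (k x y : Sp d) :
    planeWave k (x + y) = planeWave k x * planeWave k y := by
  rw [planeWave, planeWave, planeWave, ← Complex.exp_add, inner_add_right]
  push_cast; ring_nf

lemma norm_planeWave (k x : Sp d) : ‖planeWave k x‖ = 1 := by
  rw [planeWave, mul_comm, Complex.norm_exp_ofReal_mul_I]

lemma conj_planeWave (k x : Sp d) : conj (planeWave k x) = planeWave (-k) x := by
  rw [planeWave, planeWave, ← Complex.exp_conj]
  simp

lemma planeWave_ne_zero (k x : Sp d) : planeWave k x ≠ 0 := Complex.exp_ne_zero _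

lemma planeWave_comm (k x : Sp d) : planeWave k x = planeWave x k := by
  rw [planeWave, planeWave, real_inner_comm]

lemma continuous_planeWave : Continuous fun p : Sp d × Sp d => planeWave p.1 p.2 := by
  unfold planeWave; fun_prop

lemma planeWave_latVec_recip {M : Matrix (Fin d) (Fin d) ℝ} (hM : M.det ≠ 0)
    (m n : Fin d → ℤ) : planeWave (latVec (recip M) m) (latVec M n) = 1 := by
  rw [planeWave, latVec, latVec, inner_latMap_recip hM, Complex.exp_eq_one_iff]
  refine ⟨∑ i, m i * n i, ?_⟩
  push_cast; ring

section Torus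

attribute [local instance] instMeasureSpaceUnitAddCircle

/-- The parametrization of a cell by the torus. -/
def torusCell (M : Matrix (Fin d) (Fin d) ℝ) (θ : UnitAddTorus (Fin d)) : Sp d :=
  latMap M (UnitAddTorus.measurableEquivPiIoc (fun _ => (-(1 / 2) : ℝ)) θ).1

lemma measurePreserving_torusCell (M : Matrix (Fin d) (Fin d) ℝ) :
    MeasurePreserving (torusCell M) volume
      (Measure.map (latMap M) (volume.restrict (cube 0))) := by
  have h1 := UnitAddTorus.measurePreserving_equivPiIoc (fun _ : Fin d => (-(1 / 2) : ℝ))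
  have hset : {x : Fin d → ℝ | ∀ i, x i ∈ Ioc (-(1 / 2) : ℝ) (-(1 / 2) + 1)} = cube 0 := by
    ext; simp [cube]
  have h2 : MeasurePreserving
      (Subtype.val : {x : Fin d → ℝ // ∀ i, x i ∈ Ioc (-(1 / 2) : ℝ) (-(1 / 2) + 1)} → _)
      (Measure.comap Subtype.val volume) (volume.restrict (cube 0)) := by
    refine ⟨measurable_subtype_coe, ?_⟩
    rw [← hset]
    exact map_comap_subtype_coe 
      (show MeasurableSet {x : Fin d → ℝ | ∀ i, x i ∈ Ioc (-(1 / 2) : ℝ) (-(1 / 2) + 1)} from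
        hset ▸ measurableSet_cube 0) volume
  have h3 : MeasurePreserving (latMap M) (volume.restrict (cube 0))
      (Measure.map (latMap M) (volume.restrict (cube 0))) :=
    ⟨(continuous_latMap M).measurable, rfl⟩
  exact h3.comp (h2.comp h1)

lemma mFourier_neg_eq_planeWave {M : Matrix (Fin d) (Fin d) ℝ} (hM : M.det ≠ 0)
    (n : Fin d → ℤ) (θ : UnitAddTorus (Fin d)) :
    UnitAddTorus.mFourier (-n) θ = conj (planeWave (latVec (recip M) n) (torusCell M θ)) := by
  rw [UnitAddTorus.mFourier_neg, planeWave, torusCell, latVec, inner_latMap_recip hM]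
  congr 1
  set y := (UnitAddTorus.measurableEquivPiIoc (fun _ => (-(1 / 2) : ℝ)) θ) with hy
  have hθ : θ = fun i => ((y.1 i : ℝ) : UnitAddCircle) := by
    rw [← UnitAddTorus.coe_symm_measurableEquivPiIoc_apply, hy, MeasurableEquiv.symm_apply_apply]
  rw [hθ]
  simp only [UnitAddTorus.mFourier, ContinuousMap.coe_mk, fourier_coe_apply]
  rw [← Complex.exp_sum]
  congr 1
  push_cast
  rw [Finset.mul_sum, Finset.mul_sum]
  refine Finset.sum_congr rfl fun i _ => ?_
  ring

lemma hasSum_mFourierCoeff_of_memLp {F G : UnitAddTorus (Fin d) → ℂ}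
    (hF : MemLp F 2 volume) (hG : MemLp G 2 volume) :
    HasSum (fun n => conj (UnitAddTorus.mFourierCoeff F n) * UnitAddTorus.mFourierCoeff G n)
      (∫ θ, conj (F θ) * G θ) := by
  have hP := UnitAddTorus.hasSum_prod_mFourierCoeff (hF.toLp F) (hG.toLp G)
  have hc : ∀ {H : UnitAddTorus (Fin d) → ℂ} (hH : MemLp H 2 volume) (n : Fin d → ℤ),
      UnitAddTorus.mFourierCoeff (hH.toLp H) n = UnitAddTorus.mFourierCoeff H n := by
    intro H hH n
    refine integral_congr_ae ?_
    filter_upwards [hH.coeFn_toLp] with θ hθ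
    rw [hθ]
  have hv : ∫ θ, conj (hF.toLp F θ) * hG.toLp G θ = ∫ θ, conj (F θ) * G θ := by
    refine integral_congr_ae ?_
    filter_upwards [hF.coeFn_toLp, hG.coeFn_toLp] with θ h1 h2
    rw [h1, h2]
  rw [hv] at hP
  simpa only [hc hF, hc hG] using hP

lemma memLp_comp_torusCell {M : Matrix (Fin d) (Fin d) ℝ} (hM : M.det ≠ 0) {f : Sp d → ℂ}
    (hf : MemLp f 2 (volume.restrict (cell M))) : MemLp (f ∘ torusCell M) 2 volume := by
  refine MemLp.comp_measurePreserving ?_ (measurePreserving_torusCell M)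
  rw [restrict_cell_eq hM] at hf
  have h := hf.smul_measure (c := (ENNReal.ofReal |M.det|)⁻¹) (by simpa using hM)
  rwa [smul_smul, ENNReal.inv_mul_cancel (by simpa using hM) (by simp), one_smul] at h

lemma integral_cell_eq_torus {M : Matrix (Fin d) (Fin d) ℝ} (hM : M.det ≠ 0) {f : Sp d → ℂ}
    (hf : AEStronglyMeasurable f (volume.restrict (cell M))) :
    ∫ x in cell M, f x = ((|M.det| : ℝ) : ℂ) * ∫ θ, f (torusCell M θ) := by
  have hΦ := measurePreserving_torusCell M
  rw [restrict_cell_eq hM] at hf ⊢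
  have hf' : AEStronglyMeasurable f (Measure.map (torusCell M) volume) := by
    rw [hΦ.map_eq]
    refine hf.mono_ac (Measure.absolutelyContinuous_smul ?_)
    simpa using hM
  rw [integral_smul_measure, ← hΦ.map_eq, integral_map hΦ.measurable.aemeasurable hf',
    ENNReal.toReal_ofReal (abs_nonneg _), Complex.real_smul]

lemma continuous_conj_planeWave (k : Sp d) : Continuous fun x : Sp d => conj (planeWave k x) :=
  Complex.continuous_conj.comp
    (continuous_planeWave.comp (f := fun x : Sp d => (k, x)) (by fun_prop))

lemma fourier_cell_eq_mFourierCoeff {M : Matrix (Fin d) (Fin d) ℝ} (hM : M.det ≠ 0)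
    {f : Sp d → ℂ} (hf : MemLp f 2 (volume.restrict (cell M))) (n : Fin d → ℤ) :
    ∫ x in cell M, conj (planeWave (latVec (recip M) n) x) * f x
      = ((|M.det| : ℝ) : ℂ) * UnitAddTorus.mFourierCoeff (f ∘ torusCell M) n := by
  rw [integral_cell_eq_torus hM (f := fun x => conj (planeWave (latVec (recip M) n) x) * f x)
    ((continuous_conj_planeWave _).aestronglyMeasurable.mul hf.1),
    UnitAddTorus.mFourierCoeff]
  simp only [mFourier_neg_eq_planeWave hM, smul_eq_mul, Function.comp_apply]

/-- Parseval's identity for Fourier series on a cell. -/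
theorem hasSum_fourier_cell {M : Matrix (Fin d) (Fin d) ℝ} (hM : M.det ≠ 0) {f g : Sp d → ℂ}
    (hf : MemLp f 2 (volume.restrict (cell M))) (hg : MemLp g 2 (volume.restrict (cell M))) :
    HasSum (fun n : Fin d → ℤ =>
      conj (∫ x in cell M, conj (planeWave (latVec (recip M) n) x) * f x)
        * ∫ x in cell M, conj (planeWave (latVec (recip M) n) x) * g x)
      (((|M.det| : ℝ) : ℂ) * ∫ x in cell M, conj (f x) * g x) := by
  have hP := hasSum_mFourierCoeff_of_memLp (memLp_comp_torusCell hM hf)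
    (memLp_comp_torusCell hM hg)
  rw [integral_cell_eq_torus hM (f := fun x => conj (f x) * g x)
    ((Complex.continuous_conj.comp_aestronglyMeasurable hf.1).mul hg.1),
    ← mul_assoc]
  -- Each of the two unnormalized coefficients carries a factor `|det M|`; the integral over the
  -- cell absorbs one of them.
  refine (hP.mul_left (((|M.det| : ℝ) : ℂ) * ((|M.det| : ℝ) : ℂ))).congr_fun fun n => ?_
  rw [fourier_cell_eq_mFourierCoeff hM hf, fourier_cell_eq_mFourierCoeff hM hg, map_mul,
    Complex.conj_ofReal]
  ring

end Torus

/-- An `L²` function on a cell with vanishing Fourier coefficients vanishes. -/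
theorem ae_eq_zero_of_fourier_cell {M : Matrix (Fin d) (Fin d) ℝ} (hM : M.det ≠ 0) {f : Sp d → ℂ}
    (hf : MemLp f 2 (volume.restrict (cell M)))
    (h : ∀ n, ∫ x in cell M, conj (planeWave (latVec (recip M) n) x) * f x = 0) :
    f =ᵐ[volume.restrict (cell M)] 0 := by
  have hP := hasSum_fourier_cell hM hf hf
  simp only [h, mul_zero] at hP
  have h0 := hP.unique hasSum_zero
  have h1 : ∫ x in cell M, conj (f x) * f x = 0 := by
    rcases mul_eq_zero.1 h0 with h | h
    · exact absurd h (by simpa using hM)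
    · exact h
  have h2 : ∫ x in cell M, ‖f x‖ ^ 2 = 0 := by
    have : ∀ x, conj (f x) * f x = ((‖f x‖ ^ 2 : ℝ) : ℂ) := fun x => by
      rw [Complex.conj_mul']; push_cast; rfl
    simp only [this, integral_complex_ofReal] at h1
    exact_mod_cast h1
  rw [integral_eq_zero_iff_of_nonneg (fun x => by positivity)
    ((memLp_two_iff_integrable_sq_norm hf.1).1 hf)] at h2
  filter_upwards [h2] with x hx
  simpa using hx

/-! ### Schur's test and kernel operators on `L²(X × Z)` -/

section Schur

set_option linter.unusedSectionVars false

variable {X Y Z : Type*} [MeasurableSpace X] [MeasurableSpace Y] [MeasurableSpace Z]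

lemma sq_eLpNorm_two {G : Type*} [NormedAddCommGroup G] (f : X → G) (μ : Measure X) :
    eLpNorm f 2 μ ^ 2 = ∫⁻ x, ‖f x‖ₑ ^ 2 ∂μ := by
  have := eLpNorm_nnreal_pow_eq_lintegral (f := f) (μ := μ) (p := 2) (by norm_num)
  simpa using this

lemma sq_lintegral_mul_le (μ : Measure X) {f g : X → ℝ≥0∞} (hf : AEMeasurable f μ)
    (hg : AEMeasurable g μ) :
    (∫⁻ x, f x * g x ∂μ) ^ 2 ≤ (∫⁻ x, f x ^ 2 ∂μ) * ∫⁻ x, g x ^ 2 ∂μ := by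
  have h := ENNReal.lintegral_mul_le_Lp_mul_Lq μ Real.HolderConjugate.two_two hf hg
  have h2 := pow_le_pow_left' h 2
  simp only [Pi.mul_apply, ENNReal.rpow_two] at h2
  refine h2.trans (le_of_eq ?_)
  rw [mul_pow, ← ENNReal.rpow_natCast, ← ENNReal.rpow_natCast, ← ENNReal.rpow_mul,
    ← ENNReal.rpow_mul]
  norm_num

/-- Cauchy–Schwarz after writing `k f = k^{1/2} · (k^{1/2} f)`. -/
lemma sq_lintegral_kernel_le (μ : Measure Y) {k f : Y → ℝ≥0∞} (hk : AEMeasurable k μ)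
    (hf : AEMeasurable f μ) :
    (∫⁻ y, k y * f y ∂μ) ^ 2 ≤ (∫⁻ y, k y ∂μ) * ∫⁻ y, k y * f y ^ 2 ∂μ := by
  have h := sq_lintegral_mul_le μ (f := fun y => k y ^ (1 / 2 : ℝ))
    (g := fun y => k y ^ (1 / 2 : ℝ) * f y) (hk.pow_const _) ((hk.pow_const _).mul hf)
  have e : ∀ a : ℝ≥0∞, a ^ (1 / 2 : ℝ) * a ^ (1 / 2 : ℝ) = a := fun a => by
    rw [← ENNReal.rpow_add_of_nonneg _ _ (by norm_num) (by norm_num)]; norm_num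
  have e2 : ∀ a : ℝ≥0∞, (a ^ (1 / 2 : ℝ)) ^ 2 = a := fun a => by rw [sq, e]
  simpa only [← mul_assoc, e, mul_pow, e2] using h

/-- The row bound `A` comes out of the weighted Cauchy–Schwarz inequality; Tonelli then exposes the
column integrals, bounded by `B`. -/
theorem schur_test (μ : Measure X) (ν : Measure Y) [SFinite μ] [SFinite ν]
    {k : X → Y → ℝ≥0∞} (hk : Measurable (Function.uncurry k)) {f : Y → ℝ≥0∞}
    (hf : AEMeasurable f ν) {A B : ℝ≥0∞} (hA : ∀ x, ∫⁻ y, k x y ∂ν ≤ A)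
    (hB : ∀ y, ∫⁻ x, k x y ∂μ ≤ B) :
    ∫⁻ x, (∫⁻ y, k x y * f y ∂ν) ^ 2 ∂μ ≤ A * B * ∫⁻ y, f y ^ 2 ∂ν := by
  calc ∫⁻ x, (∫⁻ y, k x y * f y ∂ν) ^ 2 ∂μ
      ≤ ∫⁻ x, A * ∫⁻ y, k x y * f y ^ 2 ∂ν ∂μ := by
        refine lintegral_mono fun x => ?_
        refine (sq_lintegral_kernel_le ν hk.of_uncurry_left.aemeasurable hf).trans ?_
        gcongr
        exact hA x
    _ ≤ A * ∫⁻ x, ∫⁻ y, k x y * f y ^ 2 ∂ν ∂μ := by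
        rw [lintegral_const_mul'']
        exact (hk.aemeasurable.mul ((hf.comp_snd).pow_const 2)).lintegral_prod_right'
    _ = A * ∫⁻ y, ∫⁻ x, k x y * f y ^ 2 ∂μ ∂ν := by
        rw [lintegral_lintegral_swap]
        exact hk.aemeasurable.mul ((hf.comp_snd).pow_const 2)
    _ = A * ∫⁻ y, (∫⁻ x, k x y ∂μ) * f y ^ 2 ∂ν := by
        congr 1
        refine lintegral_congr fun y => ?_
        rw [lintegral_mul_const'' _ hk.of_uncurry_right.aemeasurable]
    _ ≤ A * ∫⁻ y, B * f y ^ 2 ∂ν := by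
        gcongr with y
        exact hB y
    _ = A * B * ∫⁻ y, f y ^ 2 ∂ν := by
        rw [lintegral_const_mul'' _ (hf.pow_const 2), mul_assoc]

/-- A family of integral kernels satisfying Schur's test with constant `A`. -/
structure IsSchur (μ : Measure X) (ν : Measure Z) (κ : X → X → Z → ℂ) (A : ℝ) : Prop where
  nonneg : 0 ≤ A
  meas : Measurable fun p : X × X × Z => κ p.1 p.2.1 p.2.2
  left : ∀ᵐ z ∂ν, ∀ x, ∫⁻ y, ‖κ x y z‖ₑ ∂μ ≤ ENNReal.ofReal A
  right : ∀ᵐ z ∂ν, ∀ y, ∫⁻ x, ‖κ x y z‖ₑ ∂μ ≤ ENNReal.ofReal A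

/-- The fibered integral operator with kernel `κ`. -/
def kernelFun (μ : Measure X) (κ : X → X → Z → ℂ) (u : X × Z → ℂ) (p : X × Z) : ℂ :=
  ∫ y, κ p.1 y p.2 * u (y, p.2) ∂μ

variable {μ : Measure X} {ν : Measure Z} [SigmaFinite μ] [SigmaFinite ν] {κ : X → X → Z → ℂ}
  {A : ℝ}

lemma ae_prod_swap {P : X × Z → Prop} (h : ∀ᵐ p ∂(μ.prod ν), P p) :
    ∀ᵐ z ∂ν, ∀ᵐ x ∂μ, P (x, z) :=
  Measure.ae_ae_of_ae_prod (Measure.measurePreserving_swap.quasiMeasurePreserving.ae h)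

lemma ae_prod_snd {P : Z → Prop} (h : ∀ᵐ z ∂ν, P z) : ∀ᵐ p ∂(μ.prod ν), P p.2 :=
  Measure.quasiMeasurePreserving_snd.ae h

lemma ae_prod_fst {P : X → Prop} (h : ∀ᵐ x ∂μ, P x) : ∀ᵐ p ∂(μ.prod ν), P p.1 :=
  Measure.quasiMeasurePreserving_fst.ae h

lemma kernelFun_congr (κ : X → X → Z → ℂ) {u u' : X × Z → ℂ} (h : u =ᵐ[μ.prod ν] u') :
    kernelFun μ κ u =ᵐ[μ.prod ν] kernelFun μ κ u' := by
  filter_upwards [ae_prod_snd (μ := μ) (ae_prod_swap h)] with p hp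
  refine integral_congr_ae ?_
  filter_upwards [hp] with y hy
  rw [hy]

/-- Schur's test for almost every fixed `z`, integrated over `z`. It is stated for the absolute
kernel, so it yields both the norm bound and the absolute convergence of the integrals. -/
lemma IsSchur.lintegral_le (hκ : IsSchur μ ν κ A) {f : X × Z → ℝ≥0∞} (hf : Measurable f) :
    ∫⁻ p, (∫⁻ y, ‖κ p.1 y p.2‖ₑ * f (y, p.2) ∂μ) ^ 2 ∂(μ.prod ν)
      ≤ ENNReal.ofReal A ^ 2 * ∫⁻ p, f p ^ 2 ∂(μ.prod ν) := by
  have hm1 : Measurable fun q : (X × Z) × X => ‖κ q.1.1 q.2 q.1.2‖ₑ :=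
    (hκ.meas.comp (by fun_prop : Measurable fun q : (X × Z) × X => (q.1.1, q.2, q.1.2))).enorm
  have hm : Measurable fun q : (X × Z) × X => ‖κ q.1.1 q.2 q.1.2‖ₑ * f (q.2, q.1.2) :=
    hm1.mul (hf.comp (by fun_prop))
  rw [lintegral_prod_symm' _ (hm.lintegral_prod_right'.pow_const 2),
    lintegral_prod_symm' _ (hf.pow_const 2), ← lintegral_const_mul _
      (hf.pow_const 2).lintegral_prod_left']
  refine lintegral_mono_ae ?_
  filter_upwards [hκ.left, hκ.right] with z h1 h2
  have := schur_test μ μ (k := fun x y => ‖κ x y z‖ₑ) (f := fun y => f (y, z))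
    (hm1.comp (by fun_prop : Measurable fun p : X × X => (((p.1, z), p.2) : (X × Z) × X)))
    (hf.comp (by fun_prop)).aemeasurable h1 h2
  rwa [← sq] at this

/-- Additivity of the operator rests on this: a Bochner integral defaults to `0` off the integrable
functions and is not additive there. -/
lemma IsSchur.ae_integrable (hκ : IsSchur μ ν κ A) {u : X × Z → ℂ}
    (hu : MemLp u 2 (μ.prod ν)) :
    ∀ᵐ p ∂(μ.prod ν), Integrable (fun y => κ p.1 y p.2 * u (y, p.2)) μ := by
  obtain ⟨u', hu', he⟩ := hu.1
  have hfin : ∫⁻ p, (∫⁻ y, ‖κ p.1 y p.2‖ₑ * ‖u' (y, p.2)‖ₑ ∂μ) ^ 2 ∂(μ.prod ν) < ⊤ := by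
    refine (hκ.lintegral_le (f := fun p => ‖u' p‖ₑ) hu'.measurable.enorm).trans_lt ?_
    rw [← sq_eLpNorm_two, ← eLpNorm_congr_ae he]
    exact ENNReal.mul_lt_top (by simp) (ENNReal.pow_lt_top hu.2)
  have hm1 : Measurable fun q : (X × Z) × X => κ q.1.1 q.2 q.1.2 :=
    hκ.meas.comp (by fun_prop : Measurable fun q : (X × Z) × X => (q.1.1, q.2, q.1.2))
  have hm : Measurable fun q : (X × Z) × X => κ q.1.1 q.2 q.1.2 * u' (q.2, q.1.2) :=
    hm1.mul (hu'.measurable.comp (by fun_prop))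
  have hae := ae_lt_top' (AEMeasurable.pow_const
    (Measurable.lintegral_prod_right' (f := fun q : (X × Z) × X =>
      ‖κ q.1.1 q.2 q.1.2‖ₑ * ‖u' (q.2, q.1.2)‖ₑ)
      (by simpa only [enorm_mul] using hm.enorm)).aemeasurable 2) hfin.ne
  filter_upwards [hae, ae_prod_snd (μ := μ) (ae_prod_swap he)] with p hp hz
  have : Integrable (fun y => κ p.1 y p.2 * u' (y, p.2)) μ := by
    refine ⟨(hm.comp (by fun_prop : Measurable fun y : X => (p, y))).aestronglyMeasurable, ?_⟩
    rw [hasFiniteIntegral_iff_enorm]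
    simp only [enorm_mul]
    by_contra! h
    rw [top_le_iff] at h
    simp [h] at hp
  refine this.congr ?_
  filter_upwards [hz] with y hy
  rw [hy]

lemma IsSchur.memLp_and_le (hκ : IsSchur μ ν κ A) {u : X × Z → ℂ} (hu : MemLp u 2 (μ.prod ν)) :
    MemLp (kernelFun μ κ u) 2 (μ.prod ν) ∧
      eLpNorm (kernelFun μ κ u) 2 (μ.prod ν) ≤ ENNReal.ofReal A * eLpNorm u 2 (μ.prod ν) := by
  obtain ⟨u', hu', he⟩ := hu.1
  have hc := kernelFun_congr κ he
  have hm1 : Measurable fun q : (X × Z) × X => κ q.1.1 q.2 q.1.2 :=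
    hκ.meas.comp (by fun_prop : Measurable fun q : (X × Z) × X => (q.1.1, q.2, q.1.2))
  have hm : Measurable fun q : (X × Z) × X => κ q.1.1 q.2 q.1.2 * u' (q.2, q.1.2) :=
    hm1.mul (hu'.measurable.comp (by fun_prop))
  have hsm : AEStronglyMeasurable (kernelFun μ κ u') (μ.prod ν) :=
    (hm.stronglyMeasurable.integral_prod_right' (ν := μ)).aestronglyMeasurable
  have hle : eLpNorm (kernelFun μ κ u) 2 (μ.prod ν)
      ≤ ENNReal.ofReal A * eLpNorm u 2 (μ.prod ν) := by
    rw [eLpNorm_congr_ae hc, eLpNorm_congr_ae he]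
    refine (ENNReal.pow_le_pow_left_iff (n := 2) (by norm_num)).1 ?_
    rw [mul_pow, sq_eLpNorm_two, sq_eLpNorm_two]
    refine le_trans (lintegral_mono fun p => ?_)
      (hκ.lintegral_le (f := fun p => ‖u' p‖ₑ) hu'.measurable.enorm)
    gcongr
    refine (enorm_integral_le_lintegral_enorm _).trans (le_of_eq ?_)
    simp only [enorm_mul]
  exact ⟨⟨hsm.congr hc.symm, hle.trans_lt (ENNReal.mul_lt_top (by simp) hu.2)⟩, hle⟩

/-- The bounded operator on `L²(X × Z)` with a Schur kernel. -/
def IsSchur.op (hκ : IsSchur μ ν κ A) : Lp ℂ 2 (μ.prod ν) →L[ℂ] Lp ℂ 2 (μ.prod ν) :=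
  LinearMap.mkContinuous
    { toFun := fun u => (hκ.memLp_and_le (Lp.memLp u)).1.toLp _
      map_add' := fun u u' => by
        ext1
        filter_upwards [(hκ.memLp_and_le (Lp.memLp (u + u'))).1.coeFn_toLp,
          (hκ.memLp_and_le (Lp.memLp u)).1.coeFn_toLp,
          (hκ.memLp_and_le (Lp.memLp u')).1.coeFn_toLp,
          Lp.coeFn_add ((hκ.memLp_and_le (Lp.memLp u)).1.toLp _)
            ((hκ.memLp_and_le (Lp.memLp u')).1.toLp _),
          kernelFun_congr κ (Lp.coeFn_add u u'), hκ.ae_integrable (Lp.memLp u),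
          hκ.ae_integrable (Lp.memLp u')] with p h1 h2 h3 h4 h5 h6 h7
        rw [h1, h4, Pi.add_apply, h2, h3, h5]
        simp only [kernelFun, Pi.add_apply, mul_add]
        rw [integral_add h6 h7]
      map_smul' := fun a u => by
        ext1
        filter_upwards [(hκ.memLp_and_le (Lp.memLp (a • u))).1.coeFn_toLp,
          (hκ.memLp_and_le (Lp.memLp u)).1.coeFn_toLp,
          Lp.coeFn_smul a ((hκ.memLp_and_le (Lp.memLp u)).1.toLp _),
          kernelFun_congr κ (Lp.coeFn_smul a u)] with p h1 h2 h3 h4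
        rw [h1, RingHom.id_apply, h3, Pi.smul_apply, h2, h4]
        simp only [kernelFun, Pi.smul_apply, smul_eq_mul, mul_left_comm _ a]
        rw [integral_const_mul] }
    A (fun u => by
      have h := (hκ.memLp_and_le (Lp.memLp u)).2
      rw [LinearMap.coe_mk, AddHom.coe_mk, Lp.norm_toLp, Lp.norm_def]
      refine (ENNReal.toReal_mono (ENNReal.mul_ne_top (by simp) (Lp.eLpNorm_ne_top u)) h).trans ?_
      rw [ENNReal.toReal_mul, ENNReal.toReal_ofReal hκ.nonneg])

lemma IsSchur.coeFn_op (hκ : IsSchur μ ν κ A) (u : Lp ℂ 2 (μ.prod ν)) :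
    hκ.op u =ᵐ[μ.prod ν] kernelFun μ κ u :=
  (hκ.memLp_and_le (Lp.memLp u)).1.coeFn_toLp

lemma IsSchur.norm_op_apply_le (hκ : IsSchur μ ν κ A) (u : Lp ℂ 2 (μ.prod ν)) :
    ‖hκ.op u‖ ≤ A * ‖u‖ :=
  (hκ.op.le_of_opNorm_le (LinearMap.mkContinuous_norm_le _ hκ.nonneg _) u)

lemma IsSchur.sub {κ' : X → X → Z → ℂ} {A' : ℝ} (hκ : IsSchur μ ν κ A) (hκ' : IsSchur μ ν κ' A') :
    IsSchur μ ν (fun x y z => κ x y z - κ' x y z) (A + A') where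
  nonneg := add_nonneg hκ.nonneg hκ'.nonneg
  meas := hκ.meas.sub hκ'.meas
  left := by
    filter_upwards [hκ.left, hκ'.left] with z h1 h2 x
    rw [ENNReal.ofReal_add hκ.nonneg hκ'.nonneg]
    refine le_trans (lintegral_mono fun y => enorm_sub_le) ?_
    rw [lintegral_add_left]
    · exact add_le_add (h1 x) (h2 x)
    · exact (hκ.meas.comp (by fun_prop : Measurable fun y : X => (x, y, z))).enorm
  right := by
    filter_upwards [hκ.right, hκ'.right] with z h1 h2 y
    rw [ENNReal.ofReal_add hκ.nonneg hκ'.nonneg]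
    refine le_trans (lintegral_mono fun x => enorm_sub_le) ?_
    rw [lintegral_add_left]
    · exact add_le_add (h1 y) (h2 y)
    · exact (hκ.meas.comp (by fun_prop : Measurable fun x : X => (x, y, z))).enorm

lemma IsSchur.op_sub {κ' : X → X → Z → ℂ} {A' : ℝ} (hκ : IsSchur μ ν κ A)
    (hκ' : IsSchur μ ν κ' A') (u : Lp ℂ 2 (μ.prod ν)) :
    hκ.op u - hκ'.op u = (hκ.sub hκ').op u := by
  ext1
  filter_upwards [Lp.coeFn_sub (hκ.op u) (hκ'.op u), hκ.coeFn_op u, hκ'.coeFn_op u,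
    (hκ.sub hκ').coeFn_op u, hκ.ae_integrable (Lp.memLp u), hκ'.ae_integrable (Lp.memLp u)]
    with p h1 h2 h3 h4 h5 h6
  rw [h1, Pi.sub_apply, h2, h3, h4]
  simp only [kernelFun, sub_mul]
  rw [integral_sub h5 h6]

/-! ### Multiplication by bounded weights -/

/-- A bounded measurable real function. -/
structure Weight (X : Type*) [MeasurableSpace X] where
  /-- the function -/
  toFun : X → ℝ
  meas : Measurable toFun
  /-- an upper bound for the absolute value -/
  bound : ℝ
  bound_nonneg : 0 ≤ bound
  abs_le : ∀ x, |toFun x| ≤ bound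

/-- The weight depending on the first variable only. -/
def Weight.fst (a : Weight X) (Z : Type*) [MeasurableSpace Z] : Weight (X × Z) where
  toFun := fun p => a.toFun p.1
  meas := a.meas.comp measurable_fst
  bound := a.bound
  bound_nonneg := a.bound_nonneg
  abs_le := fun p => a.abs_le p.1

lemma Weight.memLp_mul (a : Weight X) {μ : Measure X} {f : X → ℂ} (hf : MemLp f 2 μ) :
    MemLp (fun x => (a.toFun x : ℂ) * f x) 2 μ := by
  refine MemLp.of_le_mul (c := a.bound) hf
    ((Complex.measurable_ofReal.comp a.meas).aestronglyMeasurable.mul hf.1) ?_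
  filter_upwards with x
  rw [norm_mul, Complex.norm_real]
  exact mul_le_mul_of_nonneg_right (a.abs_le x) (norm_nonneg _)

/-- Multiplication by a weight, as a bounded operator on `L²`. -/
def Weight.mul (a : Weight X) (μ : Measure X) : Lp ℂ 2 μ →L[ℂ] Lp ℂ 2 μ :=
  LinearMap.mkContinuous
    { toFun := fun f => (a.memLp_mul (Lp.memLp f)).toLp _
      map_add' := fun f g => by
        ext1
        filter_upwards [(a.memLp_mul (Lp.memLp (f + g))).coeFn_toLp,
          (a.memLp_mul (Lp.memLp f)).coeFn_toLp, (a.memLp_mul (Lp.memLp g)).coeFn_toLp,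
          Lp.coeFn_add f g, Lp.coeFn_add ((a.memLp_mul (Lp.memLp f)).toLp _)
          ((a.memLp_mul (Lp.memLp g)).toLp _)] with x h1 h2 h3 h4 h5
        rw [h1, h5, Pi.add_apply, h2, h3, h4, Pi.add_apply, mul_add]
      map_smul' := fun c f => by
        ext1
        filter_upwards [(a.memLp_mul (Lp.memLp (c • f))).coeFn_toLp,
          (a.memLp_mul (Lp.memLp f)).coeFn_toLp,
          Lp.coeFn_smul c f, Lp.coeFn_smul c ((a.memLp_mul (Lp.memLp f)).toLp _)]
          with x h1 h2 h3 h4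
        rw [h1, RingHom.id_apply, h4, Pi.smul_apply, h2, h3, Pi.smul_apply, smul_eq_mul,
          smul_eq_mul, mul_left_comm] }
    a.bound (fun f => by
      rw [LinearMap.coe_mk, AddHom.coe_mk]
      refine Lp.norm_le_mul_norm_of_ae_le_mul ?_
      filter_upwards [(a.memLp_mul (Lp.memLp f)).coeFn_toLp] with x h1
      rw [h1, norm_mul, Complex.norm_real]
      exact mul_le_mul_of_nonneg_right (a.abs_le x) (norm_nonneg _))

lemma Weight.coeFn_mul (a : Weight X) {μ : Measure X} (f : Lp ℂ 2 μ) :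
    a.mul μ f =ᵐ[μ] fun x => (a.toFun x : ℂ) * f x :=
  (a.memLp_mul (Lp.memLp f)).coeFn_toLp

lemma Weight.norm_mul_le (a : Weight X) (μ : Measure X) : ‖a.mul μ‖ ≤ a.bound :=
  LinearMap.mkContinuous_norm_le _ a.bound_nonneg _

/-- An intertwining relation between kernels passes to the operators. With `κ'(x,y) = a(x) κ(x,y) /
a(y)` it reduces a weighted bound for `κ` to Schur's test for `κ'`. -/
lemma IsSchur.mul_op {κ' : X → X → Z → ℂ} {A' : ℝ} (hκ : IsSchur μ ν κ A)
    (hκ' : IsSchur μ ν κ' A') (a b : Weight X)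
    (h : ∀ x y z, (a.toFun x : ℂ) * κ x y z = κ' x y z * b.toFun y) (u : Lp ℂ 2 (μ.prod ν)) :
    (a.fst Z).mul _ (hκ.op u) = hκ'.op ((b.fst Z).mul _ u) := by
  ext1
  filter_upwards [(a.fst Z).coeFn_mul (hκ.op u), hκ.coeFn_op u,
    hκ'.coeFn_op ((b.fst Z).mul _ u),
    kernelFun_congr κ' ((b.fst Z).coeFn_mul u)] with p h1 h2 h3 h4
  rw [h1, h2, h3, h4]
  simp only [kernelFun, Weight.fst]
  rw [← integral_const_mul]
  refine integral_congr_ae (ae_of_all _ fun y => ?_)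
  simp only [← mul_assoc, h]

lemma IsSchur.op_eq_op_mul {κ' : X → X → Z → ℂ} {A' : ℝ} (hκ : IsSchur μ ν κ A)
    (hκ' : IsSchur μ ν κ' A') (b : Weight X) (h : ∀ x y z, κ x y z = κ' x y z * b.toFun y)
    (u : Lp ℂ 2 (μ.prod ν)) : hκ.op u = hκ'.op ((b.fst Z).mul _ u) := by
  ext1
  filter_upwards [hκ.coeFn_op u, hκ'.coeFn_op ((b.fst Z).mul _ u),
    kernelFun_congr κ' ((b.fst Z).coeFn_mul u)] with p h2 h3 h4
  rw [h2, h3, h4]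
  simp only [kernelFun, Weight.fst, ← mul_assoc, h]

end Schur

/-! ### The isometry `ℓ²(ℕ, L²(X)) → L²(X × Z)` given by an orthonormal system of `L²(Z)` -/

section Tensor

set_option linter.unusedSectionVars false

variable {X Z : Type*} [MeasurableSpace X] [MeasurableSpace Z]

/-- Functions `v n` that are orthonormal in `L²(ν)`. -/
structure IsONSystem (ν : Measure Z) (v : ℕ → Z → ℂ) : Prop where
  memLp : ∀ n, MemLp (v n) 2 ν
  orthonormal : ∀ n m, ∫ z, conj (v n z) * v m z ∂ν = if n = m then 1 else 0

variable {μ : Measure X} {ν : Measure Z} [SigmaFinite μ] [SigmaFinite ν] {v : ℕ → Z → ℂ}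

lemma memLp_tensor {f : X → ℂ} {w : Z → ℂ} (hf : MemLp f 2 μ) (hw : MemLp w 2 ν) :
    MemLp (fun p : X × Z => f p.1 * w p.2) 2 (μ.prod ν) := by
  refine ⟨hf.1.comp_fst.mul hw.1.comp_snd, ?_⟩
  have h : eLpNorm (fun p : X × Z => f p.1 * w p.2) 2 (μ.prod ν) ^ 2 < ⊤ := by
    rw [sq_eLpNorm_two]
    simp only [enorm_mul, mul_pow]
    rw [lintegral_prod_mul (hf.1.enorm.pow_const 2) (hw.1.enorm.pow_const 2),
      ← sq_eLpNorm_two, ← sq_eLpNorm_two]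
    exact ENNReal.mul_lt_top (ENNReal.pow_lt_top hf.2) (ENNReal.pow_lt_top hw.2)
  by_contra! htop
  rw [top_le_iff] at htop
  simp [htop] at h

/-- The linear map `f ↦ f ⊗ w`. -/
def tensorLin (μ : Measure X) [SigmaFinite μ] {w : Z → ℂ} (hw : MemLp w 2 ν) :
    Lp ℂ 2 μ →ₗ[ℂ] Lp ℂ 2 (μ.prod ν) where
  toFun f := (memLp_tensor (Lp.memLp f) hw).toLp _
  map_add' f g := by
    ext1
    filter_upwards [(memLp_tensor (Lp.memLp (f + g)) hw).coeFn_toLp,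
      (memLp_tensor (Lp.memLp f) hw).coeFn_toLp, (memLp_tensor (Lp.memLp g) hw).coeFn_toLp,
      Lp.coeFn_add ((memLp_tensor (Lp.memLp f) hw).toLp _) ((memLp_tensor (Lp.memLp g) hw).toLp _),
      ae_prod_fst (ν := ν) (Lp.coeFn_add f g)] with p h1 h2 h3 h4 h5
    rw [h1, h4, Pi.add_apply, h2, h3, h5, Pi.add_apply, add_mul]
  map_smul' c f := by
    ext1
    filter_upwards [(memLp_tensor (Lp.memLp (c • f)) hw).coeFn_toLp,
      (memLp_tensor (Lp.memLp f) hw).coeFn_toLp,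
      Lp.coeFn_smul c ((memLp_tensor (Lp.memLp f) hw).toLp _),
      ae_prod_fst (ν := ν) (Lp.coeFn_smul c f)] with p h1 h2 h3 h4
    rw [h1, RingHom.id_apply, h3, Pi.smul_apply, h2, h4, Pi.smul_apply, smul_eq_mul, smul_eq_mul,
      mul_assoc]

lemma coeFn_tensorLin {w : Z → ℂ} (hw : MemLp w 2 ν) (f : Lp ℂ 2 μ) :
    tensorLin μ hw f =ᵐ[μ.prod ν] fun p => f p.1 * w p.2 :=
  (memLp_tensor (Lp.memLp f) hw).coeFn_toLp

lemma inner_tensorLin {w w' : Z → ℂ} (hw : MemLp w 2 ν) (hw' : MemLp w' 2 ν)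
    (f g : Lp ℂ 2 μ) :
    inner ℂ (tensorLin μ hw f) (tensorLin μ hw' g)
      = inner ℂ f g * ∫ z, conj (w z) * w' z ∂ν := by
  rw [L2.inner_def, L2.inner_def, ← integral_prod_mul]
  refine integral_congr_ae ?_
  filter_upwards [coeFn_tensorLin hw f, coeFn_tensorLin hw' g] with p h1 h2
  rw [h1, h2]
  simp only [RCLike.inner_apply, map_mul]
  ring

/-- The isometry `f ↦ f ⊗ v n`. -/
def IsONSystem.tensor (hv : IsONSystem ν v) (μ : Measure X) [SigmaFinite μ] (n : ℕ) :
    Lp ℂ 2 μ →ₗᵢ[ℂ] Lp ℂ 2 (μ.prod ν) :=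
  (tensorLin μ (hv.memLp n)).isometryOfInner fun f g => by
    rw [inner_tensorLin, hv.orthonormal]; simp

lemma IsONSystem.coeFn_tensor (hv : IsONSystem ν v) (n : ℕ) (f : Lp ℂ 2 μ) :
    hv.tensor μ n f =ᵐ[μ.prod ν] fun p => f p.1 * v n p.2 :=
  coeFn_tensorLin (hv.memLp n) f

lemma IsONSystem.orthogonalFamily (hv : IsONSystem ν v) (μ : Measure X) [SigmaFinite μ] :
    OrthogonalFamily ℂ (fun _ : ℕ => Lp ℂ 2 μ) (hv.tensor μ) := by
  intro n m hnm f g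
  have := inner_tensorLin (hv.memLp n) (hv.memLp m) f g
  rw [hv.orthonormal, if_neg hnm, mul_zero] at this
  exact this

/-- The isometry `(g n)_n ↦ ∑ g n ⊗ v n`. -/
def IsONSystem.synth (hv : IsONSystem ν v) (μ : Measure X) [SigmaFinite μ] :
    lp (fun _ : ℕ => Lp ℂ 2 μ) 2 →ₗᵢ[ℂ] Lp ℂ 2 (μ.prod ν) :=
  (hv.orthogonalFamily μ).linearIsometry

lemma IsONSystem.hasSum_synth (hv : IsONSystem ν v) (g : lp (fun _ : ℕ => Lp ℂ 2 μ) 2) :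
    HasSum (fun n => hv.tensor μ n (g n)) (hv.synth μ g) :=
  (hv.orthogonalFamily μ).hasSum_linearIsometry g

/-- The adjoint of the isometry `synth`: the sequence of coefficients with respect to `v n`. -/
def IsONSystem.coeffs (hv : IsONSystem ν v) (μ : Measure X) [SigmaFinite μ] :
    Lp ℂ 2 (μ.prod ν) →L[ℂ] lp (fun _ : ℕ => Lp ℂ 2 μ) 2 :=
  ContinuousLinearMap.adjoint (hv.synth μ).toContinuousLinearMap

/-- The adjoint of the isometry `tensor n`. -/
def IsONSystem.coeff (hv : IsONSystem ν v) (μ : Measure X) [SigmaFinite μ] (n : ℕ) :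
    Lp ℂ 2 (μ.prod ν) →L[ℂ] Lp ℂ 2 μ :=
  ContinuousLinearMap.adjoint (hv.tensor μ n).toContinuousLinearMap

/-- Both sides are adjoints, so it suffices to pair with sequences concentrated in the single index
`n`. -/
lemma IsONSystem.coeffs_apply (hv : IsONSystem ν v) (w : Lp ℂ 2 (μ.prod ν)) (n : ℕ) :
    hv.coeffs μ w n = hv.coeff μ n w := by
  refine ext_inner_left ℂ fun f : Lp ℂ 2 μ => ?_
  have h1 := lp.inner_single_left (𝕜 := ℂ) (G := fun _ : ℕ => Lp ℂ 2 μ) n f (hv.coeffs μ w)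
  have h2 : hv.synth μ (lp.single 2 n f) = hv.tensor μ n f :=
    (hv.orthogonalFamily μ).linearIsometry_apply_single f
  rw [IsONSystem.coeff, ContinuousLinearMap.adjoint_inner_right]
  refine h1.symm.trans ?_
  rw [IsONSystem.coeffs, ContinuousLinearMap.adjoint_inner_right]
  exact congrArg (fun y => inner ℂ y w) h2

lemma IsONSystem.coeffs_synth (hv : IsONSystem ν v) (g : lp (fun _ : ℕ => Lp ℂ 2 μ) 2) :
    hv.coeffs μ (hv.synth μ g) = g := by
  refine ext_inner_left ℂ fun f => ?_
  rw [IsONSystem.coeffs, ContinuousLinearMap.adjoint_inner_right]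
  exact (hv.synth μ).inner_map_map f g

lemma IsONSystem.norm_coeffs_le (hv : IsONSystem ν v) (w : Lp ℂ 2 (μ.prod ν)) :
    ‖hv.coeffs μ w‖ ≤ ‖w‖ := by
  have h : ‖hv.coeffs μ‖ ≤ 1 := by
    rw [IsONSystem.coeffs, LinearIsometryEquiv.norm_map]
    exact (hv.synth μ).norm_toContinuousLinearMap_le
  simpa using (hv.coeffs μ).le_of_opNorm_le h w

lemma memLp_partialInner {w : Z → ℂ} (hw : MemLp w 2 ν) {F : X × Z → ℂ}
    (hF : MemLp F 2 (μ.prod ν)) : MemLp (fun x => ∫ z, conj (w z) * F (x, z) ∂ν) 2 μ := by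
  have hsm : AEStronglyMeasurable (fun p : X × Z => conj (w p.2) * F p) (μ.prod ν) :=
    (Complex.continuous_conj.comp_aestronglyMeasurable hw.1).comp_snd.mul hF.1
  refine ⟨hsm.integral_prod_right', ?_⟩
  have h : eLpNorm (fun x => ∫ z, conj (w z) * F (x, z) ∂ν) 2 μ ^ 2 < ⊤ := by
    rw [sq_eLpNorm_two]
    have hle : ∀ᵐ x ∂μ, ‖∫ z, conj (w z) * F (x, z) ∂ν‖ₑ ^ 2
        ≤ (∫⁻ z, ‖w z‖ₑ ^ 2 ∂ν) * ∫⁻ z, ‖F (x, z)‖ₑ ^ 2 ∂ν := by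
      filter_upwards [hF.1.prodMk_left] with x hx
      refine le_trans ?_ (sq_lintegral_mul_le ν hw.1.enorm hx.enorm)
      gcongr
      refine (enorm_integral_le_lintegral_enorm _).trans (le_of_eq ?_)
      simp only [enorm_mul, RCLike.enorm_conj]
    refine (lintegral_mono_ae hle).trans_lt ?_
    rw [← sq_eLpNorm_two, lintegral_const_mul' _ _ (ENNReal.pow_lt_top hw.2).ne,
      ← lintegral_prod (fun p : X × Z => ‖F p‖ₑ ^ 2) (hF.1.enorm.pow_const 2), ← sq_eLpNorm_two]
    exact ENNReal.mul_lt_top (ENNReal.pow_lt_top hw.2) (ENNReal.pow_lt_top hF.2)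
  by_contra! htop
  rw [top_le_iff] at htop
  simp [htop] at h

lemma IsONSystem.coeFn_coeff (hv : IsONSystem ν v) (n : ℕ) (F : Lp ℂ 2 (μ.prod ν)) :
    hv.coeff μ n F =ᵐ[μ] fun x => ∫ z, conj (v n z) * F (x, z) ∂ν := by
  have hm := memLp_partialInner (hv.memLp n) (Lp.memLp F)
  have : hv.coeff μ n F = hm.toLp _ := by
    refine ext_inner_left ℂ fun f => ?_
    rw [IsONSystem.coeff, ContinuousLinearMap.adjoint_inner_right]
    change inner ℂ (hv.tensor μ n f) F = _
    rw [L2.inner_def, integral_prod _ (L2.integrable_inner _ _), L2.inner_def]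
    refine integral_congr_ae ?_
    filter_upwards [Measure.ae_ae_of_ae_prod (hv.coeFn_tensor n f), hm.coeFn_toLp] with x h1 h2
    rw [h2, RCLike.inner_apply, mul_comm, ← integral_const_mul]
    refine integral_congr_ae ?_
    filter_upwards [h1] with z hz
    rw [hz, RCLike.inner_apply, map_mul]
    ring
  rw [this]
  exact hm.coeFn_toLp

/-- Componentwise multiplication by a weight. -/
def Weight.env (a : Weight X) (μ : Measure X) :
    lp (fun _ : ℕ => Lp ℂ 2 μ) 2 →L[ℂ] lp (fun _ : ℕ => Lp ℂ 2 μ) 2 :=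
  lp.mapCLM 2 (fun _ => a.mul μ) a.bound_nonneg fun _ => a.norm_mul_le μ

lemma Weight.env_apply (a : Weight X) (g : lp (fun _ : ℕ => Lp ℂ 2 μ) 2) (n : ℕ) :
    a.env μ g n = a.mul μ (g n) := rfl

lemma IsONSystem.tensor_mul (hv : IsONSystem ν v) (a : Weight X) (n : ℕ) (f : Lp ℂ 2 μ) :
    hv.tensor μ n (a.mul μ f) = (a.fst Z).mul _ (hv.tensor μ n f) := by
  ext1
  filter_upwards [hv.coeFn_tensor n (a.mul μ f), (a.fst Z).coeFn_mul (hv.tensor μ n f),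
    hv.coeFn_tensor n f, ae_prod_fst (ν := ν) (a.coeFn_mul f)] with p h1 h2 h3 h4
  rw [h1, h2, h3, h4, Weight.fst, mul_assoc]

/-- Weights in `k` act on one tensor factor and the `v n` live in the other. Together with
`IsONSystem.coeffs_mul` this transfers weighted norms between sequences and functions of `(k,z)`. -/
lemma IsONSystem.synth_env (hv : IsONSystem ν v) (a : Weight X)
    (g : lp (fun _ : ℕ => Lp ℂ 2 μ) 2) :
    hv.synth μ (a.env μ g) = (a.fst Z).mul _ (hv.synth μ g) := by
  have h1 := hv.hasSum_synth (a.env μ g)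
  have h2 := ((a.fst Z).mul (μ.prod ν)).hasSum (hv.hasSum_synth g)
  refine h1.unique ?_
  simpa only [Weight.env_apply, hv.tensor_mul] using h2

lemma IsONSystem.coeffs_mul (hv : IsONSystem ν v) (a : Weight X) (F : Lp ℂ 2 (μ.prod ν)) :
    hv.coeffs μ ((a.fst Z).mul _ F) = a.env μ (hv.coeffs μ F) := by
  ext1
  funext n
  rw [Weight.env_apply, hv.coeffs_apply, hv.coeffs_apply]
  ext1
  filter_upwards [hv.coeFn_coeff n ((a.fst Z).mul _ F), a.coeFn_mul (hv.coeff μ n F),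
    hv.coeFn_coeff n F, Measure.ae_ae_of_ae_prod ((a.fst Z).coeFn_mul F)] with x h1 h2 h3 h4
  rw [h1, h2, h3, ← integral_const_mul]
  refine integral_congr_ae ?_
  filter_upwards [h4] with z hz
  rw [hz, Weight.fst]
  ring

end Tensor

/-! ### The Fourier transform of integrable functions -/

lemma fourierConst_pos (d : ℕ) : 0 < fourierConst d := Real.rpow_pos_of_pos (by positivity) _

lemma integrable_planeWave_mul {w : Sp d → ℂ} {μ : Measure (Sp d)} (hw : Integrable w μ)
    (x : Sp d) : Integrable (fun k => planeWave k x * w k) μ := by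
  refine hw.bdd_mul (c := 1) (Continuous.aestronglyMeasurable
    (continuous_planeWave.comp (f := fun k : Sp d => (k, x)) (by fun_prop))) ?_
  exact ae_of_all _ fun k => (norm_planeWave k x).le

/-- An integrable function is determined by its Fourier transform. -/
theorem ae_eq_zero_of_fourier_eq_zero {u : Sp d → ℂ} (hu : Integrable u)
    (h : ∀ x, ∫ k, planeWave k x * u k = 0) : u =ᵐ[volume] 0 := by
  have hF : ∀ ξ : Sp d, FourierTransform.fourier u ξ = 0 := by
    intro ξ
    rw [Real.fourier_eq', ← h ((-(2 * Real.pi)) • ξ)]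
    refine integral_congr_ae (ae_of_all _ fun k => ?_)
    simp only [planeWave, smul_eq_mul, real_inner_smul_right]
    congr 2
    push_cast
    ring
  refine ae_eq_zero_of_integral_contDiff_smul_eq_zero hu.locallyIntegrable fun φ hφ hc => ?_
  have hc' : HasCompactSupport (Complex.ofRealCLM ∘ φ) := hc.comp_left rfl
  have hφ' : ContDiff ℝ ∞ (Complex.ofRealCLM ∘ φ) := by fun_prop
  set ψ : SchwartzMap (Sp d) ℂ := hc'.toSchwartzMap hφ' with hψ
  have hinv : FourierTransform.fourier (FourierTransformInv.fourierInv ψ) = ψ :=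
    FourierTransform.fourier_fourierInv_eq ψ
  set χ : SchwartzMap (Sp d) ℂ := FourierTransformInv.fourierInv ψ
  -- Every test function is the Fourier transform of a Schwartz function `χ`, and duality moves the
  -- transform onto `u`: `∫ u φ = ∫ û χ = 0`.
  have key := VectorFourier.integral_fourierIntegral_smul_eq_flip (L := innerₗ (Sp d))
    Real.continuous_fourierChar continuous_inner hu (χ.integrable (μ := volume))
  have e1 : ∀ x, VectorFourier.fourierIntegral Real.fourierChar volume (innerₗ (Sp d)).flip χ x
      = (φ x : ℂ) := by
    intro x
    rw [flip_innerₗ]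
    change FourierTransform.fourier (χ : Sp d → ℂ) x = _
    rw [← SchwartzMap.fourier_coe, hinv]
    rfl
  have e2 : ∀ ξ, VectorFourier.fourierIntegral Real.fourierChar volume (innerₗ (Sp d)) u ξ = 0 :=
    hF
  simp only [e1, e2, zero_smul, integral_zero] at key
  rw [key]
  refine integral_congr_ae (ae_of_all _ fun x => ?_)
  simp [mul_comm]

/-- The transforms in the definition of `𝓤⁰` are given only existentially; uniqueness lets them be
replaced by explicit ones. -/
lemma HasFourierL1.ae_eq {f w w' : Sp d → ℂ} (h : HasFourierL1 f w) (h' : HasFourierL1 f w') :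
    w =ᵐ[volume] w' := by
  have h0 : (fun k => w k - w' k) =ᵐ[volume] 0 := by
    refine ae_eq_zero_of_fourier_eq_zero (h.1.sub h'.1) fun x => ?_
    have e := (h.2 x).symm.trans (h'.2 x)
    have hne : (fourierConst d : ℂ) ≠ 0 := by exact_mod_cast (fourierConst_pos d).ne'
    simp only [mul_sub]
    rw [integral_sub (integrable_planeWave_mul h.1 x) (integrable_planeWave_mul h'.1 x),
      mul_left_cancel₀ hne e, sub_self]
  filter_upwards [h0] with k hk
  exact sub_eq_zero.1 hk

/-! ### The weight -/

/-- The truncated weight `min ((1 + |k|²)^{μ/2}, R)`. -/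
def kpWeight (d : ℕ) (μ R : ℝ) (hR : 0 < R) : Weight (Sp d) where
  toFun k := min ((1 + ‖k‖ ^ 2) ^ (μ / 2)) R
  meas := by fun_prop
  bound := R
  bound_nonneg := hR.le
  abs_le k := by
    rw [abs_of_nonneg (le_min (by positivity) hR.le)]
    exact min_le_right _ _

lemma kpWeight_pos {μ R : ℝ} (hR : 0 < R) (k : Sp d) : 0 < (kpWeight d μ R hR).toFun k :=
  lt_min (by positivity) hR

/-- A Peetre-type inequality, from `1+|k|² ≤ (1+|k-k'|)²(1+|k'|²)`. Truncation preserves it because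
the factor `(1+|k-k'|)^μ` is at least one. -/
lemma kpWeight_submul {μ R : ℝ} (hμ : 0 ≤ μ) (hR : 0 < R) (k k' : Sp d) :
    (kpWeight d μ R hR).toFun k ≤ (1 + ‖k - k'‖) ^ μ * (kpWeight d μ R hR).toFun k' := by
  have hn : ‖k‖ ≤ ‖k - k'‖ + ‖k'‖ := by simpa using norm_add_le (k - k') k'
  have h0 := norm_nonneg (k - k')
  have h1 := norm_nonneg k'
  have hone : 1 ≤ (1 + ‖k - k'‖) ^ μ := Real.one_le_rpow (by linarith) hμ
  have hkey : 1 + ‖k‖ ^ 2 ≤ (1 + ‖k - k'‖) ^ 2 * (1 + ‖k'‖ ^ 2) := by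
    have h2 : ‖k‖ ^ 2 ≤ (‖k - k'‖ + ‖k'‖) ^ 2 := pow_le_pow_left₀ (norm_nonneg k) hn 2
    nlinarith [sq_nonneg (‖k'‖ - 1), mul_nonneg h0 h1, mul_nonneg h0 (sq_nonneg ‖k'‖),
      mul_nonneg (sq_nonneg ‖k - k'‖) (sq_nonneg ‖k'‖), mul_nonneg h0 (sq_nonneg (‖k'‖ - 1))]
  have hmain : (1 + ‖k‖ ^ 2) ^ (μ / 2) ≤ (1 + ‖k - k'‖) ^ μ * (1 + ‖k'‖ ^ 2) ^ (μ / 2) := by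
    refine (Real.rpow_le_rpow (by positivity) hkey (by positivity)).trans (le_of_eq ?_)
    rw [Real.mul_rpow (by positivity) (by positivity), ← Real.rpow_natCast,
      ← Real.rpow_mul (by positivity)]
    congr 2
    push_cast
    ring
  simp only [kpWeight]
  rcases le_total ((1 + ‖k'‖ ^ 2) ^ (μ / 2)) R with h | h
  · rw [min_eq_left h]
    exact (min_le_left _ _).trans hmain
  · rw [min_eq_right h]
    exact (min_le_right _ _).trans (le_mul_of_one_le_left hR.le hone)

/-- The truncation level is chosen so that the weight is saturated on `‖k‖ ≥ r/ε`, the region of the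
far frequencies. -/
lemma kpWeight_eq_of_le {μ R r ε : ℝ} (hμ : 0 ≤ μ) (hR : 0 < R) (hr : 0 < r) (hε : 0 < ε)
    (hRe : R = (r / ε) ^ μ) {k : Sp d} (hk : r / ε ≤ ‖k‖) : (kpWeight d μ R hR).toFun k = R := by
  refine min_eq_right ?_
  have h0 : 0 ≤ r / ε := by positivity
  have h2 : (r / ε) ^ 2 ≤ 1 + ‖k‖ ^ 2 := by
    have := pow_le_pow_left₀ h0 hk 2
    linarith
  calc R = ((r / ε) ^ 2) ^ (μ / 2) := by
        rw [hRe, ← Real.rpow_natCast, ← Real.rpow_mul h0]; congr 1; push_cast; ring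
    _ ≤ _ := Real.rpow_le_rpow (by positivity) h2 (by positivity)

/-! ### The kernels of the potential -/

/-- The integrand of the `𝓦_μ`-norm. -/
def majorant (μ : ℝ) (Vhat : Sp d → Sp d → ℂ) (k z : Sp d) : ℝ≥0∞ :=
  ENNReal.ofReal (fourierConst d) * (ENNReal.ofReal ((1 + ‖k‖) ^ μ) * ‖Vhat k z‖ₑ)

/-- `Vhat` is the partial Fourier transform of `V`, with `𝓦_μ`-norm at most `c`. -/
structure IsPotHat (L : Matrix (Fin d) (Fin d) ℝ) (μ c : ℝ) (V : Sp d → Sp d → ℝ)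
    (Vhat : Sp d → Sp d → ℂ) : Prop where
  mu_nonneg : 0 ≤ μ
  nonneg : 0 ≤ c
  meas : Measurable (Function.uncurry Vhat)
  fourier : ∀ᵐ z ∂(volume.restrict (cell L)),
    HasFourierL1 (fun x => (V x z : ℂ)) (fun k => Vhat k z)
  mass : ∀ᵐ z ∂(volume.restrict (cell L)), ∫⁻ k, majorant μ Vhat k z ≤ ENNReal.ofReal c

/-- The constant `c` is the `𝓦_μ`-norm itself, computed from the given partial transform. -/
lemma MemW.exists_isPotHat {L : Matrix (Fin d) (Fin d) ℝ} {μ : ℝ} (hμ : 0 ≤ μ)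
    {V : Sp d → Sp d → ℝ} (hV : MemW L μ V) : ∃ c Vhat, IsPotHat L μ c V Vhat := by
  obtain ⟨Vhat, hm, hF, hlt⟩ := hV.norm_lt_top
  refine ⟨(normW L μ Vhat).toReal, Vhat, hμ, ENNReal.toReal_nonneg, hm,
    ae_restrict_of_ae hF, ?_⟩
  rw [ENNReal.ofReal_toReal hlt.ne]
  filter_upwards [ENNReal.ae_le_essSup (μ := volume.restrict (cell L))
    (fun z => ∫⁻ k : Sp d, ENNReal.ofReal ((1 + ‖k‖) ^ μ) * ‖Vhat k z‖ₑ)] with z hz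
  simp only [majorant]
  rw [lintegral_const_mul' _ _ ENNReal.ofReal_ne_top, normW]
  gcongr

section Kernels

variable {L : Matrix (Fin d) (Fin d) ℝ} {μ c : ℝ} {V : Sp d → Sp d → ℝ} {Vhat : Sp d → Sp d → ℂ}

lemma IsPotHat.measurable_majorant (h : IsPotHat L μ c V Vhat) :
    Measurable fun p : Sp d × Sp d => majorant μ Vhat p.1 p.2 := by
  have h1 : Measurable fun p : Sp d × Sp d => Vhat p.1 p.2 := h.meas
  unfold majorant
  fun_prop

lemma enorm_fourierConst_mul_le (h : IsPotHat L μ c V Vhat) (k z : Sp d) :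
    ‖(fourierConst d : ℂ) * Vhat k z‖ₑ ≤ majorant μ Vhat k z := by
  have h1 : ENNReal.ofReal 1 ≤ ENNReal.ofReal ((1 + ‖k‖) ^ μ) :=
    ENNReal.ofReal_le_ofReal (Real.one_le_rpow (by linarith [norm_nonneg k]) h.mu_nonneg)
  rw [enorm_mul, majorant]
  gcongr
  · rw [← ofReal_norm, Complex.norm_real, Real.norm_of_nonneg (fourierConst_pos d).le]
  · exact le_mul_of_one_le_left' (by simpa using h1)

/-- If `a ≤ (1 + |k|)^μ b` then `a |V̂(k, z)| / b` is controlled by the majorant. -/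
lemma enorm_weighted_le (k z : Sp d) {a b : ℝ} (ha : 0 ≤ a) (hb : 0 < b)
    (hab : a ≤ (1 + ‖k‖) ^ μ * b) :
    ‖(a : ℂ) * ((fourierConst d : ℂ) * Vhat k z) / (b : ℂ)‖ₑ ≤ majorant μ Vhat k z := by
  have e : ‖(a : ℂ) * ((fourierConst d : ℂ) * Vhat k z) / (b : ℂ)‖
      = fourierConst d * (a / b * ‖Vhat k z‖) := by
    rw [norm_div, norm_mul, norm_mul, Complex.norm_real, Complex.norm_real, Complex.norm_real,
      Real.norm_of_nonneg ha, Real.norm_of_nonneg hb.le,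
      Real.norm_of_nonneg (fourierConst_pos d).le]
    ring
  rw [← ofReal_norm, e, ENNReal.ofReal_mul (fourierConst_pos d).le,
    ENNReal.ofReal_mul (by positivity), ofReal_norm, majorant]
  gcongr
  rwa [div_le_iff₀ hb]

/-- The convolution kernel of `𝓤⁰`. -/
def kernel0 (Vhat : Sp d → Sp d → ℂ) (x y z : Sp d) : ℂ :=
  (fourierConst d : ℂ) * Vhat (x - y) z

lemma IsPotHat.measurable_kernel0 (h : IsPotHat L μ c V Vhat) :
    Measurable fun p : Sp d × Sp d × Sp d => kernel0 Vhat p.1 p.2.1 p.2.2 := by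
  have h1 : Measurable fun p : Sp d × Sp d × Sp d => Vhat (p.1 - p.2.1) p.2.2 :=
    h.meas.comp (by fun_prop : Measurable fun p : Sp d × Sp d × Sp d => (p.1 - p.2.1, p.2.2))
  exact measurable_const.mul h1

/-- Domination by a convolution kernel: translation and reflection invariance make every row and
column integral of the majorant equal to its mass. -/
lemma IsPotHat.isSchur_of_le (h : IsPotHat L μ c V Vhat) {κ : Sp d → Sp d → Sp d → ℂ}
    (hm : Measurable fun p : Sp d × Sp d × Sp d => κ p.1 p.2.1 p.2.2)
    (hle : ∀ x y z, ‖κ x y z‖ₑ ≤ majorant μ Vhat (x - y) z) :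
    IsSchur volume (volume.restrict (cell L)) κ c where
  nonneg := h.nonneg
  meas := hm
  left := by
    filter_upwards [h.mass] with z hz x
    refine (lintegral_mono fun y => hle x y z).trans ?_
    rwa [lintegral_sub_left_eq_self (fun k => majorant μ Vhat k z) x]
  right := by
    filter_upwards [h.mass] with z hz y
    refine (lintegral_mono fun x => hle x y z).trans ?_
    rwa [lintegral_sub_right_eq_self (fun k => majorant μ Vhat k z) y]

lemma IsPotHat.isSchur_kernel0 (h : IsPotHat L μ c V Vhat) :
    IsSchur volume (volume.restrict (cell L)) (kernel0 Vhat) c :=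
  h.isSchur_of_le h.measurable_kernel0 fun _ _ _ => enorm_fourierConst_mul_le h _ _

/-- The kernel of `𝓤⁰` conjugated with the weight. -/
def kernel0Weighted (Vhat : Sp d → Sp d → ℂ) (a : Weight (Sp d)) (x y z : Sp d) : ℂ :=
  (a.toFun x : ℂ) * kernel0 Vhat x y z / (a.toFun y : ℂ)

lemma IsPotHat.isSchur_kernel0Weighted (h : IsPotHat L μ c V Vhat) {R : ℝ} (hR : 0 < R) :
    IsSchur volume (volume.restrict (cell L)) (kernel0Weighted Vhat (kpWeight d μ R hR)) c := by
  refine h.isSchur_of_le ?_ fun x y z => ?_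
  · have h1 := h.measurable_kernel0
    have h2 := (kpWeight d μ R hR).meas
    unfold kernel0Weighted
    fun_prop
  · exact enorm_weighted_le _ _ (kpWeight_pos hR x).le (kpWeight_pos hR y)
      (kpWeight_submul h.mu_nonneg hR x y)

/-- `‖w 𝓤⁰ u‖ ≤ c ‖w u‖`, in `L²(ℝ^d × 𝓒)`. -/
lemma IsPotHat.norm_weight_op0_le (h : IsPotHat L μ c V Vhat) {R : ℝ} (hR : 0 < R)
    (u : Lp ℂ 2 ((volume : Measure (Sp d)).prod (volume.restrict (cell L)))) :
    ‖((kpWeight d μ R hR).fst (Sp d)).mul _ (h.isSchur_kernel0.op u)‖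
      ≤ c * ‖((kpWeight d μ R hR).fst (Sp d)).mul _ u‖ := by
  rw [h.isSchur_kernel0.mul_op (h.isSchur_kernel0Weighted hR) (kpWeight d μ R hR)
    (kpWeight d μ R hR)]
  · exact IsSchur.norm_op_apply_le _ _
  · intro x y z
    have : ((kpWeight d μ R hR).toFun y : ℂ) ≠ 0 := by exact_mod_cast (kpWeight_pos hR y).ne'
    rw [kernel0Weighted, div_mul_cancel₀ _ this]

end Kernels

/-! ### The kernel of the exact potential operator -/

section Alias

variable {L M : Matrix (Fin d) (Fin d) ℝ} {μ c ε : ℝ} {V : Sp d → Sp d → ℝ}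
  {Vhat : Sp d → Sp d → ℂ}

/-- The terms of the periodization of `V̂`, twisted by the Bloch phases. -/
def aliasTerm (M : Matrix (Fin d) (Fin d) ℝ) (ε : ℝ) (Vhat : Sp d → Sp d → ℂ) (x y z : Sp d)
    (m : Fin d → ℤ) : ℂ :=
  planeWave (latVec M m) (ε • z) * Vhat (x + latVec M m - y) z

/-- The kernel of the exact potential operator `𝓤^ε`; `M` generates the lattice `ε⁻¹ 𝓛*`. -/
def kernelEps (M : Matrix (Fin d) (Fin d) ℝ) (ε : ℝ) (Vhat : Sp d → Sp d → ℂ) (x y z : Sp d) : ℂ :=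
  -- The lattice sum is an integral against counting measure, so that measurability and Fubini
  -- apply. It takes the value `0` where the sum does not converge absolutely.
  (cell M).indicator 1 x * (cell M).indicator 1 y *
    ((fourierConst d : ℂ) * ∫ m, aliasTerm M ε Vhat x y z m ∂Measure.count)

/-- The periodization of the majorant. -/
def majorantSum (M : Matrix (Fin d) (Fin d) ℝ) (μ : ℝ) (Vhat : Sp d → Sp d → ℂ) (x y z : Sp d) :
    ℝ≥0∞ :=
  (cell M).indicator 1 x * (cell M).indicator 1 y *
    ∑' m : Fin d → ℤ, majorant μ Vhat (x + latVec M m - y) z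

lemma latVec_neg (M : Matrix (Fin d) (Fin d) ℝ) (m : Fin d → ℤ) :
    latVec M (-m) = -latVec M m := by
  have : (fun i => (((-m) i : ℤ) : ℝ)) = -(fun i => (m i : ℝ)) := by ext i; simp
  rw [latVec, this, latVec, latMap, latMap, Matrix.mulVec_neg, WithLp.toLp_neg]

lemma latVec_zero (M : Matrix (Fin d) (Fin d) ℝ) : latVec M 0 = 0 := by
  have := latVec_neg M 0
  rw [neg_zero] at this
  have h2 : (2 : ℝ) • latVec M 0 = 0 := by
    rw [two_smul]; exact eq_neg_iff_add_eq_zero.1 this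
  exact (smul_eq_zero.1 h2).resolve_left two_ne_zero

lemma IsPotHat.measurable_aliasTerm (h : IsPotHat L μ c V Vhat) (M : Matrix (Fin d) (Fin d) ℝ)
    (ε : ℝ) : Measurable fun q : (Sp d × Sp d × Sp d) × (Fin d → ℤ) =>
      aliasTerm M ε Vhat q.1.1 q.1.2.1 q.1.2.2 q.2 := by
  have hl : Measurable fun q : (Sp d × Sp d × Sp d) × (Fin d → ℤ) => latVec M q.2 :=
    (measurable_of_countable (latVec M)).comp measurable_snd
  have h1 : Measurable fun q : (Sp d × Sp d × Sp d) × (Fin d → ℤ) =>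
      Vhat (q.1.1 + latVec M q.2 - q.1.2.1) q.1.2.2 :=
    h.meas.comp (by fun_prop : Measurable fun q : (Sp d × Sp d × Sp d) × (Fin d → ℤ) =>
      (q.1.1 + latVec M q.2 - q.1.2.1, q.1.2.2))
  have h2 : Measurable fun q : (Sp d × Sp d × Sp d) × (Fin d → ℤ) =>
      planeWave (latVec M q.2) (ε • q.1.2.2) := by
    have h3 := continuous_planeWave.measurable.comp (by fun_prop :
      Measurable fun q : (Sp d × Sp d × Sp d) × (Fin d → ℤ) => (latVec M q.2, ε • q.1.2.2))
    simpa only [Function.comp_def] using h3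
  unfold aliasTerm
  exact h2.mul h1

lemma IsPotHat.measurable_kernelEps (h : IsPotHat L μ c V Vhat) (M : Matrix (Fin d) (Fin d) ℝ)
    (ε : ℝ) : Measurable fun p : Sp d × Sp d × Sp d => kernelEps M ε Vhat p.1 p.2.1 p.2.2 := by
  have h1 := ((h.measurable_aliasTerm M ε).stronglyMeasurable.integral_prod_right'
    (ν := Measure.count)).measurable
  have h2 : Measurable ((cell M).indicator (1 : Sp d → ℂ)) :=
    measurable_one.indicator (measurableSet_cell M)
  exact ((h2.comp measurable_fst).mul (h2.comp (measurable_fst.comp measurable_snd))).mul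
    (measurable_const.mul h1)

lemma IsPotHat.measurable_majorant_left (h : IsPotHat L μ c V Vhat) (z : Sp d) :
    Measurable fun k => majorant μ Vhat k z := by
  have h1 := h.measurable_majorant.comp (by fun_prop : Measurable fun k : Sp d => (k, z))
  simpa only [Function.comp_def] using h1

/-- Summing over the lattice and integrating over one cell is integrating over the whole space.
Folding therefore costs nothing: the periodized kernel obeys Schur's test with the same constant
`c`. -/
lemma IsPotHat.lintegral_majorantSum_left (h : IsPotHat L μ c V Vhat) (hM : M.det ≠ 0)
    (y z : Sp d) : ∫⁻ x, majorantSum M μ Vhat x y z ≤ ∫⁻ k, majorant μ Vhat k z := by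
  have hm := h.measurable_majorant_left z
  calc ∫⁻ x, majorantSum M μ Vhat x y z
      ≤ ∫⁻ x, (cell M).indicator
          (fun x => ∑' m : Fin d → ℤ, majorant μ Vhat (x + latVec M m - y) z) x := by
        refine lintegral_mono fun x => ?_
        by_cases hx : x ∈ cell M <;> by_cases hy : y ∈ cell M <;> simp [majorantSum, hx, hy]
    _ = ∑' m : Fin d → ℤ, ∫⁻ x in cell M, majorant μ Vhat (x + latVec M m - y) z := by
        rw [lintegral_indicator (measurableSet_cell M), lintegral_tsum]
        exact fun m => (hm.comp (by fun_prop)).aemeasurable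
    _ = ∫⁻ k, majorant μ Vhat k z := by
        rw [← lintegral_tiling hM (fun x => majorant μ Vhat (x - y) z),
          lintegral_sub_right_eq_self (fun k => majorant μ Vhat k z) y]

lemma IsPotHat.lintegral_majorantSum_right (h : IsPotHat L μ c V Vhat) (hM : M.det ≠ 0)
    (x z : Sp d) : ∫⁻ y, majorantSum M μ Vhat x y z ≤ ∫⁻ k, majorant μ Vhat k z := by
  have hm := h.measurable_majorant_left z
  calc ∫⁻ y, majorantSum M μ Vhat x y z
      ≤ ∫⁻ y, (cell M).indicator
          (fun y => ∑' m : Fin d → ℤ, majorant μ Vhat (x + latVec M m - y) z) y := by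
        refine lintegral_mono fun y => ?_
        by_cases hx : x ∈ cell M <;> by_cases hy : y ∈ cell M <;> simp [majorantSum, hx, hy]
    _ = ∑' m : Fin d → ℤ, ∫⁻ y in cell M, majorant μ Vhat (x + latVec M m - y) z := by
        rw [lintegral_indicator (measurableSet_cell M), lintegral_tsum]
        exact fun m => (hm.comp (by fun_prop)).aemeasurable
    _ = ∑' m : Fin d → ℤ, ∫⁻ y in cell M, majorant μ Vhat (x - (y + latVec M m)) z := by
        -- The lattice vector is added to `x` in the kernel; reindexing by `m ↦ -m` attaches it to
        -- `y`, so that the cell can be unfolded in that variable.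
        rw [← (Equiv.neg (Fin d → ℤ)).tsum_eq]
        refine tsum_congr fun m => lintegral_congr fun y => ?_
        rw [Equiv.neg_apply, latVec_neg]
        congr 1
        abel
    _ = ∫⁻ k, majorant μ Vhat k z := by
        rw [← lintegral_tiling hM (fun y => majorant μ Vhat (x - y) z),
          lintegral_sub_left_eq_self (fun k => majorant μ Vhat k z) x]

lemma enorm_planeWave (k x : Sp d) : ‖planeWave k x‖ₑ = 1 := by
  rw [← ofReal_norm, norm_planeWave, ENNReal.ofReal_one]

lemma IsPotHat.enorm_kernelEps_le (h : IsPotHat L μ c V Vhat) (x y z : Sp d) :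
    ‖kernelEps M ε Vhat x y z‖ₑ ≤ majorantSum M μ Vhat x y z := by
  by_cases hx : x ∈ cell M
  swap
  · simp [kernelEps, majorantSum, hx]
  by_cases hy : y ∈ cell M
  swap
  · simp [kernelEps, majorantSum, hy]
  simp only [kernelEps, majorantSum, indicator_of_mem hx, indicator_of_mem hy, Pi.one_apply,
    one_mul]
  rw [← integral_const_mul, ← lintegral_count]
  refine (enorm_integral_le_lintegral_enorm _).trans (lintegral_mono fun m => ?_)
  rw [aliasTerm, mul_left_comm, enorm_mul, enorm_planeWave, one_mul]
  exact enorm_fourierConst_mul_le h _ _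

lemma IsPotHat.isSchur_kernelEps (h : IsPotHat L μ c V Vhat) (hM : M.det ≠ 0) (ε : ℝ) :
    IsSchur volume (volume.restrict (cell L)) (kernelEps M ε Vhat) c where
  nonneg := h.nonneg
  meas := h.measurable_kernelEps M ε
  left := by
    filter_upwards [h.mass] with z hz x
    exact (lintegral_mono fun y => h.enorm_kernelEps_le x y z).trans
      ((h.lintegral_majorantSum_right hM x z).trans hz)
  right := by
    filter_upwards [h.mass] with z hz y
    exact (lintegral_mono fun x => h.enorm_kernelEps_le x y z).trans
      ((h.lintegral_majorantSum_left hM y z).trans hz)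

/-- The difference of the kernels, divided by the weight. -/
def kernelDiff (M : Matrix (Fin d) (Fin d) ℝ) (ε : ℝ) (Vhat : Sp d → Sp d → ℂ)
    (a : Weight (Sp d)) (x y z : Sp d) : ℂ :=
  (kernelEps M ε Vhat x y z - kernel0 Vhat x y z) / (a.toFun y : ℂ)

/-- The source of the rate: if the weight `b` at the incoming frequency, multiplied by `(1+|k|)^μ`,
reaches `R`, division by `b` gains `R⁻¹` at the price of the factor already contained in the
majorant. -/
lemma enorm_div_le (k z : Sp d) {R b : ℝ} (hR : 0 < R) (hb : 0 < b)
    (hab : R ≤ (1 + ‖k‖) ^ μ * b) :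
    ‖(fourierConst d : ℂ) * Vhat k z / (b : ℂ)‖ₑ
      ≤ ENNReal.ofReal R⁻¹ * majorant μ Vhat k z := by
  have h1 := enorm_weighted_le (Vhat := Vhat) k z hR.le hb hab
  have hR0 : (R : ℂ) ≠ 0 := by exact_mod_cast hR.ne'
  have e : (fourierConst d : ℂ) * Vhat k z / (b : ℂ)
      = ((R⁻¹ : ℝ) : ℂ) * ((R : ℂ) * ((fourierConst d : ℂ) * Vhat k z) / (b : ℂ)) := by
    push_cast; field_simp
  rw [e, enorm_mul]
  gcongr
  rw [← ofReal_norm, Complex.norm_real, Real.norm_of_nonneg (inv_nonneg.2 hR.le)]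

/-- Each surviving term involves a far frequency, where the weight equals `R`; submultiplicativity
carries this to the weight at `y`. If `x` or `y` is outside the cell only the convolution kernel
survives; if both are inside, the `m = 0` term cancels it. -/
lemma IsPotHat.enorm_kernelDiff_le (h : IsPotHat L μ c V Vhat) (hM : M.det ≠ 0) {R : ℝ}
    (hR : 0 < R) (hw : ∀ t : Fin d → ℝ, (∃ i, 1 / 2 ≤ |t i|) →
      (kpWeight d μ R hR).toFun (latMap M t) = R) (x y z : Sp d) :
    ‖kernelDiff M ε Vhat (kpWeight d μ R hR) x y z‖ₑ
      ≤ ENNReal.ofReal R⁻¹ * (majorantSum M μ Vhat x y z + majorant μ Vhat (x - y) z) := by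
  set a := kpWeight d μ R hR with ha
  have hout : x ∉ cell M ∨ y ∉ cell M → ‖kernelDiff M ε Vhat a x y z‖ₑ
      ≤ ENNReal.ofReal R⁻¹ * (majorantSum M μ Vhat x y z + majorant μ Vhat (x - y) z) := by
    intro hxy
    have h0 : kernelEps M ε Vhat x y z = 0 := by
      rcases hxy with hx | hy
      · simp [kernelEps, hx]
      · simp [kernelEps, hy]
    rw [kernelDiff, h0, zero_sub, neg_div, enorm_neg]
    refine (enorm_div_le (μ := μ) (x - y) z hR (kpWeight_pos hR y) ?_).trans (by gcongr; simp)
    -- For `x` outside, `R = w(x) ≤ (1+|x-y|)^μ w(y)`; for `y` outside, `R = w(y)` already.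
    rcases hxy with hx | hy
    · obtain ⟨t, rfl, ht⟩ := exists_half_le_of_notMem_cell hM hx
      have := kpWeight_submul h.mu_nonneg hR (latMap M t) y
      rwa [hw t ht] at this
    · obtain ⟨t, rfl, ht⟩ := exists_half_le_of_notMem_cell hM hy
      rw [hw t ht]
      exact le_mul_of_one_le_left hR.le
        (Real.one_le_rpow (by linarith [norm_nonneg (x - latMap M t)]) h.mu_nonneg)
  by_cases hx : x ∈ cell M
  swap
  · exact hout (Or.inl hx)
  by_cases hy : y ∈ cell M
  swap
  · exact hout (Or.inr hy)
  have hS : majorantSum M μ Vhat x y z = ∑' m : Fin d → ℤ, majorant μ Vhat (x + latVec M m - y) z := by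
    simp [majorantSum, hx, hy]
  have hRpos : ENNReal.ofReal R⁻¹ ≠ 0 := by simpa using hR
  by_cases hInt : Integrable (aliasTerm M ε Vhat x y z) Measure.count
  swap
  -- Where the lattice sum diverges the kernel has its default value, but the right-hand side is
  -- infinite.
  · have htop : majorantSum M μ Vhat x y z = ⊤ := by
      by_contra hne
      refine hInt ⟨(measurable_of_countable _).aestronglyMeasurable, ?_⟩
      have hfc : ENNReal.ofReal (fourierConst d) ≠ 0 := by simpa using fourierConst_pos d
      rw [hasFiniteIntegral_iff_enorm, lintegral_count]
      have hle : ENNReal.ofReal (fourierConst d) * ∑' m, ‖aliasTerm M ε Vhat x y z m‖ₑ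
          ≤ majorantSum M μ Vhat x y z := by
        rw [hS, ← ENNReal.tsum_mul_left]
        refine ENNReal.tsum_le_tsum fun m => ?_
        refine le_trans (le_of_eq ?_) (enorm_fourierConst_mul_le h _ _)
        rw [aliasTerm, enorm_mul, enorm_planeWave, one_mul, enorm_mul]
        congr 1
        rw [← ofReal_norm, Complex.norm_real, Real.norm_of_nonneg (fourierConst_pos d).le]
      by_contra htop
      rw [not_lt, top_le_iff] at htop
      rw [htop, ENNReal.mul_top hfc, top_le_iff] at hle
      exact hne hle
    rw [htop, top_add, ENNReal.mul_top hRpos]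
    exact le_top
  have hsplit : ∫ m, aliasTerm M ε Vhat x y z m ∂Measure.count
      = Vhat (x - y) z
        + ∫ m in {(0 : Fin d → ℤ)}ᶜ, aliasTerm M ε Vhat x y z m ∂Measure.count := by
    rw [← integral_add_compl (measurableSet_singleton (0 : Fin d → ℤ)) hInt]
    congr 1
    rw [integral_singleton]
    simp [aliasTerm, latVec_zero, planeWave, measureReal_def]
  have hD : kernelDiff M ε Vhat a x y z = ∫ m in {(0 : Fin d → ℤ)}ᶜ,
      (fourierConst d : ℂ) * aliasTerm M ε Vhat x y z m / (a.toFun y : ℂ) ∂Measure.count := by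
    rw [integral_div, integral_const_mul, kernelDiff]
    simp only [kernelEps, kernel0, indicator_of_mem hx, indicator_of_mem hy, Pi.one_apply,
      one_mul, hsplit]
    ring
  rw [hD]
  refine (enorm_integral_le_lintegral_enorm _).trans ?_
  calc ∫⁻ m in {(0 : Fin d → ℤ)}ᶜ,
        ‖(fourierConst d : ℂ) * aliasTerm M ε Vhat x y z m / (a.toFun y : ℂ)‖ₑ ∂Measure.count
      ≤ ∫⁻ m in {(0 : Fin d → ℤ)}ᶜ,
          ENNReal.ofReal R⁻¹ * majorant μ Vhat (x + latVec M m - y) z ∂Measure.count := by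
        refine setLIntegral_mono (measurable_of_countable _) fun m hm => ?_
        rw [aliasTerm, mul_left_comm, mul_div_assoc, enorm_mul, enorm_planeWave, one_mul]
        refine enorm_div_le (μ := μ) _ z hR (kpWeight_pos hR y) ?_
        -- For `m ≠ 0` the far frequency is `x + latVec M m`.
        obtain ⟨t, ht, hi⟩ := exists_half_le_of_mem_cell_add hx (mem_compl_singleton_iff.1 hm)
        rw [ht, ← hw t hi]
        exact kpWeight_submul h.mu_nonneg hR _ y
    _ ≤ ∫⁻ m, ENNReal.ofReal R⁻¹ * majorant μ Vhat (x + latVec M m - y) z ∂Measure.count :=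
        setLIntegral_le_lintegral _ _
    _ ≤ _ := by
        rw [lintegral_count, ENNReal.tsum_mul_left, ← hS]
        gcongr
        simp

lemma IsPotHat.isSchur_kernelDiff (h : IsPotHat L μ c V Vhat) (hM : M.det ≠ 0) (ε : ℝ) {R : ℝ}
    (hR : 0 < R) (hw : ∀ t : Fin d → ℝ, (∃ i, 1 / 2 ≤ |t i|) →
      (kpWeight d μ R hR).toFun (latMap M t) = R) :
    IsSchur volume (volume.restrict (cell L)) (kernelDiff M ε Vhat (kpWeight d μ R hR))
      (R⁻¹ * (c + c)) where
  nonneg := mul_nonneg (inv_nonneg.2 hR.le) (add_nonneg h.nonneg h.nonneg)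
  meas := by
    have h1 := h.measurable_kernelEps M ε
    have h2 := h.measurable_kernel0
    have h3 := (kpWeight d μ R hR).meas
    unfold kernelDiff
    fun_prop
  left := by
    filter_upwards [h.mass] with z hz x
    refine (lintegral_mono fun y => h.enorm_kernelDiff_le hM hR hw x y z).trans ?_
    have hm : Measurable fun y => majorant μ Vhat (x - y) z :=
      (h.measurable_majorant_left z).comp (by fun_prop)
    rw [lintegral_const_mul' _ _ ENNReal.ofReal_ne_top, lintegral_add_right _ hm,
      lintegral_sub_left_eq_self (fun k => majorant μ Vhat k z) x,
      ENNReal.ofReal_mul (inv_nonneg.2 hR.le), ENNReal.ofReal_add h.nonneg h.nonneg]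
    gcongr
    exact (h.lintegral_majorantSum_right hM x z).trans hz
  right := by
    filter_upwards [h.mass] with z hz y
    refine (lintegral_mono fun x => h.enorm_kernelDiff_le hM hR hw x y z).trans ?_
    have hm : Measurable fun x => majorant μ Vhat (x - y) z :=
      (h.measurable_majorant_left z).comp (by fun_prop)
    rw [lintegral_const_mul' _ _ ENNReal.ofReal_ne_top, lintegral_add_right _ hm,
      lintegral_sub_right_eq_self (fun k => majorant μ Vhat k z) y,
      ENNReal.ofReal_mul (inv_nonneg.2 hR.le), ENNReal.ofReal_add h.nonneg h.nonneg]
    gcongr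
    exact (h.lintegral_majorantSum_left hM y z).trans hz

/-- `‖(𝓤^ε - 𝓤⁰) u‖ ≤ 2 c R⁻¹ ‖w u‖`, in `L²(ℝ^d × 𝓒)`. -/
lemma IsPotHat.norm_opEps_sub_op0_le (h : IsPotHat L μ c V Vhat) (hM : M.det ≠ 0) (ε : ℝ) {R : ℝ}
    (hR : 0 < R) (hw : ∀ t : Fin d → ℝ, (∃ i, 1 / 2 ≤ |t i|) →
      (kpWeight d μ R hR).toFun (latMap M t) = R)
    (u : Lp ℂ 2 ((volume : Measure (Sp d)).prod (volume.restrict (cell L)))) :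
    ‖(h.isSchur_kernelEps hM ε).op u - h.isSchur_kernel0.op u‖
      ≤ R⁻¹ * (c + c) * ‖((kpWeight d μ R hR).fst (Sp d)).mul _ u‖ := by
  rw [IsSchur.op_sub, IsSchur.op_eq_op_mul _ (h.isSchur_kernelDiff hM ε hR hw)
    (kpWeight d μ R hR)]
  · exact IsSchur.norm_op_apply_le _ _
  · intro x y z
    have : ((kpWeight d μ R hR).toFun y : ℂ) ≠ 0 := by exact_mod_cast (kpWeight_pos hR y).ne'
    rw [kernelDiff, div_mul_cancel₀ _ this]

end Alias

/-! ### Identification of `𝓤⁰` -/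

section Swap

set_option linter.unusedSectionVars false

variable {X Z : Type*} [MeasurableSpace X] [MeasurableSpace Z] {μ : Measure X} {ν : Measure Z}
  [SigmaFinite μ] [SigmaFinite ν] {κ : X → X → Z → ℂ} {A : ℝ}

/-- The hypothesis for exchanging the `y` and `z` integrals. The function `∫ |κ||u| dy` is square
integrable in `(x,z)` by Schur's test, so for almost every `x` Cauchy–Schwarz in `z` pairs it with
`w`. -/
lemma IsSchur.ae_integrable_prod (hκ : IsSchur μ ν κ A) {w : Z → ℂ} (hw : MemLp w 2 ν)
    {u : X × Z → ℂ} (hu : MemLp u 2 (μ.prod ν)) :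
    ∀ᵐ x ∂μ, Integrable (fun q : Z × X => conj (w q.1) * (κ x q.2 q.1 * u (q.2, q.1)))
      (ν.prod μ) := by
  obtain ⟨u', hu', he⟩ := hu.1
  have hm1 : Measurable fun q : (X × Z) × X => ‖κ q.1.1 q.2 q.1.2‖ₑ :=
    (hκ.meas.comp (by fun_prop : Measurable fun q : (X × Z) × X => (q.1.1, q.2, q.1.2))).enorm
  have hm2 : Measurable fun q : (X × Z) × X => ‖u' (q.2, q.1.2)‖ₑ :=
    (hu'.measurable.comp
      (by fun_prop : Measurable fun q : (X × Z) × X => (q.2, q.1.2))).enorm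
  have hQ : Measurable fun p : X × Z => ∫⁻ y, ‖κ p.1 y p.2‖ₑ * ‖u' (y, p.2)‖ₑ ∂μ :=
    (hm1.mul hm2).lintegral_prod_right'
  have hfin : ∫⁻ p, (∫⁻ y, ‖κ p.1 y p.2‖ₑ * ‖u' (y, p.2)‖ₑ ∂μ) ^ 2 ∂(μ.prod ν) < ⊤ := by
    refine (hκ.lintegral_le (f := fun p => ‖u' p‖ₑ) hu'.measurable.enorm).trans_lt ?_
    rw [← sq_eLpNorm_two, ← eLpNorm_congr_ae he]
    exact ENNReal.mul_lt_top (by simp) (ENNReal.pow_lt_top hu.2)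
  rw [lintegral_prod _ (hQ.pow_const 2).aemeasurable] at hfin
  have hae := ae_lt_top' (hQ.pow_const 2).lintegral_prod_right'.aemeasurable hfin.ne
  filter_upwards [hae] with x hx
  have hsm : AEStronglyMeasurable
      (fun q : Z × X => conj (w q.1) * (κ x q.2 q.1 * u (q.2, q.1))) (ν.prod μ) := by
    have h1 : AEStronglyMeasurable (fun q : Z × X => conj (w q.1)) (ν.prod μ) :=
      (Complex.continuous_conj.comp_aestronglyMeasurable hw.1).comp_fst
    have h2 : Measurable fun q : Z × X => κ x q.2 q.1 :=
      hκ.meas.comp (by fun_prop : Measurable fun q : Z × X => (x, q.2, q.1))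
    have h3 : AEStronglyMeasurable (fun q : Z × X => u (q.2, q.1)) (ν.prod μ) :=
      hu.1.comp_quasiMeasurePreserving Measure.measurePreserving_swap.quasiMeasurePreserving
    exact h1.mul (h2.aestronglyMeasurable.mul h3)
  refine ⟨hsm, ?_⟩
  rw [hasFiniteIntegral_iff_enorm, lintegral_prod _ hsm.enorm]
  have hz : ∀ᵐ z ∂ν, ∫⁻ y, ‖conj (w z) * (κ x y z * u (y, z))‖ₑ ∂μ
      = ‖w z‖ₑ * ∫⁻ y, ‖κ x y z‖ₑ * ‖u' (y, z)‖ₑ ∂μ := by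
    filter_upwards [ae_prod_swap he] with z hz
    rw [← lintegral_const_mul' _ _ enorm_ne_top]
    refine lintegral_congr_ae ?_
    filter_upwards [hz] with y hy
    rw [enorm_mul, enorm_mul, RCLike.enorm_conj, hy]
  rw [lintegral_congr_ae hz]
  have hsq := sq_lintegral_mul_le ν hw.1.enorm
    (hQ.comp (by fun_prop : Measurable fun z : Z => (x, z))).aemeasurable
  have hlt : (∫⁻ z, ‖w z‖ₑ * ∫⁻ y, ‖κ x y z‖ₑ * ‖u' (y, z)‖ₑ ∂μ ∂ν) ^ 2 < ⊤ := by
    refine lt_of_le_of_lt hsq (ENNReal.mul_lt_top ?_ hx)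
    rw [← sq_eLpNorm_two]
    exact ENNReal.pow_lt_top hw.2
  by_contra! h
  rw [top_le_iff] at h
  simp [h] at hlt

lemma IsSchur.coeFn_coeff_op (hκ : IsSchur μ ν κ A) {v : ℕ → Z → ℂ} (hv : IsONSystem ν v) (n : ℕ)
    {u : Lp ℂ 2 (μ.prod ν)} {U : X × Z → ℂ} (hU : u =ᵐ[μ.prod ν] U) :
    hv.coeff μ n (hκ.op u) =ᵐ[μ]
      fun x => ∫ y, ∫ z, conj (v n z) * (κ x y z * U (y, z)) ∂ν ∂μ := by
  have hUL : MemLp U 2 (μ.prod ν) := (Lp.memLp u).ae_eq hU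
  filter_upwards [hv.coeFn_coeff n (hκ.op u),
    Measure.ae_ae_of_ae_prod ((hκ.coeFn_op u).trans (kernelFun_congr κ hU)),
    hκ.ae_integrable_prod (hv.memLp n) hUL] with x h1 h2 h3
  rw [h1, ← integral_integral_swap h3]
  refine integral_congr_ae ?_
  filter_upwards [h2] with z hz
  rw [hz, kernelFun, integral_const_mul]

end Swap

/-! ### Matrix elements of the potential and of its partial Fourier transform. -/

section PotElem

variable {L : Matrix (Fin d) (Fin d) ℝ} {μ c : ℝ} {V : Sp d → Sp d → ℝ} {Vhat : Sp d → Sp d → ℂ}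
  {v : ℕ → Sp d → ℂ}

/-- Matrix elements of the partial Fourier transform of the potential. -/
def potHat (L : Matrix (Fin d) (Fin d) ℝ) (v : ℕ → Sp d → ℂ) (Vhat : Sp d → Sp d → ℂ)
    (n n' : ℕ) (k : Sp d) : ℂ :=
  ∫ z in cell L, conj (v n z) * v n' z * Vhat k z

lemma IsPotHat.integrable_matrixElem (h : IsPotHat L μ c V Vhat)
    (hv : IsONSystem (volume.restrict (cell L)) v) (n n' : ℕ) :
    Integrable (fun p : Sp d × Sp d =>
      conj (v n p.2) * v n' p.2 * ((fourierConst d : ℂ) * Vhat p.1 p.2))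
      (volume.prod (volume.restrict (cell L))) := by
  have hVm : Measurable fun p : Sp d × Sp d => Vhat p.1 p.2 := h.meas
  have hvv : AEStronglyMeasurable (fun z => conj (v n z) * v n' z) (volume.restrict (cell L)) :=
    (Complex.continuous_conj.comp_aestronglyMeasurable (hv.memLp n).1).mul (hv.memLp n').1
  have hsm : AEStronglyMeasurable (fun p : Sp d × Sp d =>
      conj (v n p.2) * v n' p.2 * ((fourierConst d : ℂ) * Vhat p.1 p.2))
      (volume.prod (volume.restrict (cell L))) :=
    hvv.comp_snd.mul (hVm.const_mul _).aestronglyMeasurable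
  refine ⟨hsm, ?_⟩
  rw [hasFiniteIntegral_iff_enorm, lintegral_prod_symm _ hsm.enorm]
  have hle : ∀ᵐ z ∂(volume.restrict (cell L)),
      ∫⁻ k, ‖conj (v n z) * v n' z * ((fourierConst d : ℂ) * Vhat k z)‖ₑ
        ≤ ‖v n z‖ₑ * ‖v n' z‖ₑ * ENNReal.ofReal c := by
    filter_upwards [h.mass] with z hz
    simp only [enorm_mul (conj (v n z) * v n' z), enorm_mul (conj (v n z)), RCLike.enorm_conj]
    rw [lintegral_const_mul' _ _ (by finiteness)]
    gcongr
    exact (lintegral_mono fun k => enorm_fourierConst_mul_le h k z).trans hz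
  refine (lintegral_mono_ae hle).trans_lt ?_
  rw [lintegral_mul_const' _ _ ENNReal.ofReal_ne_top]
  refine ENNReal.mul_lt_top ?_ ENNReal.ofReal_lt_top
  have := (((hv.memLp n).integrable_mul (hv.memLp n')).2)
  rw [hasFiniteIntegral_iff_enorm] at this
  simpa only [Pi.mul_apply, enorm_mul] using this

/-- By Fubini, taking matrix elements in `z` commutes with the Fourier integral in `k`. -/
lemma IsPotHat.hasFourierL1_potElem (h : IsPotHat L μ c V Vhat)
    (hv : IsONSystem (volume.restrict (cell L)) v) (n n' : ℕ) :
    HasFourierL1 (potElem L v V n n') (potHat L v Vhat n n') := by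
  have hne : (fourierConst d : ℂ) ≠ 0 := by exact_mod_cast (fourierConst_pos d).ne'
  have hI := h.integrable_matrixElem hv n n'
  have e1 : ∀ k, potHat L v Vhat n n' k = (fourierConst d : ℂ)⁻¹ *
      ∫ z in cell L, conj (v n z) * v n' z * ((fourierConst d : ℂ) * Vhat k z) := by
    intro k
    rw [← integral_const_mul, potHat]
    refine integral_congr_ae (ae_of_all _ fun z => ?_)
    field_simp
  refine ⟨?_, fun x => ?_⟩
  · simp only [funext e1]
    exact hI.integral_prod_left.const_mul _
  · have hI2 : Integrable (fun p : Sp d × Sp d => planeWave p.1 x *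
        (conj (v n p.2) * v n' p.2 * ((fourierConst d : ℂ) * Vhat p.1 p.2)))
        (volume.prod (volume.restrict (cell L))) := by
      refine hI.bdd_mul (c := 1) (Continuous.aestronglyMeasurable
        (continuous_planeWave.comp (f := fun p : Sp d × Sp d => (p.1, x)) (by fun_prop))) ?_
      exact ae_of_all _ fun p => (norm_planeWave p.1 x).le
    calc potElem L v V n n' x
        = ∫ z in cell L, ∫ k, planeWave k x *
            (conj (v n z) * v n' z * ((fourierConst d : ℂ) * Vhat k z)) := by
          refine integral_congr_ae ?_
          filter_upwards [h.fourier] with z hz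
          simp only [hz.2 x]
          rw [← mul_assoc, ← integral_const_mul]
          refine integral_congr_ae (ae_of_all _ fun k => ?_)
          simp only
          ring
      _ = ∫ k, ∫ z in cell L, planeWave k x *
            (conj (v n z) * v n' z * ((fourierConst d : ℂ) * Vhat k z)) :=
          (integral_integral_swap hI2).symm
      _ = (fourierConst d : ℂ) * ∫ k, planeWave k x * potHat L v Vhat n n' k := by
          rw [← integral_const_mul]
          refine integral_congr_ae (ae_of_all _ fun k => ?_)
          beta_reduce
          rw [integral_const_mul, e1, mul_left_comm (fourierConst d : ℂ), mul_inv_cancel_left₀ hne]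

/-- `𝓤⁰` is the operator `coeffs ∘ op ∘ synth`. -/
lemma IsPotHat.eq_of_isU0 (h : IsPotHat L μ c V Vhat)
    (hv : IsONSystem (volume.restrict (cell L)) v) {g f : EnvSpace d} (hU : IsU0 L v V g f) :
    f = hv.coeffs volume (h.isSchur_kernel0.op (hv.synth volume g)) := by
  obtain ⟨Vh, hVh, hT⟩ := hU
  ext1
  funext n
  rw [hv.coeffs_apply]
  set T := (hv.coeff volume n).comp h.isSchur_kernel0.op with hTdef
  -- Both sides are limits in `L²` of partial sums over `n'`: one by continuity of `T`, the other by
  -- definition of `𝓤⁰`. It is enough to match single terms.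
  have hlim : Tendsto (fun N => T (∑ n' ∈ Finset.range N, hv.tensor volume n' (g n'))) atTop
      (𝓝 (T (hv.synth volume g))) :=
    (T.continuous.tendsto _).comp (hv.hasSum_synth g).tendsto_sum_nat
  have hterm : ∀ n', T (hv.tensor volume n' (g n')) =ᵐ[volume] fun k =>
      (fourierConst d : ℂ) * ∫ k', Vh n n' (k - k') * g n' k' := by
    intro n'
    have h1 := h.isSchur_kernel0.coeFn_coeff_op hv n (hv.coeFn_tensor n' (g n'))
    filter_upwards [h1] with k hk
    rw [hTdef, ContinuousLinearMap.comp_apply, hk, ← integral_const_mul]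
    have hae : ∀ᵐ k', Vh n n' (k - k') = potHat L v Vhat n n' (k - k') :=
      (Measure.measurePreserving_sub_left volume k).quasiMeasurePreserving.ae
        ((hVh n n').ae_eq (h.hasFourierL1_potElem hv n n'))
    refine integral_congr_ae ?_
    filter_upwards [hae] with k' hk'
    rw [hk', potHat, ← mul_assoc, ← integral_const_mul, ← integral_mul_const]
    refine integral_congr_ae (ae_of_all _ fun z => ?_)
    simp only [kernel0]
    ring
  have hsum : ∀ N, T (∑ n' ∈ Finset.range N, hv.tensor volume n' (g n')) =ᵐ[volume] fun k =>
      ∑ n' ∈ Finset.range N, (fourierConst d : ℂ) * ∫ k', Vh n n' (k - k') * g n' k' := by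
    intro N
    rw [map_sum]
    have h2 : ∀ᵐ k, ∀ n', T (hv.tensor volume n' (g n')) k =
        (fourierConst d : ℂ) * ∫ k', Vh n n' (k - k') * g n' k' := ae_all_iff.2 hterm
    filter_upwards [Lp.coeFn_finsetSum (Finset.range N)
      (fun n' => T (hv.tensor volume n' (g n'))), h2] with k h3 h4
    rw [h3, Finset.sum_apply]
    exact Finset.sum_congr rfl fun n' _ => h4 n'
  refine tendsto_nhds_unique ?_ hlim
  rw [Lp.tendsto_Lp_iff_tendsto_eLpNorm']
  refine (hT n).congr fun N => ?_
  rw [← eLpNorm_neg]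
  refine eLpNorm_congr_ae ?_
  filter_upwards [hsum N] with k hk
  simp only [Pi.neg_apply, Pi.sub_apply, hk, neg_sub]

end PotElem

/-! ### Identification of `𝓤^ε` -/

section PartialIntegral

set_option linter.unusedSectionVars false

variable {X Z : Type*} [MeasurableSpace X] [MeasurableSpace Z] {μ : Measure X} {ν : Measure Z}
  [SigmaFinite μ] [SigmaFinite ν] {w : X × Z → ℂ} {b : X → ℝ≥0∞} {F : X × Z → ℂ}

lemma aestronglyMeasurable_partialIntegral (hw : Measurable w)
    (hF : AEStronglyMeasurable F (μ.prod ν)) :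
    AEStronglyMeasurable (fun z => ∫ x, w (x, z) * F (x, z) ∂μ) ν := by
  have h : AEStronglyMeasurable (fun q : Z × X => w (q.2, q.1) * F (q.2, q.1)) (ν.prod μ) :=
    (hw.aestronglyMeasurable.mul hF).comp_quasiMeasurePreserving
      Measure.measurePreserving_swap.quasiMeasurePreserving
  exact h.integral_prod_right'

lemma ae_memLp_slice (hF : MemLp F 2 (μ.prod ν)) :
    ∀ᵐ z ∂ν, MemLp (fun x => F (x, z)) 2 μ := by
  have hsw : AEStronglyMeasurable (fun q : Z × X => F (q.2, q.1)) (ν.prod μ) :=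
    hF.1.comp_quasiMeasurePreserving Measure.measurePreserving_swap.quasiMeasurePreserving
  have hfin : ∫⁻ z, ∫⁻ x, ‖F (x, z)‖ₑ ^ 2 ∂μ ∂ν < ⊤ := by
    rw [← lintegral_prod_symm (fun p : X × Z => ‖F p‖ₑ ^ 2) (hF.1.enorm.pow_const 2),
      ← sq_eLpNorm_two]
    exact ENNReal.pow_lt_top hF.2
  have hae := ae_lt_top' (hsw.enorm.pow_const 2).lintegral_prod_right' hfin.ne
  filter_upwards [hae, hsw.prodMk_left] with z h1 h2
  refine ⟨h2, ?_⟩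
  rw [← sq_eLpNorm_two] at h1
  by_contra! h
  rw [top_le_iff] at h
  simp [h] at h1

/-- Cauchy–Schwarz in `x` for each `z`. With `b` the indicator of a set of finite measure,
integration of `F` against phases over that set is a bounded map `L²(X × Z) → L²(Z)`. -/
lemma sq_eLpNorm_partialIntegral_le (hb : Measurable b)
    (hwb : ∀ p, ‖w p‖ₑ ≤ b p.1) (hF : MemLp F 2 (μ.prod ν)) (hbt : ∫⁻ x, b x ^ 2 ∂μ ≠ ⊤) :
    eLpNorm (fun z => ∫ x, w (x, z) * F (x, z) ∂μ) 2 ν ^ 2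
      ≤ (∫⁻ x, b x ^ 2 ∂μ) * eLpNorm F 2 (μ.prod ν) ^ 2 := by
  rw [sq_eLpNorm_two, sq_eLpNorm_two, lintegral_prod_symm _ (hF.1.enorm.pow_const 2),
    ← lintegral_const_mul' _ _ hbt]
  refine lintegral_mono_ae ?_
  filter_upwards [ae_memLp_slice hF] with z hz
  refine le_trans ?_ (sq_lintegral_mul_le μ hb.aemeasurable hz.1.enorm)
  gcongr
  refine (enorm_integral_le_lintegral_enorm _).trans (lintegral_mono fun x => ?_)
  rw [enorm_mul]
  gcongr
  exact hwb (x, z)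

end PartialIntegral

lemma tendsto_zero_of_sq_le {f b : ℕ → ℝ≥0∞} (hb : Tendsto b atTop (𝓝 0))
    (h : ∀ N, f N ^ 2 ≤ b N) : Tendsto f atTop (𝓝 0) := by
  have h1 : Tendsto (fun N => f N ^ 2) atTop (𝓝 0) :=
    tendsto_of_tendsto_of_tendsto_of_le_of_le tendsto_const_nhds hb (fun _ => zero_le) h
  have h2 := h1.ennrpow_const (1 / 2)
  rw [ENNReal.zero_rpow_of_pos (by norm_num)] at h2
  refine h2.congr fun N => ?_
  rw [← ENNReal.rpow_natCast, ← ENNReal.rpow_mul]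
  norm_num

lemma map_affine {ε : ℝ} (hε : ε ≠ 0) (a : Sp d) :
    Measure.map (fun z : Sp d => ε • (z + a)) volume
      = ENNReal.ofReal |(ε ^ d)⁻¹| • (volume : Measure (Sp d)) := by
  have h1 : (fun z : Sp d => ε • (z + a)) = (fun y => ε • y) ∘ fun z => z + a := rfl
  rw [h1, ← Measure.map_map (by fun_prop) (by fun_prop), map_add_right_eq_self,
    Measure.map_addHaar_smul volume hε]
  simp

lemma measurableEmbedding_affine {ε : ℝ} (hε : ε ≠ 0) (a : Sp d) :
    MeasurableEmbedding fun z : Sp d => ε • (z + a) := by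
  refine Continuous.measurableEmbedding (by fun_prop) fun x y hxy => ?_
  exact add_right_cancel (smul_right_injective _ hε hxy)

lemma sq_eLpNorm_comp_affine_le {ε : ℝ} (hε : ε ≠ 0) (a : Sp d) (s : Set (Sp d)) (f : Sp d → ℂ) :
    eLpNorm (fun z => f (ε • (z + a))) 2 (volume.restrict s) ^ 2
      ≤ ENNReal.ofReal |(ε ^ d)⁻¹| * eLpNorm f 2 volume ^ 2 := by
  rw [sq_eLpNorm_two, sq_eLpNorm_two]
  refine (setLIntegral_le_lintegral _ _).trans (le_of_eq ?_)
  rw [← (measurableEmbedding_affine hε a).lintegral_map (fun x => ‖f x‖ₑ ^ 2), map_affine hε,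
    lintegral_smul_measure, smul_eq_mul]

lemma aestronglyMeasurable_comp_affine {ε : ℝ} (hε : ε ≠ 0) (a : Sp d) (s : Set (Sp d))
    {f : Sp d → ℂ} (hf : AEStronglyMeasurable f volume) :
    AEStronglyMeasurable (fun z => f (ε • (z + a))) (volume.restrict s) := by
  have h : AEStronglyMeasurable (f ∘ fun z => ε • (z + a)) volume := by
    rw [← (measurableEmbedding_affine hε a).aestronglyMeasurable_map_iff, map_affine hε]
    exact hf.smul_measure _
  exact h.restrict

/-! ### The wave function as a Fourier integral on translates of the cell. -/

section Synthesis

variable {L : Matrix (Fin d) (Fin d) ℝ} {ε : ℝ} {v : ℕ → Sp d → ℂ}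

/-- The phase `𝟙_B(k) e^{ik·ε(z+a)}`. -/
def phase (B : Set (Sp d)) (ε : ℝ) (a : Sp d) (p : Sp d × Sp d) : ℂ :=
  B.indicator 1 p.1 * planeWave p.1 (ε • (p.2 + a))

lemma measurable_phase {B : Set (Sp d)} (hB : MeasurableSet B) (ε : ℝ) (a : Sp d) :
    Measurable (phase B ε a) := by
  have h1 : Measurable fun p : Sp d × Sp d => B.indicator (1 : Sp d → ℂ) p.1 :=
    (measurable_one.indicator hB).comp measurable_fst
  have h2 := continuous_planeWave.measurable.comp
    (by fun_prop : Measurable fun p : Sp d × Sp d => (p.1, ε • (p.2 + a)))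
  exact h1.mul h2

lemma enorm_phase_le (B : Set (Sp d)) (ε : ℝ) (a : Sp d) (p : Sp d × Sp d) :
    ‖phase B ε a p‖ₑ ≤ B.indicator 1 p.1 := by
  rw [phase, enorm_mul, enorm_planeWave, mul_one]
  by_cases h : p.1 ∈ B <;> simp [h]

lemma integral_phase {B : Set (Sp d)} (hB : MeasurableSet B) (ε : ℝ) (a z : Sp d)
    (F : Sp d → ℂ) :
    ∫ k, phase B ε a (k, z) * F k = ∫ k in B, planeWave k (ε • (z + a)) * F k := by
  rw [← integral_indicator hB]
  refine integral_congr_ae (ae_of_all _ fun k => ?_)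
  by_cases h : k ∈ B <;> simp [phase, h]

lemma lintegral_indicator_sq {B : Set (Sp d)} (hB : MeasurableSet B) :
    ∫⁻ k, (B.indicator (1 : Sp d → ℝ≥0∞) k) ^ 2 = volume B := by
  rw [← lintegral_indicator_one hB]
  refine lintegral_congr fun k => ?_
  by_cases h : k ∈ B <;> simp [h]

lemma integrable_planeWave_mul_of_memLp {B : Set (Sp d)} (hBt : volume B ≠ ⊤) {f : Sp d → ℂ}
    (hf : MemLp f 2 volume) (x : Sp d) :
    Integrable (fun k => planeWave k x * f k) (volume.restrict B) := by
  have : IsFiniteMeasure ((volume : Measure (Sp d)).restrict B) :=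
    ⟨by simpa using hBt.lt_top⟩
  exact integrable_planeWave_mul ((hf.restrict B).integrable one_le_two) x

/-- Pointwise form of the synthesis on the translates of the cell. -/
lemma IsSynthesis.ae_eq (hL : L.det ≠ 0) (hε : 0 < ε)
    (hv : IsONSystem (volume.restrict (cell L)) v) (hper : ∀ n, IsPeriodic L (v n))
    {g : EnvSpace d} {ψ : Sp d → ℂ} (h : IsSynthesis L v ε g ψ) (m : Fin d → ℤ) :
    ∀ᵐ z ∂(volume.restrict (cell L)), ψ (ε • (z + latVec L m))
      = (Real.sqrt (volume.real (cell L)) : ℂ) * ((fourierConst d : ℂ) *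
        ∫ k in brillouinScaled L ε, planeWave k (ε • (z + latVec L m)) *
          hv.synth volume g (k, z)) := by
  set B := brillouinScaled L ε with hBdef
  have hBeq : B = cell (recip (ε • L)) := brillouinScaled_eq hL hε.ne'
  have hB : MeasurableSet B := hBeq ▸ measurableSet_cell _
  have hBt : volume B ≠ ⊤ := hBeq ▸ (volume_cell_lt_top _).ne
  set a := latVec L m
  set ν := (volume : Measure (Sp d)).restrict (cell L) with hν
  set C : ℂ := (Real.sqrt (volume.real (cell L)) : ℂ) with hC
  set u := hv.synth (volume : Measure (Sp d)) g
  set uN : ℕ → Lp ℂ 2 ((volume : Measure (Sp d)).prod ν) :=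
    fun N => ∑ n ∈ Finset.range N, hv.tensor volume n (g n)
  have huN : Tendsto uN atTop (𝓝 u) := (hv.hasSum_synth g).tendsto_sum_nat
  have hwm := measurable_phase hB ε a
  set Φ : (Sp d × Sp d → ℂ) → Sp d → ℂ := fun F z => ∫ k, phase B ε a (k, z) * F (k, z) with hΦ
  set S : ℕ → Sp d → ℂ := fun N x => C *
    ∑ n ∈ Finset.range N, envFun L ε (fun k => g n k) x * v n (ε⁻¹ • x) with hS
  -- At `x = ε(z+a)` periodicity replaces `v n (x/ε)` by `v n z`, so a partial sum of the synthesis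
  -- is a Fourier integral over `B` of the partial sum of `synth`.
  have hSN : ∀ N, ∀ᵐ z ∂ν, S N (ε • (z + a)) = C * ((fourierConst d : ℂ) * Φ (uN N) z) := by
    intro N
    have hcoe : ∀ᵐ z ∂ν, ∀ᵐ k, uN N (k, z) = ∑ n ∈ Finset.range N, g n k * v n z := by
      refine ae_prod_swap (P := fun p => uN N p = ∑ n ∈ Finset.range N, g n p.1 * v n p.2) ?_
      have h2 : ∀ᵐ p ∂((volume : Measure (Sp d)).prod ν), ∀ n,
          hv.tensor volume n (g n) p = g n p.1 * v n p.2 :=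
        ae_all_iff.2 fun n => hv.coeFn_tensor n (g n)
      filter_upwards [Lp.coeFn_finsetSum (Finset.range N)
        (fun n => hv.tensor volume n (g n)), h2] with p h3 h4
      simp only [uN]
      rw [h3, Finset.sum_apply]
      exact Finset.sum_congr rfl fun n _ => h4 n
    filter_upwards [hcoe] with z hz
    simp only [hS, hΦ]
    congr 1
    rw [integral_phase hB ε a z (fun k => uN N (k, z))]
    have e1 : ∫ k in B, planeWave k (ε • (z + a)) * uN N (k, z)
        = ∑ n ∈ Finset.range N, (∫ k in B, planeWave k (ε • (z + a)) * g n k) * v n z := by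
      rw [integral_congr_ae (g := fun k => ∑ n ∈ Finset.range N,
        planeWave k (ε • (z + a)) * g n k * v n z)]
      · rw [integral_finsetSum]
        · exact Finset.sum_congr rfl fun n _ => integral_mul_const _ _
        · exact fun n _ => (integrable_planeWave_mul_of_memLp hBt (Lp.memLp (g n)) _).mul_const _
      · filter_upwards [ae_restrict_of_ae hz] with k hk
        rw [hk, Finset.mul_sum]
        exact Finset.sum_congr rfl fun n _ => (mul_assoc _ _ _).symm
    rw [e1, Finset.mul_sum]
    refine Finset.sum_congr rfl fun n _ => ?_
    rw [envFun, inv_smul_smul₀ hε.ne', mul_assoc]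
    congr 2
    exact hper n m z
  have hbb : Measurable (B.indicator (1 : Sp d → ℝ≥0∞)) := measurable_one.indicator hB
  have hbt : ∫⁻ k, (B.indicator (1 : Sp d → ℝ≥0∞) k) ^ 2 ≠ ⊤ := by
    rw [lintegral_indicator_sq hB]; exact hBt
  have hΦm : ∀ F : Lp ℂ 2 ((volume : Measure (Sp d)).prod ν), AEStronglyMeasurable (Φ F) ν :=
    fun F => aestronglyMeasurable_partialIntegral hwm (Lp.memLp F).1
  have hΦle : ∀ F : Lp ℂ 2 ((volume : Measure (Sp d)).prod ν),
      eLpNorm (Φ F) 2 ν ^ 2 ≤ volume B * eLpNorm F 2 ((volume : Measure (Sp d)).prod ν) ^ 2 := by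
    intro F
    have := sq_eLpNorm_partialIntegral_le hbb (enorm_phase_le B ε a) (Lp.memLp F) hbt
    rwa [lintegral_indicator_sq hB] at this
  have hΦint : ∀ F : Lp ℂ 2 ((volume : Measure (Sp d)).prod ν),
      ∀ᵐ z ∂ν, Integrable fun k => phase B ε a (k, z) * F (k, z) := by
    intro F
    filter_upwards [ae_memLp_slice (Lp.memLp F)] with z hz
    have := (integrable_planeWave_mul_of_memLp hBt hz (ε • (z + a)))
    refine ((integrable_indicator_iff hB).2 this).congr (ae_of_all _ fun k => ?_)
    by_cases hk : k ∈ B <;> simp [phase, hk]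
  have hΦsub : ∀ N, Φ (uN N - u : Lp ℂ 2 ((volume : Measure (Sp d)).prod ν))
      =ᵐ[ν] fun z => Φ (uN N) z - Φ u z := by
    intro N
    filter_upwards [hΦint (uN N), hΦint u, ae_prod_swap (Lp.coeFn_sub (uN N) u)] with z h1 h2 h3
    simp only [hΦ]
    rw [← integral_sub h1 h2]
    refine integral_congr_ae ?_
    filter_upwards [h3] with k hk
    rw [hk, Pi.sub_apply, mul_sub]
  set X : Sp d → ℂ := fun z => ψ (ε • (z + a)) - C * ((fourierConst d : ℂ) * Φ u z) with hX
  have hXm : AEStronglyMeasurable X ν :=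
    (aestronglyMeasurable_comp_affine hε.ne' a (cell L) h.1.1).sub
      (((hΦm u).const_mul _).const_mul _)
  -- The discrepancy `X` does not depend on `N`, but splits into two errors that both tend to zero
  -- in `L²`; hence it vanishes almost everywhere.
  have hdec : ∀ N, X =ᵐ[ν] fun z => (ψ (ε • (z + a)) - S N (ε • (z + a)))
      + (C * (fourierConst d : ℂ)) •
        Φ (uN N - u : Lp ℂ 2 ((volume : Measure (Sp d)).prod ν)) z := by
    intro N
    filter_upwards [hSN N, hΦsub N] with z h1 h2
    rw [h1, h2, smul_eq_mul, hX]
    ring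
  have hle : ∀ N, eLpNorm X 2 ν ≤ eLpNorm (fun z => ψ (ε • (z + a)) - S N (ε • (z + a))) 2 ν
      + ‖C * (fourierConst d : ℂ)‖ₑ *
        eLpNorm (Φ (uN N - u : Lp ℂ 2 ((volume : Measure (Sp d)).prod ν))) 2 ν := by
    intro N
    have hm2 := (hΦm (uN N - u)).const_smul (C * (fourierConst d : ℂ))
    have hm1 : AEStronglyMeasurable (fun z => ψ (ε • (z + a)) - S N (ε • (z + a))) ν := by
      refine (hXm.sub hm2).congr ?_
      filter_upwards [hdec N] with z hz
      simp only [Pi.sub_apply, Pi.smul_apply, hz]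
      ring
    rw [eLpNorm_congr_ae (hdec N), ← eLpNorm_const_smul]
    exact eLpNorm_add_le hm1 hm2 one_le_two
  have hlim1 : Tendsto (fun N => eLpNorm (fun z => ψ (ε • (z + a)) - S N (ε • (z + a))) 2 ν)
      atTop (𝓝 0) := by
    have h2 : Tendsto (fun N => ENNReal.ofReal |(ε ^ d)⁻¹| *
        eLpNorm (fun x => ψ x - S N x) 2 volume ^ 2) atTop (𝓝 0) := by
      have := ENNReal.Tendsto.const_mul (a := ENNReal.ofReal |(ε ^ d)⁻¹|)
        (ENNReal.Tendsto.pow (n := 2) h.2) (Or.inr ENNReal.ofReal_ne_top)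
      simpa using this
    exact tendsto_zero_of_sq_le h2
      (fun N => sq_eLpNorm_comp_affine_le hε.ne' a (cell L) (fun x => ψ x - S N x))
  have hlim2 : Tendsto (fun N => ‖C * (fourierConst d : ℂ)‖ₑ *
      eLpNorm (Φ (uN N - u : Lp ℂ 2 ((volume : Measure (Sp d)).prod ν))) 2 ν) atTop (𝓝 0) := by
    have h1 := (Lp.tendsto_Lp_iff_tendsto_eLpNorm' uN u).1 huN
    have h1' : Tendsto (fun N => eLpNorm
        (uN N - u : Lp ℂ 2 ((volume : Measure (Sp d)).prod ν)) 2 (volume.prod ν)) atTop (𝓝 0) :=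
      h1.congr fun N => (eLpNorm_congr_ae (Lp.coeFn_sub _ _)).symm
    have h2 : Tendsto (fun N => volume B * eLpNorm
        (uN N - u : Lp ℂ 2 ((volume : Measure (Sp d)).prod ν)) 2 (volume.prod ν) ^ 2)
        atTop (𝓝 0) := by
      have := ENNReal.Tendsto.const_mul (a := volume B)
        (ENNReal.Tendsto.pow (n := 2) h1') (Or.inr hBt)
      simpa using this
    have h5 := ENNReal.Tendsto.const_mul (a := ‖C * (fourierConst d : ℂ)‖ₑ)
      (tendsto_zero_of_sq_le h2 fun N => hΦle (uN N - u)) (Or.inr enorm_ne_top)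
    simpa using h5
  have hzero : eLpNorm X 2 ν = 0 := by
    have := ge_of_tendsto' (hlim1.add hlim2) hle
    simpa using this
  rw [eLpNorm_eq_zero_iff hXm two_ne_zero] at hzero
  filter_upwards [hzero] with z hz
  rw [← integral_phase hB ε a z (fun k => u (k, z))]
  exact sub_eq_zero.1 hz

end Synthesis

/-! ### Folding of frequencies into the Brillouin zone. -/

section AliasIdentity

variable {L M : Matrix (Fin d) (Fin d) ℝ} {μ c ε : ℝ} {V : Sp d → Sp d → ℝ}
  {Vhat : Sp d → Sp d → ℂ} {v : ℕ → Sp d → ℂ}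

/-- A product of Fourier integrals, sampled on a lattice, as a Fourier integral over the dual
cell of the periodized convolution. -/
lemma alias_identity (hM : M.det ≠ 0) (x z : Sp d)
    (hx : ∀ m, planeWave (latVec M m) x = planeWave (latVec M m) (ε • z))
    (hK : Integrable fun k => Vhat k z) {u : Sp d → ℂ}
    (hu : Integrable u (volume.restrict (cell M))) :
    ((fourierConst d : ℂ) * ∫ q, planeWave q x * Vhat q z) * ∫ k in cell M, planeWave k x * u k
      = ∫ k in cell M, planeWave k x * ∫ y, kernelEps M ε Vhat k y z * u y := by
  set B := cell M with hBdef
  have hB : MeasurableSet B := measurableSet_cell M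
  set f : Sp d → ℂ := B.indicator u with hf
  set w : Sp d → ℂ := fun k => (fourierConst d : ℂ) * Vhat k z with hw
  have hfi : Integrable f := (integrable_indicator_iff hB).2 hu
  have hwi : Integrable w := hK.const_mul _
  have hconv : Integrable (fun p : Sp d × Sp d => f p.2 * w (p.1 - p.2)) (volume.prod volume) :=
    hfi.convolution_integrand (ContinuousLinearMap.mul ℂ ℂ) hwi
  set F : Sp d × Sp d → ℂ := fun p => planeWave p.1 x * (f p.2 * w (p.1 - p.2)) with hF
  have hFi : Integrable F (volume.prod volume) := by
    refine hconv.bdd_mul (c := 1) (Continuous.aestronglyMeasurable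
      (continuous_planeWave.comp (f := fun p : Sp d × Sp d => (p.1, x)) (by fun_prop))) ?_
    exact ae_of_all _ fun p => (norm_planeWave p.1 x).le
  -- The product of the two Fourier integrals is one integral over `(k,k')` of a convolution
  -- integrand. Tiling the `k` variable by translates of the cell produces the lattice sum.
  have hmp : MeasurePreserving (fun q : Sp d × (Fin d → ℤ) × Sp d =>
      (q.1 + latVec M q.2.1, q.2.2))
      ((volume.restrict B).prod (Measure.count.prod volume)) (volume.prod volume) := by
    have h1 := (measurePreserving_tiling hM).prod (MeasurePreserving.id (volume : Measure (Sp d)))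
    have h2 := (measurePreserving_prodAssoc (volume.restrict B)
      (Measure.count : Measure (Fin d → ℤ)) (volume : Measure (Sp d))).symm
    exact h1.comp h2
  set G : Sp d × (Fin d → ℤ) × Sp d → ℂ := fun q => F (q.1 + latVec M q.2.1, q.2.2) with hG
  have hGi : Integrable G ((volume.restrict B).prod (Measure.count.prod volume)) :=
    hmp.integrable_comp_of_integrable hFi
  have hGF : ∫ q, G q ∂((volume.restrict B).prod (Measure.count.prod volume))
      = ∫ p, F p ∂(volume.prod volume) := by
    rw [← hmp.map_eq, integral_map hmp.measurable.aemeasurable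
      (by rw [hmp.map_eq]; exact hFi.aestronglyMeasurable)]
  have hlhs : ((fourierConst d : ℂ) * ∫ q, planeWave q x * Vhat q z)
      * ∫ k in B, planeWave k x * u k = ∫ p, F p ∂(volume.prod volume) := by
    rw [integral_prod_symm _ hFi, ← integral_indicator hB, ← integral_const_mul]
    refine integral_congr_ae (ae_of_all _ fun k' => ?_)
    have e1 : (fourierConst d : ℂ) * ∫ q, planeWave q x * Vhat q z
        = ∫ q, planeWave (q - k') x * w (q - k') := by
      rw [integral_sub_right_eq_self (fun q => planeWave q x * w q) k', ← integral_const_mul]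
      refine integral_congr_ae (ae_of_all _ fun q => ?_)
      simp only [hw]
      ring
    have e2 : B.indicator (fun k => planeWave k x * u k) k' = planeWave k' x * f k' := by
      by_cases hk : k' ∈ B <;> simp [hf, hk]
    beta_reduce
    rw [e1, e2, ← integral_mul_const]
    refine integral_congr_ae (ae_of_all _ fun q => ?_)
    have e3 : planeWave q x = planeWave (q - k') x * planeWave k' x := by
      rw [← planeWave_add_left, sub_add_cancel]
    simp only [hF, e3]
    ring
  rw [hlhs, ← hGF, integral_prod _ hGi]
  refine integral_congr_ae ?_
  filter_upwards [hGi.prod_right_ae, ae_restrict_mem hB] with k hk hkB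
  rw [integral_prod_symm _ hk, ← integral_const_mul]
  refine integral_congr_ae (ae_of_all _ fun y => ?_)
  beta_reduce
  have e4 : kernelEps M ε Vhat k y z * u y
      = f y * ((fourierConst d : ℂ) * ∫ m, aliasTerm M ε Vhat k y z m ∂Measure.count) := by
    rw [kernelEps, ← hBdef, indicator_of_mem hkB, Pi.one_apply, one_mul]
    by_cases hy : y ∈ B
    · simp only [hf, indicator_of_mem hy, Pi.one_apply, one_mul]; ring
    · simp [hf, hy]
  rw [e4, ← integral_const_mul, ← integral_const_mul, ← integral_const_mul]
  -- At `x` the phase of a lattice frequency is its phase at `εz`, by `hx`; this is the Bloch phase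
  -- of the kernel.
  refine integral_congr_ae (ae_of_all _ fun m => ?_)
  simp only [hG, hF, hw, aliasTerm, planeWave_add_left, hx]
  ring

/-- The weight `𝟙` of the complement of a measurable set. -/
def complWeight {B : Set (Sp d)} (hB : MeasurableSet B) : Weight (Sp d) where
  toFun := Bᶜ.indicator 1
  meas := measurable_one.indicator hB.compl
  bound := 1
  bound_nonneg := zero_le_one
  abs_le k := by by_cases h : k ∈ B <;> simp [h]

/-- Multiplication by the indicator of `Bᶜ` kills every component and commutes with `synth`, so it
kills the synthesis. -/
lemma ae_synth_eq_zero {B : Set (Sp d)} (hB : MeasurableSet B)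
    {ν : Measure (Sp d)} [SigmaFinite ν] (hv : IsONSystem ν v) {g : EnvSpace d}
    (hg : ∀ n, ∀ᵐ k : Sp d, k ∉ B → g n k = 0) :
    ∀ᵐ p ∂((volume : Measure (Sp d)).prod ν), p.1 ∉ B → hv.synth volume g p = 0 := by
  have h0 : (complWeight hB).env volume g = 0 := by
    ext1
    funext n
    rw [Weight.env_apply]
    change (complWeight hB).mul volume (g n) = 0
    ext1
    filter_upwards [(complWeight hB).coeFn_mul (g n), hg n,
      Lp.coeFn_zero ℂ 2 (volume : Measure (Sp d))] with k h1 h2 h3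
    rw [h1, h3, Pi.zero_apply]
    by_cases hk : k ∈ B
    · simp [complWeight, hk]
    · rw [h2 hk, mul_zero]
  have h1 := hv.synth_env (complWeight hB) g
  rw [h0, map_zero] at h1
  have h2 := ((complWeight hB).fst (Sp d)).coeFn_mul (hv.synth volume g)
  rw [← h1] at h2
  filter_upwards [h2, Lp.coeFn_zero ℂ 2 ((volume : Measure (Sp d)).prod ν)] with p h3 h4 hp
  rw [h4] at h3
  simpa [complWeight, Weight.fst, hp] using h3.symm

/-- `𝓤^ε` is the operator `coeffs ∘ op ∘ synth`. -/
lemma IsPotHat.synth_eq_of_isUeps (hL : L.det ≠ 0) (hε : 0 < ε) (h : IsPotHat L μ c V Vhat)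
    (hVper : ∀ x, IsPeriodic L (V x)) (hv : IsONSystem (volume.restrict (cell L)) v)
    (hper : ∀ n, IsPeriodic L (v n)) {g f : EnvSpace d} (hU : IsUeps L v V ε g f) :
    hv.synth volume f =
      (h.isSchur_kernelEps (det_recip (det_smul_ne_zero hL hε.ne')) ε).op
        (hv.synth volume g) := by
  obtain ⟨ψ, hψ, hsupp, hVψ⟩ := hU
  have hεL := det_smul_ne_zero hL hε.ne'
  set M := recip (ε • L) with hMdef
  have hM : M.det ≠ 0 := det_recip hεL
  have hBeq : brillouinScaled L ε = cell M := brillouinScaled_eq hL hε.ne'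
  have hB : MeasurableSet (cell M) := measurableSet_cell M
  have hBt : volume (cell M) ≠ ⊤ := (volume_cell_lt_top M).ne
  have hlat : ∀ m, latVec (ε • L) m = ε • latVec L m := fun m => latMap_smul ε L _
  have hrec : recip M = ε • L := recip_recip hεL
  have hfc : (fourierConst d : ℂ) ≠ 0 := by exact_mod_cast (fourierConst_pos d).ne'
  set hS := h.isSchur_kernelEps hM ε
  set u := hv.synth (volume : Measure (Sp d)) g
  set H := hv.synth (volume : Measure (Sp d)) f
  have hout : ∀ᵐ z ∂(volume.restrict (cell L)), ∀ᵐ k, k ∉ cell M → H (k, z) = 0 := by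
    refine ae_prod_swap (P := fun p => p.1 ∉ cell M → H p = 0) ?_
    exact ae_synth_eq_zero hB hv (by simpa only [hBeq] using hsupp)
  have hset : MeasurableSet {p : Sp d × Sp d | H p = hS.op u p} :=
    measurableSet_eq_fun (Lp.stronglyMeasurable _).measurable (Lp.stronglyMeasurable _).measurable
  ext1
  refine (Measure.ae_prod_iff_ae_ae hset).2 ((Measure.ae_ae_comm
    (p := fun k z => H (k, z) = hS.op u (k, z)) hset).2 ?_)
  rcases eq_or_ne (volume (cell L)) 0 with hC | hC
  · have hall : ∀ P : Sp d → Prop, ∀ᵐ y ∂(volume.restrict (cell L)), P y := fun P => by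
      rw [Measure.restrict_eq_zero.2 hC]; simp
    exact hall _
  have hsq : (Real.sqrt (volume.real (cell L)) : ℂ) ≠ 0 := by
    have : 0 < volume.real (cell L) :=
      ENNReal.toReal_pos hC (volume_cell_lt_top L).ne
    exact_mod_cast (Real.sqrt_pos.2 this).ne'
  filter_upwards [ae_all_iff.2 (hψ.ae_eq hL hε hv hper), ae_all_iff.2 (hVψ.ae_eq hL hε hv hper),
    h.fourier, hout, ae_memLp_slice (Lp.memLp u), ae_memLp_slice (Lp.memLp H),
    ae_memLp_slice (Lp.memLp (hS.op u)), ae_prod_swap (hS.coeFn_op u)]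
    with z h1 h2 h3 h4 h5 h6 h7 h8
  have hui : Integrable (fun k => u (k, z)) (volume.restrict (cell M)) :=
    (h5.restrict (cell M)).integrable one_le_two
  -- For fixed `z`, sampling at all `x = ε(z+a)`, `a ∈ 𝓛`, yields all Fourier coefficients on the
  -- frequency cell of the difference multiplied by `e^{ik·εz}`. Their vanishing forces equality on
  -- the cell; off the cell both functions are zero.
  have hmain : ∀ m, ∫ k in cell M, planeWave k (ε • (z + latVec L m)) * (H (k, z) - hS.op u (k, z))
      = 0 := by
    intro m
    set x := ε • (z + latVec L m) with hxdef
    have hx : ∀ n, planeWave (latVec M n) x = planeWave (latVec M n) (ε • z) := by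
      intro n
      rw [hxdef, smul_add, planeWave_add_right, ← hlat, planeWave_latVec_recip hεL, mul_one]
    have e1 := h2 m
    -- Periodicity freezes the fast variable at `z`, while the slow variable keeps the sampled value
    -- `x`.
    have e2 : V x (ε⁻¹ • x) = V x z := by
      rw [hxdef, inv_smul_smul₀ hε.ne']
      exact hVper _ m z
    have e0 : (V x z : ℂ) = (fourierConst d : ℂ) * ∫ q, planeWave q x * Vhat q z := h3.2 x
    rw [← hxdef, e2, h1 m, e0, hBeq, ← hxdef] at e1
    have e3 := alias_identity hM x z hx h3.1 hui
    have e4 : ∫ k in cell M, planeWave k x * H (k, z)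
        = ((fourierConst d : ℂ) * ∫ q, planeWave q x * Vhat q z)
          * ∫ k in cell M, planeWave k x * u (k, z) := by
      have hprod : (Real.sqrt (volume.real (cell L)) : ℂ) * (fourierConst d : ℂ) ≠ 0 :=
        mul_ne_zero hsq hfc
      refine mul_left_cancel₀ hprod ?_
      rw [mul_assoc, ← e1]
      ring
    have e5 : ∫ k in cell M, planeWave k x * hS.op u (k, z)
        = ∫ k in cell M, planeWave k x * ∫ y, kernelEps M ε Vhat k y z * u (y, z) := by
      refine integral_congr_ae ?_
      filter_upwards [ae_restrict_of_ae h8] with k hk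
      rw [hk, kernelFun]
    simp only [mul_sub]
    rw [integral_sub (integrable_planeWave_mul_of_memLp hBt h6 x)
      (integrable_planeWave_mul_of_memLp hBt h7 x), e4, e5, e3, sub_self]
  have hzero := ae_eq_zero_of_fourier_cell hM
    (f := fun k => planeWave k (ε • z) * (H (k, z) - hS.op u (k, z))) ?_ ?_
  · have hz' := (ae_restrict_iff' hB).1 hzero
    filter_upwards [hz', h4, h8] with k k1 k2 k3
    by_cases hk : k ∈ cell M
    · have := (mul_eq_zero.1 (k1 hk)).resolve_left (planeWave_ne_zero _ _)
      exact sub_eq_zero.1 this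
    · rw [k2 hk, k3, kernelFun]
      simp [kernelEps, hk]
  · refine ((h6.sub h7).restrict (cell M)).of_le_mul (c := 1) ?_ ?_
    · exact (Continuous.aestronglyMeasurable (continuous_planeWave.comp
        (f := fun k : Sp d => (k, ε • z)) (by fun_prop))).mul
          ((h6.sub h7).restrict (cell M)).aestronglyMeasurable
    · refine ae_of_all _ fun k => ?_
      rw [norm_mul, norm_planeWave]
      rfl
  · intro n
    -- The conjugate in the Fourier coefficient reverses the sign of the lattice vector.
    rw [← hmain (-n)]
    refine integral_congr_ae (ae_of_all _ fun k => ?_)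
    beta_reduce
    rw [hrec, conj_planeWave, ← latVec_neg, hlat, smul_add, planeWave_add_right,
      planeWave_comm (ε • latVec L (-n)) k]
    ring

end AliasIdentity

/-! ### Symmetry of the `k·p` operator -/

section Bloch

variable {L : Matrix (Fin d) (Fin d) ℝ} {W : Sp d → ℝ} {E : ℕ → ℝ} {v : ℕ → Sp d → ℂ}
  {dv : ℕ → Fin d → Sp d → ℂ}

lemma contDiff_planeWave (k : Sp d) : ContDiff ℝ ∞ (planeWave k) := by
  have h : ContDiff ℝ ∞ fun x : Sp d => ((inner ℝ k x : ℝ) : ℂ) :=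
    Complex.ofRealCLM.contDiff.comp (innerSL ℝ k).contDiff
  exact (contDiff_const.mul h).cexp

lemma partialDeriv_planeWave (j : Fin d) (k x : Sp d) :
    partialDeriv j (planeWave k) x = Complex.I * (k j : ℂ) * planeWave k x := by
  have h1 : HasFDerivAt (fun x : Sp d => Complex.I * ((inner ℝ k x : ℝ) : ℂ))
      (Complex.I • (Complex.ofRealCLM.comp (innerSL ℝ k))) x :=
    ((Complex.ofRealCLM.hasFDerivAt).comp x (innerSL ℝ k).hasFDerivAt).const_mul Complex.I
  have h2 := h1.cexp
  have h3 : fderiv ℝ (planeWave k) x = _ := h2.fderiv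
  rw [partialDeriv, h3]
  simp only [planeWave, smul_apply, ContinuousLinearMap.comp_apply, innerSL_apply_apply,
    Complex.ofRealCLM_apply, EuclideanSpace.inner_single_right, smul_eq_mul]
  simp
  ring

lemma isPerTest_planeWave (hL : L.det ≠ 0) (m : Fin d → ℤ) :
    IsPerTest L (planeWave (-latVec (recip L) m)) := by
  refine ⟨contDiff_planeWave _, fun n x => ?_⟩
  have h := planeWave_latVec_recip hL (-m) n
  rw [latVec_neg] at h
  change planeWave (-latVec (recip L) m) (x + latVec L n) = _
  rw [planeWave_add_right, h, mul_one]

/-- Fourier coefficients on the cell. -/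
def cellCoeff (L : Matrix (Fin d) (Fin d) ℝ) (f : Sp d → ℂ) (m : Fin d → ℤ) : ℂ :=
  ∫ x in cell L, conj (planeWave (latVec (recip L) m) x) * f x

lemma cellCoeff_eq (f : Sp d → ℂ) (m : Fin d → ℤ) :
    cellCoeff L f m = ∫ x in cell L, f x * planeWave (-latVec (recip L) m) x := by
  simp only [cellCoeff, conj_planeWave, mul_comm]

/-- Plane waves of reciprocal lattice vectors are periodic test functions, so the weak gradient
becomes multiplication by `iλ_j` on Fourier coefficients. -/
lemma IsBlochBasis.cellCoeff_grad (hb : IsBlochBasis L W E v dv) (hL : L.det ≠ 0) (n : ℕ)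
    (j : Fin d) (m : Fin d → ℤ) :
    cellCoeff L (dv n j) m = Complex.I * (latVec (recip L) m j : ℂ) * cellCoeff L (v n) m := by
  have h := hb.weak_grad n j _ (isPerTest_planeWave hL m)
  have e : ∫ x in cell L, v n x * partialDeriv j (planeWave (-latVec (recip L) m)) x
      = -(Complex.I * (latVec (recip L) m j : ℂ)) *
        ∫ x in cell L, v n x * planeWave (-latVec (recip L) m) x := by
    rw [← integral_const_mul]
    refine integral_congr_ae (ae_of_all _ fun x => ?_)
    simp only [partialDeriv_planeWave, PiLp.neg_apply]
    push_cast
    ring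
  rw [cellCoeff_eq, cellCoeff_eq]
  rw [e] at h
  linear_combination h

lemma IsBlochBasis.cellCoeff_eigen (hb : IsBlochBasis L W E v dv) (hL : L.det ≠ 0) (n : ℕ)
    (m : Fin d → ℤ) :
    (1 / 2 : ℂ) * ∑ j, (-(Complex.I * (latVec (recip L) m j : ℂ))) * cellCoeff L (dv n j) m
      + cellCoeff L (fun x => (W x : ℂ) * v n x) m = (E n : ℂ) * cellCoeff L (v n) m := by
  have h := hb.eigen n _ (isPerTest_planeWave hL m)
  have e : ∀ j, ∫ x in cell L, dv n j x * partialDeriv j (planeWave (-latVec (recip L) m)) x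
      = -(Complex.I * (latVec (recip L) m j : ℂ)) * cellCoeff L (dv n j) m := by
    intro j
    rw [cellCoeff_eq, ← integral_const_mul]
    refine integral_congr_ae (ae_of_all _ fun x => ?_)
    simp only [partialDeriv_planeWave, PiLp.neg_apply]
    push_cast
    ring
  simp only [e] at h
  rw [cellCoeff_eq (v n), cellCoeff_eq (fun x => (W x : ℂ) * v n x)]
  exact h

lemma hasSum_cellCoeff (hL : L.det ≠ 0) {f g : Sp d → ℂ}
    (hf : MemLp f 2 (volume.restrict (cell L))) (hg : MemLp g 2 (volume.restrict (cell L))) :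
    HasSum (fun m => conj (cellCoeff L f m) * cellCoeff L g m)
      (((|L.det| : ℝ) : ℂ) * ∫ x in cell L, conj (f x) * g x) :=
  hasSum_fourier_cell hL hf hg

/-- Integration by parts. -/
lemma IsBlochBasis.integral_by_parts (hb : IsBlochBasis L W E v dv) (hL : L.det ≠ 0) (n n' : ℕ)
    (j : Fin d) : ∫ x in cell L, conj (v n x) * dv n' j x
      = -∫ x in cell L, conj (dv n j x) * v n' x := by
  have hdet : ((|L.det| : ℝ) : ℂ) ≠ 0 := by exact_mod_cast (abs_pos.2 hL).ne'
  have h1 := hasSum_cellCoeff hL (hb.memLp n) (hb.grad_memLp n' j)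
  have h2 := hasSum_cellCoeff hL (hb.grad_memLp n j) (hb.memLp n')
  -- The `v n` are only `H¹` and not admissible as test functions. Comparison goes through Parseval:
  -- the multiplier `iλ_j` changes sign under conjugation.
  have e : ∀ m, conj (cellCoeff L (v n) m) * cellCoeff L (dv n' j) m
      = -(conj (cellCoeff L (dv n j) m) * cellCoeff L (v n') m) := by
    intro m
    rw [hb.cellCoeff_grad hL, hb.cellCoeff_grad hL, map_mul, map_mul, Complex.conj_I,
      Complex.conj_ofReal]
    ring
  simp only [e] at h1
  have h3 := h1.unique h2.neg
  rw [← mul_neg] at h3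
  exact mul_left_cancel₀ hdet h3

/-- The crystal potential as a bounded weight. -/
def potWeight (hW : IsCrystalPotential L W) : Weight (Sp d) where
  toFun := W
  meas := hW.measurable
  bound := |hW.bounded.choose|
  bound_nonneg := abs_nonneg _
  abs_le x := by
    rw [abs_of_nonneg (zero_le_one.trans (hW.one_le x))]
    exact (hW.bounded.choose_spec x).trans (le_abs_self _)

/-- The energy form is diagonal in the Bloch basis. -/
lemma IsBlochBasis.energy_form (hb : IsBlochBasis L W E v dv) (hW : IsCrystalPotential L W)
    (hL : L.det ≠ 0) (n n' : ℕ) :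
    (1 / 2 : ℂ) * ∑ j, (∫ x in cell L, conj (dv n j x) * dv n' j x)
      + ∫ x in cell L, conj (v n x) * ((W x : ℂ) * v n' x)
      = (E n' : ℂ) * ∫ x in cell L, conj (v n x) * v n' x := by
  have hdet : ((|L.det| : ℝ) : ℂ) ≠ 0 := by exact_mod_cast (abs_pos.2 hL).ne'
  have h1 := hasSum_sum (s := Finset.univ) fun j _ =>
    hasSum_cellCoeff hL (hb.grad_memLp n j) (hb.grad_memLp n' j)
  have h2 := hasSum_cellCoeff (g := fun x => (W x : ℂ) * v n' x) hL (hb.memLp n)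
    ((potWeight hW).memLp_mul (hb.memLp n'))
  have h3 := (hasSum_cellCoeff hL (hb.memLp n) (hb.memLp n')).mul_left (E n' : ℂ)
  have h4 := (h1.mul_left (1 / 2 : ℂ)).add h2
  -- The eigenvalue equation tested with a plane wave, multiplied by the conjugate coefficient of `v
  -- n`; summation over `m` is Parseval.
  have e : ∀ m, (1 / 2 : ℂ) * ∑ j, conj (cellCoeff L (dv n j) m) * cellCoeff L (dv n' j) m
      + conj (cellCoeff L (v n) m) * cellCoeff L (fun x => (W x : ℂ) * v n' x) m
      = (E n' : ℂ) * (conj (cellCoeff L (v n) m) * cellCoeff L (v n') m) := by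
    intro m
    have h5 := hb.cellCoeff_eigen hL n' m
    have h6 : ∀ j, conj (cellCoeff L (dv n j) m) * cellCoeff L (dv n' j) m
        = conj (cellCoeff L (v n) m) *
          (-(Complex.I * (latVec (recip L) m j : ℂ)) * cellCoeff L (dv n' j) m) := by
      intro j
      rw [hb.cellCoeff_grad hL n, map_mul, map_mul, Complex.conj_I, Complex.conj_ofReal]
      ring
    simp only [h6]
    rw [← Finset.mul_sum]
    linear_combination (conj (cellCoeff L (v n) m)) * h5
  have h7 := (h4.congr_fun fun m => (e m).symm).unique h3
  refine mul_left_cancel₀ hdet ?_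
  rw [← Finset.mul_sum] at h7
  linear_combination h7

end Bloch

/-! ### Skew forms controlled by a diagonal form. -/

section AbstractSymmetry

variable {𝓗 : Type*} [NormedAddCommGroup 𝓗] [InnerProductSpace ℂ 𝓗] [CompleteSpace 𝓗]

/-- Convergence and skew symmetry of a form that is relatively bounded with respect to a
diagonal one. -/
lemma exists_hasSum_skew {e D : ℕ → 𝓗} (he : Orthonormal ℂ e)
    (hskew : ∀ n m, inner ℂ (e n) (D m) = -inner ℂ (D n) (e m)) {E : ℕ → ℝ}
    (hbound : ∀ (s : Finset ℕ) (c : ℕ → ℂ),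
      ‖∑ n ∈ s, c n • D n‖ ^ 2 ≤ 2 * ∑ n ∈ s, E n * ‖c n‖ ^ 2)
    {c : ℕ → ℂ} (hc : Summable fun n => ‖c n‖ ^ 2)
    (hEc : Summable fun n => ‖(E n : ℂ) * c n‖ ^ 2) :
    (∀ n, Summable fun m => inner ℂ (e n) (D m) * c m) ∧
    ∃ x : ℂ, x.re = 0 ∧
      HasSum (fun n => conj (c n) * ∑' m, inner ℂ (e n) (D m) * c m) x := by
  -- Pointwise `|E||c|² ≤ |c|² + |Ec|²`.
  have hE : Summable fun n => E n * ‖c n‖ ^ 2 := by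
    refine Summable.of_norm_bounded (hc.add hEc) fun n => ?_
    rw [norm_mul, norm_pow, norm_norm, Complex.norm_mul, Complex.norm_real, mul_pow]
    nlinarith [sq_nonneg (‖E n‖ - 1), sq_nonneg ‖c n‖, mul_nonneg (sq_nonneg (‖E n‖ - 1))
      (sq_nonneg ‖c n‖)]
  have hφ : Summable fun n => c n • e n := by
    have h1 := (he.orthogonalFamily).summable_iff_norm_sq_summable (f := c)
    exact h1.2 hc
  -- `hbound` bounds finite blocks of `∑ c n • D n` by blocks of the convergent series `hE`, which
  -- gives the Cauchy criterion.
  have hD : Summable fun n => c n • D n := by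
    rw [summable_iff_vanishing_norm]
    intro δ hδ
    obtain ⟨s, hs⟩ := summable_iff_vanishing_norm.1 hE (δ ^ 2 / 2) (by positivity)
    refine ⟨s, fun t ht => ?_⟩
    have h1 := hbound t c
    have h2 := (le_abs_self _).trans_lt (hs t ht)
    have h3 : ‖∑ n ∈ t, c n • D n‖ ^ 2 < δ ^ 2 := by linarith
    exact lt_of_pow_lt_pow_left₀ 2 hδ.le h3
  obtain ⟨φ, hφ⟩ := hφ
  obtain ⟨ψ, hψ⟩ := hD
  have hinner : ∀ n, HasSum (fun m => inner ℂ (e n) (D m) * c m) (inner ℂ (e n) ψ) := by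
    intro n
    have := hψ.mapL (innerSL ℂ (e n))
    simpa only [innerSL_apply_apply, inner_smul_right, mul_comm] using this
  refine ⟨fun n => (hinner n).summable, inner ℂ φ ψ, ?_, ?_⟩
  -- The real part vanishes on finite sums by skew symmetry, and passes to the limit since both
  -- series converge in norm.
  · have hlim : Tendsto (fun s : Finset ℕ => inner ℂ (∑ n ∈ s, c n • e n) (∑ n ∈ s, c n • D n)
        + inner ℂ (∑ n ∈ s, c n • D n) (∑ n ∈ s, c n • e n)) atTop
        (𝓝 (inner ℂ φ ψ + inner ℂ ψ φ)) :=
      (Tendsto.inner hφ hψ).add (Tendsto.inner hψ hφ)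
    have hzero : ∀ s : Finset ℕ, inner ℂ (∑ n ∈ s, c n • e n) (∑ n ∈ s, c n • D n)
        + inner ℂ (∑ n ∈ s, c n • D n) (∑ n ∈ s, c n • e n) = 0 := by
      intro s
      simp only [sum_inner, inner_sum, inner_smul_left, inner_smul_right, hskew]
      rw [← Finset.sum_add_distrib]
      refine Finset.sum_eq_zero fun i _ => ?_
      rw [← mul_add, ← Finset.sum_add_distrib, Finset.sum_eq_zero, mul_zero]
      intro m _
      ring
    simp only [hzero] at hlim
    have h0 := tendsto_nhds_unique tendsto_const_nhds hlim
    rw [← inner_conj_symm ψ φ] at h0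
    have := congrArg Complex.re h0
    simp only [Complex.zero_re, Complex.add_re, Complex.conj_re] at this
    linarith
  · have h1 := ((innerSL ℂ ψ).hasSum hφ).map (starRingEnd ℂ) Complex.continuous_conj
    have h2 : HasSum (fun n => conj (c n) * inner ℂ (e n) ψ) (inner ℂ φ ψ) := by
      simpa only [Function.comp_def, innerSL_apply_apply, inner_conj_symm, inner_smul_left]
        using h1
    simpa only [(hinner _).tsum_eq] using h2

end AbstractSymmetry

/-! ### Well-definedness, linearity and symmetry of the `k·p` operator. -/

section Akp

variable {L : Matrix (Fin d) (Fin d) ℝ} {W : Sp d → ℝ} {E : ℕ → ℝ} {v : ℕ → Sp d → ℂ}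
  {dv : ℕ → Fin d → Sp d → ℂ}

lemma inner_toLp {X : Type*} [MeasurableSpace X] {μ : Measure X} {f g : X → ℂ}
    (hf : MemLp f 2 μ) (hg : MemLp g 2 μ) :
    inner ℂ (hf.toLp f) (hg.toLp g) = ∫ x, conj (f x) * g x ∂μ := by
  rw [L2.inner_def]
  refine integral_congr_ae ?_
  filter_upwards [hf.coeFn_toLp, hg.coeFn_toLp] with x h1 h2
  rw [h1, h2, RCLike.inner_apply, mul_comm]

lemma IsBlochBasis.orthonormal_toLp (hb : IsBlochBasis L W E v dv) :
    Orthonormal ℂ fun n => (hb.memLp n).toLp (v n) := by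
  rw [orthonormal_iff_ite]
  intro n m
  rw [inner_toLp, hb.orthonormal]

lemma Weight.re_inner_mul_nonneg {X : Type*} [MeasurableSpace X] {μ : Measure X} (a : Weight X)
    (ha : ∀ x, 0 ≤ a.toFun x) (f : Lp ℂ 2 μ) : 0 ≤ (inner ℂ f (a.mul μ f)).re := by
  have hInt := L2.integrable_inner (𝕜 := ℂ) f (a.mul μ f)
  rw [L2.inner_def]
  have h := integral_re hInt
  simp only [RCLike.re_eq_complex_re] at h
  rw [← h]
  refine integral_nonneg_of_ae ?_
  filter_upwards [a.coeFn_mul f] with x hx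
  rw [hx, RCLike.inner_apply, mul_assoc, Complex.mul_conj, ← Complex.ofReal_mul,
    Complex.ofReal_re]
  exact mul_nonneg (ha x) (Complex.normSq_nonneg _)

/-- The gradient is bounded by the energy. -/
lemma IsBlochBasis.norm_grad_sq_le (hb : IsBlochBasis L W E v dv) (hW : IsCrystalPotential L W)
    (hL : L.det ≠ 0) (j : Fin d) (s : Finset ℕ) (c : ℕ → ℂ) :
    ‖∑ n ∈ s, c n • (hb.grad_memLp n j).toLp (dv n j)‖ ^ 2 ≤ 2 * ∑ n ∈ s, E n * ‖c n‖ ^ 2 := by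
  set e : ℕ → Lp ℂ 2 (volume.restrict (cell L)) := fun n => (hb.memLp n).toLp (v n) with he
  set D : Fin d → ℕ → Lp ℂ 2 (volume.restrict (cell L)) :=
    fun j n => (hb.grad_memLp n j).toLp (dv n j) with hD
  set T := (potWeight hW).mul (volume.restrict (cell L)) with hT
  have hTe : ∀ n, T (e n) = ((potWeight hW).memLp_mul (hb.memLp n)).toLp _ := by
    intro n
    ext1
    filter_upwards [(potWeight hW).coeFn_mul (e n), (hb.memLp n).coeFn_toLp,
      ((potWeight hW).memLp_mul (hb.memLp n)).coeFn_toLp] with x h1 h2 h3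
    rw [h3, ← h2]
    exact h1
  have hform : ∀ n n', (1 / 2 : ℂ) * ∑ j, inner ℂ (D j n) (D j n') + inner ℂ (e n) (T (e n'))
      = (E n' : ℂ) * if n = n' then 1 else 0 := by
    intro n n'
    rw [← hb.orthonormal n n', ← hb.energy_form hW hL n n', hTe]
    simp only [hD, he, inner_toLp]
    rfl
  -- The energy form of `∑ c n • v n` is diagonal. The potential term is nonnegative, so half the
  -- squared norm of each gradient component is at most the energy.
  have hsum : (1 / 2 : ℂ) * ∑ j, inner ℂ (∑ n ∈ s, c n • D j n) (∑ n ∈ s, c n • D j n)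
      + inner ℂ (∑ n ∈ s, c n • e n) (T (∑ n ∈ s, c n • e n))
      = ((∑ n ∈ s, E n * ‖c n‖ ^ 2 : ℝ) : ℂ) := by
    have h1 : ∀ n ∈ s, ∑ n' ∈ s, conj (c n) * c n' * ((E n' : ℂ) * if n = n' then 1 else 0)
        = ((E n * ‖c n‖ ^ 2 : ℝ) : ℂ) := by
      intro n hn
      rw [Finset.sum_eq_single_of_mem n hn fun m _ hm => by simp [hm.symm]]
      have := Complex.conj_mul' (c n)
      push_cast
      rw [if_pos rfl, this]
      ring
    rw [Complex.ofReal_sum, ← Finset.sum_congr rfl h1]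
    simp only [← hform]
    simp only [map_sum, map_smul, sum_inner, inner_sum, inner_smul_left, inner_smul_right]
    simp only [mul_add, Finset.sum_add_distrib, Finset.mul_sum]
    congr 1
    · conv_rhs => rw [Finset.sum_comm]
      rw [Finset.sum_comm]
      refine Finset.sum_congr rfl fun n _ => ?_
      rw [Finset.sum_comm]
      refine Finset.sum_congr rfl fun n' _ => Finset.sum_congr rfl fun j _ => ?_
      ring
    · rw [Finset.sum_comm]
      refine Finset.sum_congr rfl fun n _ => Finset.sum_congr rfl fun n' _ => ?_
      ring
  have hpos := (potWeight hW).re_inner_mul_nonneg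
    (fun x => zero_le_one.trans (hW.one_le x)) (∑ n ∈ s, c n • e n)
  have hre := congrArg Complex.re hsum
  simp only [inner_self_eq_norm_sq_to_K, Complex.add_re, Complex.ofReal_re] at hre
  have h2 : ((1 / 2 : ℂ) * ∑ j, ((‖∑ n ∈ s, c n • D j n‖ : ℝ) : ℂ) ^ 2).re
      = 1 / 2 * ∑ j, ‖∑ n ∈ s, c n • D j n‖ ^ 2 := by
    have : (1 / 2 : ℂ) * ∑ j, ((‖∑ n ∈ s, c n • D j n‖ : ℝ) : ℂ) ^ 2
      = ((1 / 2 * ∑ j, ‖∑ n ∈ s, c n • D j n‖ ^ 2 : ℝ) : ℂ) := by push_cast; rfl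
    rw [this, Complex.ofReal_re]
  have h3 : ‖∑ n ∈ s, c n • D j n‖ ^ 2 ≤ ∑ j, ‖∑ n ∈ s, c n • D j n‖ ^ 2 :=
    Finset.single_le_sum (f := fun j => ‖∑ n ∈ s, c n • D j n‖ ^ 2) (fun _ _ => sq_nonneg _)
      (Finset.mem_univ j)
  have h4 : ((1 / 2 : ℂ) * ∑ j, ((‖∑ n ∈ s, c n • D j n‖ : ℝ) : ℂ) ^ 2).re
      + (inner ℂ (∑ n ∈ s, c n • e n) (T (∑ n ∈ s, c n • e n))).re
      = ∑ n ∈ s, E n * ‖c n‖ ^ 2 := hre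
  rw [h2] at h4
  change ‖∑ n ∈ s, c n • D j n‖ ^ 2 ≤ _
  change 0 ≤ (inner ℂ (∑ n ∈ s, c n • e n) (T (∑ n ∈ s, c n • e n))).re at hpos
  linarith

lemma IsBlochBasis.exists_hasSum_gradElem (hb : IsBlochBasis L W E v dv)
    (hW : IsCrystalPotential L W) (hL : L.det ≠ 0) (j : Fin d)
    {c : ℕ → ℂ} (hc : Summable fun n => ‖c n‖ ^ 2)
    (hEc : Summable fun n => ‖(E n : ℂ) * c n‖ ^ 2) :
    (∀ n, Summable fun m => gradElem L v dv n m j * c m) ∧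
    ∃ x : ℂ, x.re = 0 ∧
      HasSum (fun n => conj (c n) * ∑' m, gradElem L v dv n m j * c m) x := by
  have h := exists_hasSum_skew (D := fun n => (hb.grad_memLp n j).toLp (dv n j))
    hb.orthonormal_toLp (fun n m => ?_) (hb.norm_grad_sq_le hW hL j) hc hEc
  · simpa only [inner_toLp, gradElem] using h
  · rw [inner_toLp, inner_toLp]
    exact hb.integral_by_parts hL n m j

/-- The off-diagonal part of the `k·p` operator converges. -/
lemma IsBlochBasis.hasSum_kp (hb : IsBlochBasis L W E v dv)
    (hW : IsCrystalPotential L W) (hL : L.det ≠ 0) (k : Sp d)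
    {c : ℕ → ℂ} (hc : Summable fun n => ‖c n‖ ^ 2)
    (hEc : Summable fun n => ‖(E n : ℂ) * c n‖ ^ 2) (n : ℕ) :
    HasSum (fun m => (∑ j, (k j : ℂ) * gradElem L v dv n m j) * c m)
      (∑ j, (k j : ℂ) * ∑' m, gradElem L v dv n m j * c m) := by
  have h := hasSum_sum (s := Finset.univ) fun j _ =>
    (((hb.exists_hasSum_gradElem hW hL j hc hEc).1 n).hasSum).mul_left (k j : ℂ)
  refine h.congr_fun fun m => ?_
  rw [Finset.sum_mul]
  exact Finset.sum_congr rfl fun j _ => by ring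

/-- Symmetry of the fibers of the `k·p` operator. -/
lemma IsBlochBasis.hasSum_im_fiber (hb : IsBlochBasis L W E v dv)
    (hW : IsCrystalPotential L W) (hL : L.det ≠ 0) (ε : ℝ) (k : Sp d)
    {c : ℕ → ℂ} (hc : Summable fun n => ‖c n‖ ^ 2)
    (hEc : Summable fun n => ‖(E n : ℂ) * c n‖ ^ 2) :
    HasSum (fun n => (conj (c n) * (((E n / ε ^ 2 + ‖k‖ ^ 2 / 2 : ℝ) : ℂ) * c n
      - Complex.I / (ε : ℂ) * ∑' m, (∑ j, (k j : ℂ) * gradElem L v dv n m j) * c m)).im) 0 := by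
  choose x hx hsum using fun j => (hb.exists_hasSum_gradElem hW hL j hc hEc).2
  have h1 := (hasSum_sum (s := Finset.univ) fun j _ => (hsum j).mul_left (k j : ℂ)).mul_left
    (-(Complex.I / (ε : ℂ)))
  have h2 := h1.mapL Complex.imCLM
  have h3 : (-(Complex.I / (ε : ℂ)) * ∑ j, (k j : ℂ) * x j).im = 0 := by
    have h4 : (∑ j, (k j : ℂ) * x j).re = 0 := by
      rw [Complex.re_sum]
      exact Finset.sum_eq_zero fun j _ => by simp [hx]
    -- The sums `x j` are purely imaginary, so the prefactor `-i/ε` makes the coupling term real.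
    have h5 : -(Complex.I / (ε : ℂ)) * ∑ j, (k j : ℂ) * x j
        = ((-ε⁻¹ : ℝ) : ℂ) * (Complex.I * ∑ j, (k j : ℂ) * x j) := by
      push_cast
      ring
    rw [h5, Complex.im_ofReal_mul, Complex.I_mul_im, h4, mul_zero]
  simp only [Complex.imCLM_apply, h3] at h2
  refine h2.congr_fun fun n => ?_
  rw [(hb.hasSum_kp hW hL k hc hEc n).tsum_eq]
  have h6 : conj (c n) * (((E n / ε ^ 2 + ‖k‖ ^ 2 / 2 : ℝ) : ℂ) * c n
      - Complex.I / (ε : ℂ) * ∑ j, (k j : ℂ) * ∑' m, gradElem L v dv n m j * c m)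
      = (((E n / ε ^ 2 + ‖k‖ ^ 2 / 2) * ‖c n‖ ^ 2 : ℝ) : ℂ)
        + -(Complex.I / (ε : ℂ)) *
          ∑ j, (k j : ℂ) * (conj (c n) * ∑' m, gradElem L v dv n m j * c m) := by
    have h7 : ∑ j, (k j : ℂ) * (conj (c n) * ∑' m, gradElem L v dv n m j * c m)
        = conj (c n) * ∑ j, (k j : ℂ) * ∑' m, gradElem L v dv n m j * c m := by
      rw [Finset.mul_sum]
      exact Finset.sum_congr rfl fun j _ => by ring
    have h8 := Complex.conj_mul' (c n)
    rw [h7]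
    push_cast
    linear_combination ((E n : ℂ) / (ε : ℂ) ^ 2 + (‖k‖ : ℂ) ^ 2 / 2) * h8
  rw [h6, Complex.add_im, Complex.ofReal_im, zero_add]

lemma integral_norm_sq_coeFn {X : Type*} [MeasurableSpace X] {μ : Measure X} (f : Lp ℂ 2 μ) :
    ∫ x, ‖f x‖ ^ 2 ∂μ = ‖f‖ ^ 2 := by
  have h : (inner ℂ f f : ℂ) = ((∫ x, ‖f x‖ ^ 2 ∂μ : ℝ) : ℂ) := by
    rw [L2.inner_def, ← integral_complex_ofReal]
    refine integral_congr_ae (ae_of_all _ fun x => ?_)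
    simp [inner_self_eq_norm_sq_to_K]
  apply Complex.ofReal_injective
  rw [← h, inner_self_eq_norm_sq_to_K]
  push_cast
  rfl

lemma summable_norm_sq (g : EnvSpace d) : Summable fun n => ‖g n‖ ^ 2 := by
  have := (lp.hasSum_norm (p := 2) (by norm_num) g).summable
  simpa using this

lemma ae_summable_sq (g : EnvSpace d) : ∀ᵐ k : Sp d, Summable fun n => ‖g n k‖ ^ 2 := by
  have h1 : ∀ n, ∫⁻ k : Sp d, ‖g n k‖ₑ ^ 2 = ENNReal.ofReal (‖g n‖ ^ 2) := by
    intro n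
    rw [← sq_eLpNorm_two, ENNReal.ofReal_pow (norm_nonneg _), Lp.norm_def,
      ENNReal.ofReal_toReal (Lp.eLpNorm_ne_top _)]
  have hm : ∀ n, AEMeasurable (fun k : Sp d => ‖g n k‖ₑ ^ 2) :=
    fun n => (Lp.aestronglyMeasurable (g n)).enorm.pow_const 2
  have h2 : ∫⁻ k : Sp d, ∑' n, ‖g n k‖ₑ ^ 2 ≠ ⊤ := by
    rw [lintegral_tsum hm]
    simp only [h1]
    exact (summable_norm_sq g).tsum_ofReal_ne_top
  filter_upwards [ae_lt_top' (AEMeasurable.tsum hm) h2] with k hk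
  have h3 : Summable fun n => ‖g n k‖₊ ^ 2 := by
    rw [← ENNReal.tsum_coe_ne_top_iff_summable]
    simp only [ENNReal.coe_pow]
    exact hk.ne
  have h4 := NNReal.summable_coe.2 h3
  simpa only [NNReal.coe_pow, coe_nnnorm] using h4

lemma coeFn_sub_env (g g' : EnvSpace d) :
    ∀ᵐ k : Sp d, ∀ n, (g - g') n k = g n k - g' n k := by
  rw [ae_all_iff]
  intro n
  filter_upwards [Lp.coeFn_sub (g n) (g' n)] with k hk
  exact hk

/-- Subtraction passes through the coupling series because the domain condition makes it converge,
by `IsBlochBasis.hasSum_kp`. -/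
lemma IsAkp.sub (hb : IsBlochBasis L W E v dv) (hW : IsCrystalPotential L W) (hL : L.det ≠ 0)
    {ε : ℝ} {g g' h h' : EnvSpace d} (hg : IsAkp E (gradElem L v dv) ε g h)
    (hg' : IsAkp E (gradElem L v dv) ε g' h') :
    IsAkp E (gradElem L v dv) ε (g - g') (h - h') := by
  filter_upwards [hg, hg', coeFn_sub_env g g', coeFn_sub_env h h', ae_summable_sq g,
    ae_summable_sq g'] with k ⟨h1, h2⟩ ⟨h1', h2'⟩ h3 h4 h5 h5'
  refine ⟨?_, fun n => ?_⟩
  · refine Summable.of_nonneg_of_le (fun _ => sq_nonneg _) (fun n => ?_)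
      ((h1.mul_left 2).add (h1'.mul_left 2))
    rw [h3, mul_sub]
    have := norm_sub_le ((E n : ℂ) * g n k) ((E n : ℂ) * g' n k)
    nlinarith [sq_nonneg (‖(E n : ℂ) * g n k‖ - ‖(E n : ℂ) * g' n k‖),
      norm_nonneg ((E n : ℂ) * g n k - (E n : ℂ) * g' n k)]
  · have e := ((hb.hasSum_kp hW hL k h5 h1 n).sub (hb.hasSum_kp hW hL k h5' h1' n)).tsum_eq
    simp only [← mul_sub] at e
    simp only [h3, e]
    rw [h4, h2, h2', (hb.hasSum_kp hW hL k h5 h1 n).tsum_eq,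
      (hb.hasSum_kp hW hL k h5' h1' n).tsum_eq]
    ring

lemma coeFn_env (a : Weight (Sp d)) (g : EnvSpace d) :
    ∀ᵐ k : Sp d, ∀ n, a.env volume g n k = (a.toFun k : ℂ) * g n k := by
  rw [ae_all_iff]
  intro n
  rw [Weight.env_apply]
  exact a.coeFn_mul (g n)

/-- For fixed `k` the weight is a scalar and the fiber operator is linear. -/
lemma IsAkp.env (a : Weight (Sp d)) {P : ℕ → ℕ → Fin d → ℂ} {ε : ℝ} {g h : EnvSpace d}
    (hg : IsAkp E P ε g h) : IsAkp E P ε (a.env volume g) (a.env volume h) := by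
  filter_upwards [hg, coeFn_env a g, coeFn_env a h] with k ⟨h1, h2⟩ h3 h4
  refine ⟨?_, fun n => ?_⟩
  · refine (h1.mul_left (‖(a.toFun k : ℂ)‖ ^ 2)).congr fun n => ?_
    rw [h3, norm_mul, norm_mul, norm_mul]
    ring
  · have e : ∀ n', (∑ j, (k j : ℂ) * P n n' j) * a.env volume g n' k
        = (a.toFun k : ℂ) * ((∑ j, (k j : ℂ) * P n n' j) * g n' k) := by
      intro n'
      rw [h3]
      ring
    rw [h4, h2, h3, tsum_congr e, tsum_mul_left]
    ring

/-- The `k·p` operator is symmetric. -/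
lemma IsAkp.inner_im (hb : IsBlochBasis L W E v dv) (hW : IsCrystalPotential L W)
    (hL : L.det ≠ 0) {ε : ℝ} {g h : EnvSpace d} (hg : IsAkp E (gradElem L v dv) ε g h) :
    (inner ℂ g h).im = 0 := by
  have hI : ∀ n, Integrable fun k : Sp d => conj (g n k) * h n k := by
    intro n
    have := L2.integrable_inner (𝕜 := ℂ) (g n) (h n)
    simpa only [RCLike.inner_apply, mul_comm] using this
  have h1 := (lp.hasSum_inner (𝕜 := ℂ) g h).mapL Complex.imCLM
  have h2 : ∀ n, (inner ℂ (g n) (h n)).im = ∫ k : Sp d, (conj (g n k) * h n k).im := by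
    intro n
    have := integral_im (hI n)
    simp only [RCLike.im_eq_complex_im] at this
    rw [this, L2.inner_def]
    simp only [RCLike.inner_apply, mul_comm]
  simp only [Complex.imCLM_apply] at h1
  simp only [h2] at h1
  have hsq : ∀ f : Lp ℂ 2 (volume : Measure (Sp d)), Integrable fun k => ‖f k‖ ^ 2 :=
    fun f => (Lp.memLp f).integrable_norm_pow (p := 2) (by norm_num)
  -- Exchange of sum over `n` and integral over `k`, justified by `‖g_n‖‖h_n‖ ≤ ‖g_n‖² + ‖h_n‖²`;
  -- the fibers then contribute zero one `k` at a time.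
  have h3 := hasSum_integral_of_summable_integral_norm (fun n => (hI n).im) (by
    refine Summable.of_nonneg_of_le (fun _ => integral_nonneg fun _ => norm_nonneg _) (fun n => ?_)
      ((summable_norm_sq g).add (summable_norm_sq h))
    rw [← integral_norm_sq_coeFn, ← integral_norm_sq_coeFn, ← integral_add (hsq _) (hsq _)]
    refine integral_mono (hI n).im.norm ((hsq _).add (hsq _)) fun k => ?_
    have h4 : ‖RCLike.im (conj (g n k) * h n k)‖ ≤ ‖g n k‖ * ‖h n k‖ := by
      refine (Complex.abs_im_le_norm _).trans (le_of_eq ?_)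
      rw [norm_mul, RCLike.norm_conj]
    refine h4.trans ?_
    change _ ≤ ‖g n k‖ ^ 2 + ‖h n k‖ ^ 2
    nlinarith [sq_nonneg (‖g n k‖ - ‖h n k‖), sq_nonneg (‖g n k‖), sq_nonneg (‖h n k‖)])
  simp only [RCLike.im_eq_complex_im] at h3
  have h5 : ∫ k : Sp d, ∑' n, (conj (g n k) * h n k).im = 0 := by
    refine integral_eq_zero_of_ae ?_
    filter_upwards [hg, ae_summable_sq g] with k ⟨h6, h7⟩ h8
    simp only [h7]
    exact (hb.hasSum_im_fiber hW hL ε k h8 h6).tsum_eq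
  rw [h5] at h3
  exact h1.unique h3

end Akp

/-! ### Energy estimate for mild solutions -/

section Energy

variable {H : Type*} [NormedAddCommGroup H] [InnerProductSpace ℂ H] [NormedSpace ℝ H]

/-- The symmetric part drops out: `d/dt ‖F‖² = 2 Im⟨F,b⟩ ≤ 2c‖F‖² + 2η‖F‖ ≤ (2c+1)‖F‖² + η²`, and
Grönwall applies. The extra `1` pays for the source and keeps the exponent positive when `c = 0`. -/
lemma sq_norm_le_of_symmetric_evolution {F : ℝ → H} {τ c η : ℝ} (hc : 0 ≤ c)
    (hF : ContinuousOn F (Icc 0 τ))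
    (hF' : ∀ t ∈ Ico 0 τ, ∃ a b, HasDerivAt F (-(Complex.I • (a + b))) t ∧
      (inner ℂ (F t) a).im = 0 ∧ ‖b‖ ≤ c * ‖F t‖ + η) :
    ∀ t ∈ Icc 0 τ, ‖F t‖ ^ 2 ≤ (‖F 0‖ ^ 2 + η ^ 2) * Real.exp ((2 * c + 1) * t) := by
  have hK : 0 < 2 * c + 1 := by positivity
  have key : ∀ t ∈ Ico 0 τ, ∃ x, HasDerivAt (fun s => ‖F s‖ ^ 2) x t ∧
      x ≤ (2 * c + 1) * ‖F t‖ ^ 2 + η ^ 2 := by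
    intro t ht
    obtain ⟨a, b, h1, h2, h3⟩ := hF' t ht
    have h4 := Complex.reCLM.hasFDerivAt.comp_hasDerivAt t (h1.inner ℂ h1)
    have h5 : ∀ s, Complex.reCLM (inner ℂ (F s) (F s)) = ‖F s‖ ^ 2 := fun s => by
      have := inner_self_eq_norm_sq (𝕜 := ℂ) (F s)
      exact this
    refine ⟨_, h4.congr_of_eventuallyEq (Eventually.of_forall fun s => (h5 s).symm), ?_⟩
    have h6 : (inner ℂ (F t) (-(Complex.I • (a + b)))).re = (inner ℂ (F t) b).im := by
      rw [inner_neg_right, inner_smul_right, inner_add_right, Complex.neg_re, Complex.I_mul_re,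
        Complex.add_im, h2, zero_add, neg_neg]
    have h7 : (inner ℂ (-(Complex.I • (a + b))) (F t)).re = (inner ℂ (F t) b).im := by
      rw [← inner_conj_symm, Complex.conj_re, h6]
    have h8 : (inner ℂ (F t) b).im ≤ ‖F t‖ * ‖b‖ :=
      ((le_abs_self _).trans (Complex.abs_im_le_norm _)).trans (norm_inner_le_norm _ _)
    rw [Complex.reCLM_apply, Complex.add_re, h6, h7]
    nlinarith [mul_le_mul_of_nonneg_left h3 (norm_nonneg (F t)), sq_nonneg (‖F t‖ - η)]
  choose! f' hf' hb using key
  intro t ht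
  have h := le_gronwallBound_of_liminf_deriv_right_le (f := fun s => ‖F s‖ ^ 2) (f' := f')
    (δ := ‖F 0‖ ^ 2) (hF.norm.pow 2)
    (fun x hx r hr => (hf' x hx).hasDerivWithinAt.liminf_right_slope_le hr) le_rfl hb t ht
  refine h.trans ?_
  rw [gronwallBound_of_K_ne_0 hK.ne', sub_zero]
  have h1 : η ^ 2 / (2 * c + 1) ≤ η ^ 2 := div_le_self (sq_nonneg _) (by linarith)
  have h2 : 0 ≤ η ^ 2 / (2 * c + 1) := by positivity
  have h3 := Real.exp_pos ((2 * c + 1) * t)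
  nlinarith [mul_le_mul_of_nonneg_right h1 h3.le]

variable [IsScalarTower ℝ ℂ H] [CompleteSpace H]

/-- Comparison of two mild solutions, generated by bounded perturbations of the same symmetric
operator, in terms of a weight that commutes with the latter. -/
lemma norm_sub_le_of_mild_of_continuous {A : H → H → Prop} {U U₀ M : H →L[ℂ] H} {c η τ : ℝ}
    (hc : 0 ≤ c) (hη : 0 ≤ η)
    (hzero : ∀ a, A 0 a → a = 0)
    (hsub : ∀ x y a b, A x a → A y b → A (x - y) (a - b))
    (hsymm : ∀ x a, A x a → (inner ℂ x a).im = 0)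
    (hM : ∀ x a, A x a → A (M x) (M a))
    (hU : ∀ x, ‖U x‖ ≤ c * ‖x‖) (hU₀ : ∀ x, ‖M (U₀ x)‖ ≤ c * ‖M x‖)
    (hUU₀ : ∀ x, ‖U x - U₀ x‖ ≤ η * ‖M x‖)
    {g₀ : H} {g f : ℝ → H} (hgc : Continuous g) (hfc : Continuous f)
    (hg : ∀ t, 0 ≤ t → ∃ a, A (∫ s in (0 : ℝ)..t, g s) a ∧
      g t = g₀ - Complex.I • (a + U (∫ s in (0 : ℝ)..t, g s)))
    (hf : ∀ t, 0 ≤ t → ∃ a, A (∫ s in (0 : ℝ)..t, f s) a ∧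
      f t = g₀ - Complex.I • (a + U₀ (∫ s in (0 : ℝ)..t, f s)))
    {t : ℝ} (ht : t ∈ Icc 0 τ) :
    ‖g t - f t‖ ≤ η * Real.exp ((2 * c + 1) * τ) * ‖M g₀‖ := by
  set K := 2 * c + 1 with hKdef
  have hK : 0 < K := by positivity
  have hτ : 0 ≤ τ := ht.1.trans ht.2
  set G : ℝ → H := fun t => ∫ s in (0 : ℝ)..t, g s with hG
  set Φ : ℝ → H := fun t => ∫ s in (0 : ℝ)..t, f s with hΦ
  have hG' : ∀ t, HasDerivAt G (g t) t := fun t => (hgc.integral_hasStrictDerivAt 0 t).hasDerivAt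
  have hΦ' : ∀ t, HasDerivAt Φ (f t) t := fun t => (hfc.integral_hasStrictDerivAt 0 t).hasDerivAt
  have hg0 : g 0 = g₀ := by
    obtain ⟨a, h1, h2⟩ := hg 0 le_rfl
    rw [intervalIntegral.integral_same] at h1 h2
    rw [h2, hzero a h1, map_zero, add_zero, smul_zero, sub_zero]
  have hf0 : f 0 = g₀ := by
    obtain ⟨a, h1, h2⟩ := hf 0 le_rfl
    rw [intervalIntegral.integral_same] at h1 h2
    rw [h2, hzero a h1, map_zero, add_zero, smul_zero, sub_zero]
  -- Norms, unlike their squares, grow with exponent `K/2`. The two successive estimates each cost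
  -- one factor `e`, giving `exp(Kτ)` in total.
  set e := Real.exp (K * τ / 2) with he
  have he2 : e ^ 2 = Real.exp (K * τ) := by
    rw [he, ← Real.exp_nat_mul]
    congr 1
    push_cast
    ring
  have hepos : 0 < e := Real.exp_pos _
  have hexp : ∀ s ∈ Icc 0 τ, Real.exp (K * s) ≤ e ^ 2 := by
    intro s hs
    rw [he2]
    gcongr
    exact hs.2
  -- Increments of the time integrals are differentiable, lie in the domain, and by linearity
  -- satisfy the homogeneous equation with no initial term.
  have hshift : ∀ {F : ℝ → H} {F' : ℝ → H} (h s : ℝ), (∀ t, HasDerivAt F (F' t) t) →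
      HasDerivAt (fun s => F (s + h) - F s) (F' (s + h) - F' s) s := fun h s hF =>
    ((hF (s + h)).comp_add_const s h).sub (hF s)
  have hMy : ∀ h, 0 < h → ∀ s ∈ Icc 0 τ,
      ‖M (Φ (s + h) - Φ s)‖ ≤ e * ‖M (Φ (0 + h) - Φ 0)‖ := by
    intro h hh s hs
    have hder : ∀ s, HasDerivAt (fun s => M (Φ (s + h) - Φ s)) (M (f (s + h) - f s)) s :=
      fun s => (M.restrictScalars ℝ).hasFDerivAt.comp_hasDerivAt s (hshift h s hΦ')
    have h1 := sq_norm_le_of_symmetric_evolution (τ := τ) (η := 0) hc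
      (continuous_iff_continuousAt.2 fun s => (hder s).continuousAt).continuousOn
      (fun s hs => by
        obtain ⟨a₁, ha₁, e₁⟩ := hf (s + h) (add_nonneg hs.1 hh.le)
        obtain ⟨a₂, ha₂, e₂⟩ := hf s hs.1
        refine ⟨M (a₁ - a₂), M (U₀ (Φ (s + h) - Φ s)), ?_,
          hsymm _ _ (hM _ _ (hsub _ _ _ _ ha₁ ha₂)), ?_⟩
        · have e₃ : -(Complex.I • (M (a₁ - a₂) + M (U₀ (Φ (s + h) - Φ s))))
              = M (f (s + h) - f s) := by
            rw [← map_add, ← map_smul, ← map_neg, e₁, e₂, map_sub]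
            congr 1
            module
          rw [e₃]
          exact hder s
        · rw [add_zero]
          exact hU₀ _) s hs
    refine le_of_sq_le_sq ?_ (by positivity)
    refine h1.trans ?_
    rw [mul_pow, mul_comm]
    simp only [ne_eq, OfNat.ofNat_ne_zero, not_false_eq_true, zero_pow, add_zero]
    exact mul_le_mul_of_nonneg_right (hexp s hs) (sq_nonneg _)
  have hD : ∀ h, 0 < h → ‖(G (t + h) - G t) - (Φ (t + h) - Φ t)‖ ^ 2
      ≤ (‖(G (0 + h) - G 0) - (Φ (0 + h) - Φ 0)‖ ^ 2
        + (η * (e * ‖M (Φ (0 + h) - Φ 0)‖)) ^ 2) * Real.exp (K * t) := by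
    intro h hh
    have hder : ∀ s, HasDerivAt (fun s => (G (s + h) - G s) - (Φ (s + h) - Φ s))
        ((g (s + h) - g s) - (f (s + h) - f s)) s :=
      fun s => (hshift h s hG').sub (hshift h s hΦ')
    refine sq_norm_le_of_symmetric_evolution (τ := τ) hc
      (continuous_iff_continuousAt.2 fun s => (hder s).continuousAt).continuousOn
      (fun s hs => ?_) t ht
    obtain ⟨a₁, ha₁, e₁⟩ := hg (s + h) (add_nonneg hs.1 hh.le)
    obtain ⟨a₂, ha₂, e₂⟩ := hg s hs.1
    obtain ⟨b₁, hb₁, e₃⟩ := hf (s + h) (add_nonneg hs.1 hh.le)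
    obtain ⟨b₂, hb₂, e₄⟩ := hf s hs.1
    -- The difference evolves under `A + U`, with the source `(U - U₀)` applied to the increment of
    -- the second solution; `hMy` has bounded that in the weighted norm.
    refine ⟨(a₁ - a₂) - (b₁ - b₂), U ((G (s + h) - G s) - (Φ (s + h) - Φ s))
      + (U (Φ (s + h) - Φ s) - U₀ (Φ (s + h) - Φ s)), ?_,
      hsymm _ _ (hsub _ _ _ _ (hsub _ _ _ _ ha₁ ha₂) (hsub _ _ _ _ hb₁ hb₂)), ?_⟩
    · convert hder s using 1
      rw [e₁, e₂, e₃, e₄]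
      simp only [map_sub]
      module
    · refine (norm_add_le _ _).trans (add_le_add (hU _) ((hUU₀ _).trans ?_))
      exact mul_le_mul_of_nonneg_left (hMy h hh s ⟨hs.1, hs.2.le⟩) hη
  have hslope : ∀ {F : ℝ → H} {F' : H} {s : ℝ}, HasDerivAt F F' s →
      Tendsto (fun h : ℝ => h⁻¹ • (F (s + h) - F s)) (𝓝[>] 0) (𝓝 F') := fun hF =>
    hF.tendsto_slope_zero_right
  -- Dividing by `h` and letting `h` decrease to zero turns increments into the solutions. At time
  -- zero the two slopes have the same limit `g₀`, so only the source term remains.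
  have l1 := (((hslope (hG' t)).sub (hslope (hΦ' t))).norm).pow 2
  have l2 := (((hslope (hG' 0)).sub (hslope (hΦ' 0))).norm).pow 2
  have l3 := (((((M.continuous.tendsto _).comp (hslope (hΦ' 0))).norm).const_mul e).const_mul η).pow
    2
  have l4 := (l2.add l3).mul_const (Real.exp (K * t))
  have hlim := le_of_tendsto_of_tendsto l1 l4 (by
    filter_upwards [self_mem_nhdsWithin] with h hh
    have hsc : ∀ x : H, ‖h⁻¹ • x‖ = h⁻¹ * ‖x‖ := fun x => by
      rw [norm_smul, Real.norm_of_nonneg (inv_nonneg.2 (le_of_lt hh))]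
    have hMsc : M (h⁻¹ • (Φ (0 + h) - Φ 0)) = h⁻¹ • M (Φ (0 + h) - Φ 0) :=
      (M.restrictScalars ℝ).map_smul _ _
    simp only [Function.comp_apply]
    rw [← smul_sub, ← smul_sub, hMsc, hsc, hsc, hsc]
    have := mul_le_mul_of_nonneg_left (hD h hh) (sq_nonneg h⁻¹)
    calc _ = h⁻¹ ^ 2 * ‖(G (t + h) - G t) - (Φ (t + h) - Φ t)‖ ^ 2 := by ring
      _ ≤ _ := this
      _ = _ := by ring)
  rw [hg0, hf0, sub_self, norm_zero] at hlim
  refine le_of_sq_le_sq (hlim.trans ?_) (by positivity)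
  have := hexp t ht
  rw [← he2]
  calc _ = (η * (e * ‖M g₀‖)) ^ 2 * Real.exp (K * t) := by ring
    _ ≤ (η * (e * ‖M g₀‖)) ^ 2 * e ^ 2 := by gcongr
    _ = _ := by ring

/-- Replacing `g(s)` by `g(max(0,s))` gives functions continuous on the whole line, with two-sided
derivatives of the time integrals at `0`, and changes nothing for nonnegative times. -/
lemma norm_sub_le_of_mild {A : H → H → Prop} {U U₀ M : H →L[ℂ] H} {c η τ : ℝ}
    (hc : 0 ≤ c) (hη : 0 ≤ η)
    (hzero : ∀ a, A 0 a → a = 0)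
    (hsub : ∀ x y a b, A x a → A y b → A (x - y) (a - b))
    (hsymm : ∀ x a, A x a → (inner ℂ x a).im = 0)
    (hM : ∀ x a, A x a → A (M x) (M a))
    (hU : ∀ x, ‖U x‖ ≤ c * ‖x‖) (hU₀ : ∀ x, ‖M (U₀ x)‖ ≤ c * ‖M x‖)
    (hUU₀ : ∀ x, ‖U x - U₀ x‖ ≤ η * ‖M x‖)
    {g₀ : H} {g f : ℝ → H} (hgc : ContinuousOn g (Ici 0)) (hfc : ContinuousOn f (Ici 0))
    (hg : ∀ t, 0 ≤ t → ∃ a, A (∫ s in (0 : ℝ)..t, g s) a ∧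
      g t = g₀ - Complex.I • (a + U (∫ s in (0 : ℝ)..t, g s)))
    (hf : ∀ t, 0 ≤ t → ∃ a, A (∫ s in (0 : ℝ)..t, f s) a ∧
      f t = g₀ - Complex.I • (a + U₀ (∫ s in (0 : ℝ)..t, f s)))
    {t : ℝ} (ht : t ∈ Icc 0 τ) :
    ‖g t - f t‖ ≤ η * Real.exp ((2 * c + 1) * τ) * ‖M g₀‖ := by
  have hcont : ∀ {F : ℝ → H}, ContinuousOn F (Ici 0) → Continuous fun s => F (max 0 s) :=
    fun hF => hF.comp_continuous (by fun_prop) fun s => mem_Ici.2 (le_max_left _ _)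
  have hInt : ∀ (F : ℝ → H) (t : ℝ), 0 ≤ t →
      ∫ s in (0 : ℝ)..t, F (max 0 s) = ∫ s in (0 : ℝ)..t, F s := fun F t ht =>
    intervalIntegral.integral_congr fun s hs => by
      rw [uIcc_of_le ht] at hs
      simp only [max_eq_right hs.1]
  have h := norm_sub_le_of_mild_of_continuous (g₀ := g₀) (τ := τ) (t := t) hc hη hzero hsub hsymm
    hM hU hU₀ hUU₀ (hcont hgc) (hcont hfc)
    (fun t ht => by rw [hInt g t ht, max_eq_right ht]; exact hg t ht)
    (fun t ht => by rw [hInt f t ht, max_eq_right ht]; exact hf t ht) ht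
  rwa [max_eq_right ht.1] at h

end Energy

/-! ### Assembly of the estimates. -/

section Main

variable {L : Matrix (Fin d) (Fin d) ℝ} {W : Sp d → ℝ} {E : ℕ → ℝ} {v : ℕ → Sp d → ℂ}
  {dv : ℕ → Fin d → Sp d → ℂ}

lemma IsAkp.eq_zero {P : ℕ → ℕ → Fin d → ℂ} {ε : ℝ} {a : EnvSpace d} (h : IsAkp E P ε 0 a) :
    a = 0 := by
  ext1
  funext n
  refine (Lp.eq_zero_iff_ae_eq_zero).2 ?_
  filter_upwards [h] with k ⟨_, h2⟩
  rw [h2]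
  simp

/-- The truncated weight is dominated by the weight of `𝓛²_μ`. -/
lemma norm_kpWeight_env_le {μ R : ℝ} (hR : 0 < R) {g : EnvSpace d} (hg : MemL2mu μ g) :
    ‖(kpWeight d μ R hR).env volume g‖ ≤ normL2mu μ g := by
  set a := kpWeight d μ R hR
  refine Real.le_sqrt_of_sq_le ?_
  have h1 : ‖a.env volume g‖ ^ 2 = ∑' n, ‖a.env volume g n‖ ^ 2 := by
    have := lp.norm_rpow_eq_tsum (p := 2) (by norm_num) (a.env volume g)
    simpa using this
  rw [h1, ← ENNReal.ofReal_le_iff_le_toReal hg.ne,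
    ENNReal.ofReal_tsum_of_nonneg (fun _ => sq_nonneg _) (summable_norm_sq _)]
  refine ENNReal.tsum_le_tsum fun n => ?_
  rw [ENNReal.ofReal_pow (norm_nonneg _), Lp.norm_def,
    ENNReal.ofReal_toReal (Lp.eLpNorm_ne_top _), sq_eLpNorm_two]
  refine lintegral_mono_ae ?_
  filter_upwards [a.coeFn_mul (g n)] with k hk
  rw [Weight.env_apply, hk, enorm_mul, mul_pow]
  gcongr
  have h2 : ‖(a.toFun k : ℂ)‖ₑ = ENNReal.ofReal (a.toFun k) := by
    rw [← ofReal_norm, Complex.norm_real, Real.norm_of_nonneg (kpWeight_pos hR k).le]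
  rw [h2, ← ENNReal.ofReal_pow (kpWeight_pos hR k).le]
  refine ENNReal.ofReal_le_ofReal ?_
  calc a.toFun k ^ 2 ≤ ((1 + ‖k‖ ^ 2) ^ (μ / 2)) ^ 2 :=
        pow_le_pow_left₀ (kpWeight_pos hR k).le (min_le_left _ _) 2
    _ = (1 + ‖k‖ ^ 2) ^ μ := by
        rw [← Real.rpow_natCast, ← Real.rpow_mul (by positivity)]
        congr 1
        push_cast
        ring

/-- The abstract comparison with `M` the truncated weight, `U` and `U₀` the compressions `coeffs ∘
op ∘ synth`, and `η = 2c(r/ε)^{-μ}`. Isometry of `synth` and contractivity of `coeffs` carry over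
the kernel bounds. -/
lemma IsPotHat.norm_mild_sub_le {μ c : ℝ} {V : Sp d → Sp d → ℝ} {Vhat : Sp d → Sp d → ℂ}
    (hL : L.det ≠ 0) (h : IsPotHat L μ c V Vhat) (hVper : ∀ x, IsPeriodic L (V x)) {r : ℝ}
    (hr : 0 < r) (hrL : ∀ t : Fin d → ℝ, (∃ i, 1 / 2 ≤ |t i|) → r ≤ ‖latMap (recip L) t‖)
    (hW : IsCrystalPotential L W) (hb : IsBlochBasis L W E v dv) {ε : ℝ} (hε : 0 < ε)
    {gin : EnvSpace d} (hgin : MemL2mu μ gin) {g gkp : ℝ → EnvSpace d}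
    (hg : IsMildSolution (IsAkp E (gradElem L v dv) ε) (IsUeps L v V ε) gin g)
    (hgkp : IsMildSolution (IsAkp E (gradElem L v dv) ε) (IsU0 L v V) gin gkp)
    {τ t : ℝ} (ht : t ∈ Icc 0 τ) :
    ‖g t - gkp t‖
      ≤ ((r / ε) ^ μ)⁻¹ * (c + c) * Real.exp ((2 * c + 1) * τ) * normL2mu μ gin := by
  have hR : 0 < (r / ε) ^ μ := Real.rpow_pos_of_pos (div_pos hr hε) μ
  set R := (r / ε) ^ μ with hRdef
  have hv : IsONSystem (volume.restrict (cell L)) v := ⟨hb.memLp, hb.orthonormal⟩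
  have hεL := det_smul_ne_zero hL hε.ne'
  have hw : ∀ t : Fin d → ℝ, (∃ i, 1 / 2 ≤ |t i|) →
      (kpWeight d μ R hR).toFun (latMap (recip (ε • L)) t) = R := by
    intro t ht
    refine kpWeight_eq_of_le h.mu_nonneg hR hr hε hRdef ?_
    rw [recip_smul hL hε.ne', latMap_smul, norm_smul, norm_inv, Real.norm_of_nonneg hε.le,
      div_eq_inv_mul]
    exact mul_le_mul_of_nonneg_left (hrL t ht) (by positivity)
  set S := (hv.synth (volume : Measure (Sp d))).toContinuousLinearMap
  set U : EnvSpace d →L[ℂ] EnvSpace d :=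
    (hv.coeffs volume).comp ((h.isSchur_kernelEps (det_recip hεL) ε).op.comp S)
  set U₀ : EnvSpace d →L[ℂ] EnvSpace d :=
    (hv.coeffs volume).comp (h.isSchur_kernel0.op.comp S)
  have hc := h.nonneg
  have hη : 0 ≤ R⁻¹ * (c + c) := by positivity
  have hnorm : ∀ x, ‖((kpWeight d μ R hR).fst (Sp d)).mul _ (hv.synth volume x)‖
      = ‖(kpWeight d μ R hR).env volume x‖ := fun x => by
    rw [← hv.synth_env, LinearIsometry.norm_map]
  have key := norm_sub_le_of_mild (A := IsAkp E (gradElem L v dv) ε) (U := U) (U₀ := U₀)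
    (M := (kpWeight d μ R hR).env volume) (c := c) (η := R⁻¹ * (c + c)) (g₀ := gin) (g := g)
    (f := gkp) hc hη (fun a ha => ha.eq_zero) (fun x y a b hx hy => hx.sub hb hW hL hy)
    (fun x a hx => hx.inner_im hb hW hL) (fun x a hx => hx.env _)
    (fun x => by
      refine (hv.norm_coeffs_le _).trans
        (((h.isSchur_kernelEps (det_recip hεL) ε).norm_op_apply_le _).trans_eq ?_)
      exact congrArg _ ((hv.synth volume).norm_map x))
    (fun x => by
      rw [← hnorm x]
      refine le_trans ?_ (h.norm_weight_op0_le hR (hv.synth volume x))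
      change ‖(kpWeight d μ R hR).env volume
        (hv.coeffs volume (h.isSchur_kernel0.op (hv.synth volume x)))‖ ≤ _
      rw [← hv.coeffs_mul]
      exact hv.norm_coeffs_le _)
    (fun x => by
      rw [← hnorm x]
      refine le_trans ?_ (h.norm_opEps_sub_op0_le (det_recip hεL) ε hR hw (hv.synth volume x))
      change ‖hv.coeffs volume ((h.isSchur_kernelEps (det_recip hεL) ε).op (hv.synth volume x))
        - hv.coeffs volume (h.isSchur_kernel0.op (hv.synth volume x))‖ ≤ _
      rw [← map_sub]
      exact hv.norm_coeffs_le _)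
    hg.1 hgkp.1
    (fun t ht => by
      obtain ⟨a, u, ha, hu, e⟩ := hg.2 t ht
      refine ⟨a, ha, ?_⟩
      have h1 := congrArg (hv.coeffs volume)
        (IsPotHat.synth_eq_of_isUeps hL hε h hVper hv hb.periodic hu)
      rw [hv.coeffs_synth] at h1
      rw [e, h1]
      rfl)
    (fun t ht => by
      obtain ⟨a, u, ha, hu, e⟩ := hgkp.2 t ht
      refine ⟨a, ha, ?_⟩
      rw [e, h.eq_of_isU0 hv hu]
      rfl) ht
  refine key.trans (mul_le_mul_of_nonneg_left (norm_kpWeight_env_le hR hgin) (by positivity))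

end Main


end KP

end

theorem theorem5p3 {d : ℕ} (L : Matrix (Fin d) (Fin d) ℝ) (hL : L.det ≠ 0)
    (μ : ℝ) (hμ : 0 ≤ μ) (V : KP.Sp d → KP.Sp d → ℝ) (hV : KP.MemW L μ V)
    (τ : ℝ) (hτ : 0 ≤ τ) :
    ∃ C : ℝ, 0 ≤ C ∧
      ∀ (W : KP.Sp d → ℝ) (E : ℕ → ℝ) (v : ℕ → KP.Sp d → ℂ) (dv : ℕ → Fin d → KP.Sp d → ℂ),
        KP.IsCrystalPotential L W → KP.IsBlochBasis L W E v dv →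
      ∀ (ε : ℝ), 0 < ε →
      ∀ (gin : KP.EnvSpace d), KP.MemL2mu μ gin →
      ∀ (g gkp : ℝ → KP.EnvSpace d),
        KP.IsMildSolution (KP.IsAkp E (KP.gradElem L v dv) ε) (KP.IsUeps L v V ε) gin g →
        KP.IsMildSolution (KP.IsAkp E (KP.gradElem L v dv) ε) (KP.IsU0 L v V) gin gkp →
      ∀ t ∈ Set.Icc (0 : ℝ) τ,
        ‖g t - gkp t‖ ≤ ε ^ μ * C * KP.normL2mu μ gin := by
  obtain ⟨c, Vhat, h⟩ := hV.exists_isPotHat hμ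
  obtain ⟨r, hr, hrL⟩ := KP.exists_le_norm_latMap (KP.det_recip hL)
  have hc := h.nonneg
  -- Here `c` comes from `V` and `r` from the lattice, so the constant is fixed before the crystal
  -- potential, `ε` and the data. The factor `ε^μ` comes from `((r/ε)^μ)⁻¹ = ε^μ (r^μ)⁻¹`.
  refine ⟨(r ^ μ)⁻¹ * (c + c) * Real.exp ((2 * c + 1) * τ), by positivity, ?_⟩
  intro W E v dv hW hb ε hε gin hgin g gkp hg hgkp t ht
  refine (h.norm_mild_sub_le hL hV.periodic hr hrL hW hb hε hgin hg hgkp ht).trans_eq ?_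
  rw [Real.div_rpow hr.le hε.le, inv_div]
  ring
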